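/- Let $G$ be a finite-dimensional Lie group acting smoothly on a (finite-dimensional, Hausdorff, smooth) manifold $M$. Let $C^k(G,A)$ denote the nonhomogeneous $k$-cochains of $G$ with values in a right $G$-module $A$, with the differential $$(Dc)(g_1,\dots,g_{k+1})=c(g_2,\dots,g_{k+1})+\sum_{i=1}^k(-1)^ic(g_1,\dots,g_ig_{i+1},\dots,g_{k+1})+(-1)^{k+1}c(g_1,\dots,g_k)g_{k+1}.$$ For $A=\Omega^j(M)$, with $G$ acting by pullback, write $\delta'=D$, and put $\delta''c=(-1)^k\,d\circ c$ for $c\in C^k(G,\Omega^j(M))$; for the action of $G$ on itself by left translations write $\delta'_G$ and $d_G$ for $\delta'$ on $C^*(G,\Omega^j(G))$ and for the exterior derivative on $G$. A cochain in $C^k(G,A)$, where $A=\mathbb R$ or $A$ is a space of smooth forms with the $C^\infty$-topology, is called differentiable if it is a $C^\infty$ map $G^k\to A$; write $C^k_{\mathrm{diff}}(G,A)$ for the space of these. Let $\omega$ be a $G$-invariant exact $m$-form on $M$, let $1\le p\le m-1$, and assume $H^{m-p}(M)=\dots=H^{m-1}(M)=0$ and $H^{m-p-1}(M)\ne0$ (real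 cohomology). Let $\varphi_{i,m-i-1}\in C^i(G,\Omega^{m-i-1}(M))$, $0\le i\le p$, satisfy $\omega=-d\varphi_{0,m-1}$ and $\delta'\varphi_{i-1,m-i}+\delta''\varphi_{i,m-i-1}=0$ for $1\le i\le p$, and assume that $\varphi_{i,m-i-1}$ is differentiable for $1\le i\le p$. Let $\alpha$ be a smooth singular $(m-p-1)$-cycle of $M$ (real coefficients) whose homology class $a$ is $G$-invariant, and put $$c_a(\omega)(g_1,\dots,g_{p+1})=\int_\alpha(\delta'\varphi_{p,m-p-1})(g_1,\dots,g_{p+1}).$$ With $q=m-p-1$, let $f_\alpha:\Omega^{q+k}(M)\to\Omega^k(G)$ be the map $$f_\alpha(\theta)(X_1^r,\dots,X_k^r)(g)=\int_\alpha\varphi_g^*\bigl(i(\tilde X_k)\cdots i(\tilde X_1)\theta\bigr),$$ where $X_1,\dots,X_k\in T_eG$, $X_i^r$ is the right invariant vector field on $G$ with $X_i^r(e)=X_i$, $\tilde X_i$ is the fundamental vector field of $X_i$ on $M$, and $\varphi_g(x)=gx$. (1) If $c_a(\omega)$ is trivial in the complex of differentiable cochains, i.e. $c_a(\omega)=Db$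 for some $b\in C^p_{\mathrm{diff}}(G,\mathbb R)$ (trivial $G$-module $\mathbb R$), then there is $f\in C^{p-1}_{\mathrm{diff}}(G,\Omega^0(G))$ with $$\delta'_G\bigl(f_\alpha\circ\varphi_{p-1,m-p}-d_G\circ f\bigr)=0.$$ (2) If $G$ is connected and such an $f$ exists, then $c_a(\omega)$ is trivial in the complex of differentiable cochains. -/

import Mathlib

open Set MeasureTheory
open scoped Manifold ContDiff Topology

noncomputable section

/-! ### Differential forms

A manifold `M` is modelled on a finite-dimensional real vector space `E` (no boundary), through
`ChartedSpace E M`.  A form is first a section of alternating maps on tangent spaces; smoothness is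
a separate predicate, and `smoothForms E M k` is the space of smooth `k`-forms. -/

section Forms

variable (E : Type*) [NormedAddCommGroup E] [NormedSpace ℝ E]
  (M : Type*) [TopologicalSpace M] [ChartedSpace E M]

/-- Not necessarily smooth differential `k`-forms on `M`: families of alternating `k`-linear
forms on the tangent spaces. -/
def DForm (k : ℕ) : Type _ :=
  ∀ x : M, TangentSpace 𝓘(ℝ, E) x [⋀^Fin k]→L[ℝ] ℝ

instance (k : ℕ) : AddCommGroup (DForm E M k) :=
  inferInstanceAs (AddCommGroup (∀ x : M, TangentSpace 𝓘(ℝ, E) x [⋀^Fin k]→L[ℝ] ℝ))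

instance (k : ℕ) : Module ℝ (DForm E M k) :=
  inferInstanceAs (Module ℝ (∀ x : M, TangentSpace 𝓘(ℝ, E) x [⋀^Fin k]→L[ℝ] ℝ))

variable {E M}

/-- Tangent spaces of `M` are copies of the model space `E`, through the preferred chart. -/
def tangentModel (x : M) : TangentSpace 𝓘(ℝ, E) x ≃L[ℝ] E := ContinuousLinearEquiv.refl ℝ E

/-- The identity map between the tangent spaces at two equal points. -/
def tangentCast {x y : M} (_h : x = y) : TangentSpace 𝓘(ℝ, E) x ≃L[ℝ] TangentSpace 𝓘(ℝ, E) y :=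
  ContinuousLinearEquiv.refl ℝ E

/-- The coordinate expression of a form in the chart around `x₀`: the pullback of `θ` by the
inverse chart, a form on the (open) target of the chart in `E`. -/
def DForm.chartRep {k : ℕ} (θ : DForm E M k) (x₀ : M) (y : E) : E [⋀^Fin k]→L[ℝ] ℝ :=
  (θ ((extChartAt 𝓘(ℝ, E) x₀).symm y)).compContinuousLinearMap
    ((mfderiv 𝓘(ℝ, E) 𝓘(ℝ, E) (extChartAt 𝓘(ℝ, E) x₀).symm y).comp
      (NormedSpace.fromTangentSpace y).symm.toContinuousLinearMap)

/-- A form is smooth if all its coordinate expressions are. -/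
def DForm.IsSmooth {k : ℕ} (θ : DForm E M k) : Prop :=
  ∀ x₀ : M, ContDiffOn ℝ ∞ (θ.chartRep x₀) (extChartAt 𝓘(ℝ, E) x₀).target

/-- The exterior derivative, computed at `x` in the chart around `x`. -/
def DForm.d {k : ℕ} (θ : DForm E M k) : DForm E M (k + 1) := fun x =>
  (extDeriv (θ.chartRep x) (extChartAt 𝓘(ℝ, E) x x)).compContinuousLinearMap
    ((NormedSpace.fromTangentSpace (extChartAt 𝓘(ℝ, E) x x)).toContinuousLinearMap.comp
      (mfderiv 𝓘(ℝ, E) 𝓘(ℝ, E) (extChartAt 𝓘(ℝ, E) x) x))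

theorem DForm.chartRep_add {k : ℕ} (θ η : DForm E M k) (x₀ : M) :
    (θ + η).chartRep x₀ = θ.chartRep x₀ + η.chartRep x₀ := rfl

theorem DForm.chartRep_smul {k : ℕ} (c : ℝ) (θ : DForm E M k) (x₀ : M) :
    (c • θ).chartRep x₀ = c • θ.chartRep x₀ := rfl

theorem DForm.chartRep_zero {k : ℕ} (x₀ : M) :
    (0 : DForm E M k).chartRep x₀ = 0 := rfl

variable (E M)

/-- The vector space `Ω^k(M)` of smooth `k`-forms. -/
def smoothForms (k : ℕ) : Submodule ℝ (DForm E M k) where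
  carrier := {θ | θ.IsSmooth}
  add_mem' := fun {θ η} hθ hη x₀ => by
    rw [DForm.chartRep_add]; exact (hθ x₀).add (hη x₀)
  zero_mem' := fun x₀ => by
    rw [DForm.chartRep_zero]; exact contDiffOn_const
  smul_mem' := fun c θ hθ x₀ => by
    rw [DForm.chartRep_smul]; exact contDiffOn_const.smul (hθ x₀)

/-- The `C^∞`-topology on `Ω^k(M)`: uniform convergence of the coordinate expressions and of all
their iterated derivatives on all compact subsets of charts. -/
instance smoothForms.instTopologicalSpace (k : ℕ) : TopologicalSpace (smoothForms E M k) :=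
  ⨅ (x₀ : M) (n : ℕ), TopologicalSpace.induced
    (fun θ : smoothForms E M k =>
      UniformOnFun.ofFun {K : Set E | IsCompact K ∧ K ⊆ (extChartAt 𝓘(ℝ, E) x₀).target}
        (iteratedFDeriv ℝ n ((θ : DForm E M k).chartRep x₀)))
    inferInstance

variable {E M}

/-- `θ` is the exterior derivative of a smooth form (in degree `0`: `θ = 0`). -/
def DForm.IsExact : {k : ℕ} → DForm E M k → Prop
  | 0, θ => θ = 0
  | k + 1, θ => ∃ η : smoothForms E M k, (η : DForm E M k).d = θ

variable (E M)

/-- `H^k(M) = 0` for the de Rham cohomology: every closed smooth `k`-form is exact. -/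
def DeRhamVanishes (k : ℕ) : Prop :=
  ∀ θ : smoothForms E M k, (θ : DForm E M k).d = 0 → (θ : DForm E M k).IsExact

variable {E M}

/-- The pullback of a form on `N` by a map `f : M → N`. -/
def DForm.pullback {E' : Type*} [NormedAddCommGroup E'] [NormedSpace ℝ E']
    {N : Type*} [TopologicalSpace N] [ChartedSpace E' N] {k : ℕ}
    (f : M → N) (θ : DForm E' N k) : DForm E M k := fun x =>
  (θ (f x)).compContinuousLinearMap (mfderiv 𝓘(ℝ, E) 𝓘(ℝ, E') f x)

/-- The right action of `G` on forms by pullback along `x ↦ g • x`. -/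
def DForm.act {G : Type*} [SMul G M] {k : ℕ} (g : G) (θ : DForm E M k) : DForm E M k :=
  θ.pullback (fun x : M => g • x)

end Forms

/-! ### Smooth singular chains -/

section Chains

/-- The standard `q`-simplex in `ℝ^q`, with vertices `0, e₁, …, e_q`. -/
def cornerSimplex (q : ℕ) : Set (Fin q → ℝ) := {t | (∀ j, 0 ≤ t j) ∧ ∑ j, t j ≤ 1}

theorem zero_mem_cornerSimplex (q : ℕ) : (0 : Fin q → ℝ) ∈ cornerSimplex q := by
  simp [cornerSimplex]

/-- The `i`-th face inclusion of the standard simplex: insert `0` as the `i`-th barycentric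
coordinate, where `(1 - ∑ t, t₁, …, t_q)` are the barycentric coordinates of `t`. -/
def faceInclusion {q : ℕ} (i : Fin (q + 2)) (t : Fin q → ℝ) : Fin (q + 1) → ℝ := fun j =>
  (i.insertNth (0 : ℝ) (Fin.cons (1 - ∑ l, t l) t : Fin (q + 1) → ℝ) : Fin (q + 2) → ℝ) j.succ

theorem faceInclusion_mapsTo {q : ℕ} (i : Fin (q + 2)) :
    MapsTo (faceInclusion i) (cornerSimplex q) (cornerSimplex (q + 1)) := by
  rintro t ⟨h0, h1⟩
  have hb : ∀ k, 0 ≤ (Fin.cons (1 - ∑ l, t l) t : Fin (q + 1) → ℝ) k := by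
    intro k
    refine Fin.cases ?_ (fun k => ?_) k
    · simpa using h1
    · simpa using h0 k
  have hb' : ∀ k, 0 ≤ (i.insertNth (0 : ℝ)
      (Fin.cons (1 - ∑ l, t l) t : Fin (q + 1) → ℝ) : Fin (q + 2) → ℝ) k := by
    intro k
    refine Fin.succAboveCases i ?_ (fun k => ?_) k
    · simp
    · simpa using hb k
  refine ⟨fun j => hb' _, ?_⟩
  have hs : ∑ k, (i.insertNth (0 : ℝ)
      (Fin.cons (1 - ∑ l, t l) t : Fin (q + 1) → ℝ) : Fin (q + 2) → ℝ) k = 1 := by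
    rw [Fin.sum_insertNth, Fin.sum_cons]; ring
  rw [Fin.sum_univ_succ] at hs
  have := hb' 0
  simp only [faceInclusion]
  linarith

theorem faceInclusion_contDiff {q : ℕ} (i : Fin (q + 2)) : ContDiff ℝ ∞ (faceInclusion (q := q) i) := by
  rw [contDiff_pi]
  intro j
  simp only [faceInclusion]
  generalize j.succ = k
  refine Fin.succAboveCases i ?_ (fun k => ?_) k
  · simpa using contDiff_const
  · simp only [Fin.insertNth_apply_succAbove]
    refine Fin.cases ?_ (fun k => ?_) k
    · simp only [Fin.cons_zero]
      exact contDiff_const.sub (ContDiff.sum fun l _ => contDiff_apply ℝ ℝ l)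
    · simp only [Fin.cons_succ]
      exact contDiff_apply ℝ ℝ k

/-- A function on the standard simplex, extended to `ℝ^q` by a constant. Only the values of the
extension on the simplex matter. -/
def simplexExtend {M : Type*} {q : ℕ} (σ : cornerSimplex q → M) (t : Fin q → ℝ) : M :=
  open Classical in
  if h : t ∈ cornerSimplex q then σ ⟨t, h⟩ else σ ⟨0, zero_mem_cornerSimplex q⟩

theorem simplexExtend_of_mem {M : Type*} {q : ℕ} (σ : cornerSimplex q → M) {t : Fin q → ℝ}
    (h : t ∈ cornerSimplex q) : simplexExtend σ t = σ ⟨t, h⟩ := by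
  simp [simplexExtend, h]

variable (E : Type*) [NormedAddCommGroup E] [NormedSpace ℝ E]
  (M : Type*) [TopologicalSpace M] [ChartedSpace E M]

/-- Smooth singular `q`-simplices of `M`: maps from the standard simplex to `M` that are smooth
(up to the boundary of the simplex). -/
structure SmoothSimplex (q : ℕ) where
  toFun : cornerSimplex q → M
  smooth : ContMDiffOn 𝓘(ℝ, Fin q → ℝ) 𝓘(ℝ, E) ∞ (simplexExtend toFun) (cornerSimplex q)

/-- Smooth singular `q`-chains of `M` with real coefficients. -/
abbrev SmoothChain (q : ℕ) : Type _ := SmoothSimplex E M q →₀ ℝ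

variable {E M}

/-- The `i`-th face of a smooth singular simplex. -/
def SmoothSimplex.face {q : ℕ} (σ : SmoothSimplex E M (q + 1)) (i : Fin (q + 2)) :
    SmoothSimplex E M q where
  toFun := fun t => σ.toFun ⟨faceInclusion i t, faceInclusion_mapsTo i t.2⟩
  smooth := by
    refine (σ.smooth.comp ((faceInclusion_contDiff i).contMDiff.contMDiffOn
      (s := cornerSimplex q)) (faceInclusion_mapsTo i)).congr ?_
    intro t ht
    simp only [Function.comp_apply]
    rw [simplexExtend_of_mem _ ht, simplexExtend_of_mem _ (faceInclusion_mapsTo i ht)]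

/-- The image of a smooth singular simplex under a smooth map. -/
def SmoothSimplex.map {E' : Type*} [NormedAddCommGroup E'] [NormedSpace ℝ E']
    {N : Type*} [TopologicalSpace N] [ChartedSpace E' N] {q : ℕ} (f : M → N)
    (hf : ContMDiff 𝓘(ℝ, E) 𝓘(ℝ, E') ∞ f) (σ : SmoothSimplex E M q) : SmoothSimplex E' N q where
  toFun := fun t => f (σ.toFun t)
  smooth := by
    refine (hf.comp_contMDiffOn σ.smooth).congr ?_
    intro t ht
    simp only [Function.comp_apply]
    rw [simplexExtend_of_mem _ ht, simplexExtend_of_mem _ ht]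

/-- The boundary operator on smooth singular chains. -/
def SmoothChain.boundary {q : ℕ} (c : SmoothChain E M (q + 1)) : SmoothChain E M q :=
  c.sum fun σ r => ∑ i : Fin (q + 2), Finsupp.single (σ.face i) ((-1) ^ (i : ℕ) * r)

/-- A chain is a cycle if its boundary vanishes; every `0`-chain is a cycle. -/
def SmoothChain.IsCycle : {q : ℕ} → SmoothChain E M q → Prop
  | 0, _ => True
  | _ + 1, c => SmoothChain.boundary c = 0

/-- The homology class of the cycle `α` is invariant under `G`: for each `g`, the cycle `g α` is
homologous to `α`. -/
def SmoothChain.HasInvariantClass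
    (F : Type*) [NormedAddCommGroup F] [NormedSpace ℝ F]
    (G : Type*) [TopologicalSpace G] [ChartedSpace F G] [SMul G M]
    [ContMDiffSMul 𝓘(ℝ, F) 𝓘(ℝ, E) ∞ G M] {q : ℕ} (α : SmoothChain E M q) : Prop :=
  ∀ g : G, ∃ β : SmoothChain E M (q + 1), SmoothChain.boundary β =
    α.mapDomain (SmoothSimplex.map (fun x : M => g • x)
      (ContMDiffSMul.contMDiff_const_smul (I := 𝓘(ℝ, F)) g)) - α

variable {V : Type*} [NormedAddCommGroup V] [NormedSpace ℝ V]

/-- The integral over a smooth singular simplex of a `q`-form with values in `V`, here given by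
its values `η x (v₁, …, v_q)`. -/
def SmoothSimplex.integral {q : ℕ} (σ : SmoothSimplex E M q)
    (η : ∀ x : M, (Fin q → TangentSpace 𝓘(ℝ, E) x) → V) : V :=
  ∫ t in cornerSimplex q, η (simplexExtend σ.toFun t) fun j =>
    mfderivWithin 𝓘(ℝ, Fin q → ℝ) 𝓘(ℝ, E) (simplexExtend σ.toFun) (cornerSimplex q) t
      ((NormedSpace.fromTangentSpace t).symm (Pi.single j 1))

/-- The integral over a smooth singular chain. -/
def SmoothChain.integral {q : ℕ} (α : SmoothChain E M q)
    (η : ∀ x : M, (Fin q → TangentSpace 𝓘(ℝ, E) x) → V) : V :=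
  α.sum fun σ r => r • σ.integral η

end Chains

/-! ### Group cochains -/

section Cochains

/-- The differential of the standard complex of nonhomogeneous cochains of a group `G` with values
in a right `G`-module `A`, where `act g a = a g`. -/
def groupDiff {G A : Type*} [Mul G] [AddCommGroup A] (act : G → A → A) {p : ℕ}
    (c : (Fin p → G) → A) : (Fin (p + 1) → G) → A := fun g =>
  c (fun i => g i.succ)
    + ∑ i : Fin p, (-1 : ℤ) ^ ((i : ℕ) + 1) • c (Fin.contractNth i.castSucc (· * ·) g)
    + (-1 : ℤ) ^ (p + 1) • act (g (Fin.last p)) (c fun i => g i.castSucc)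

/-- `δ'` on cochains with values in forms on the `G`-manifold `M`. -/
abbrev deltaOne {E : Type*} [NormedAddCommGroup E] [NormedSpace ℝ E]
    {M : Type*} [TopologicalSpace M] [ChartedSpace E M] {G : Type*} [Mul G] [SMul G M]
    {p k : ℕ} (c : (Fin p → G) → DForm E M k) : (Fin (p + 1) → G) → DForm E M k :=
  groupDiff DForm.act c

/-- `δ''` on cochains with values in forms. -/
def deltaTwo {E : Type*} [NormedAddCommGroup E] [NormedSpace ℝ E]
    {M : Type*} [TopologicalSpace M] [ChartedSpace E M] {G : Type*}
    {p k : ℕ} (c : (Fin p → G) → DForm E M k) : (Fin p → G) → DForm E M (k + 1) :=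
  fun g => (-1 : ℤ) ^ p • (c g).d

/-- `f` is of class `C^n` on the open set `U` of a finite-dimensional space, with values in a
topological vector space: iterated partial derivatives up to order `n` exist and are
continuous. -/
def ContDiffTVS {X A : Type*} [NormedAddCommGroup X] [NormedSpace ℝ X]
    [AddCommGroup A] [Module ℝ A] [TopologicalSpace A] : ℕ → (X → A) → Set X → Prop
  | 0, f, U => ContinuousOn f U
  | n + 1, f, U => ContinuousOn f U ∧ ∃ f' : X → X → A,
      (∀ x ∈ U, ∀ v, Filter.Tendsto (fun s : ℝ => s⁻¹ • (f (x + s • v) - f x)) (𝓝[≠] 0)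
        (𝓝 (f' x v))) ∧
      ∀ v, ContDiffTVS n (fun x => f' x v) U

/-- Differentiable (that is, `C^∞`) cochains: the map `G^p → A` is of class `C^∞` in the product
charts of `G^p`. -/
def IsDiffCochain (F : Type*) [NormedAddCommGroup F] [NormedSpace ℝ F]
    {G : Type*} [TopologicalSpace G] [ChartedSpace F G]
    {A : Type*} [AddCommGroup A] [Module ℝ A] [TopologicalSpace A] {p : ℕ}
    (c : (Fin p → G) → A) : Prop :=
  ∀ (g₀ : Fin p → G) (n : ℕ),
    ContDiffTVS n (fun y : Fin p → F => c fun i => (chartAt F (g₀ i)).symm (y i))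
      (Set.univ.pi fun i => (chartAt F (g₀ i)).target)

/-- Triviality of a real-valued cocycle in the complex of differentiable cochains with values in
the trivial `G`-module `ℝ`. -/
def IsTrivialDiff (F : Type*) [NormedAddCommGroup F] [NormedSpace ℝ F]
    {G : Type*} [TopologicalSpace G] [ChartedSpace F G] [Mul G] {p : ℕ}
    (c : (Fin (p + 1) → G) → ℝ) : Prop :=
  ∃ b : (Fin p → G) → ℝ, IsDiffCochain F b ∧ groupDiff (fun _ a => a) b = c

variable {E : Type*} [NormedAddCommGroup E] [NormedSpace ℝ E]
  {M : Type*} [TopologicalSpace M] [ChartedSpace E M] {G : Type*} [Mul G] [SMul G M]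

/-- The cochains `φ_{i,m-1-i}`, `0 ≤ i ≤ p`, attached to the `m`-form `θ`, where `m = p + q + 1`:
`θ = -d φ_{0,m-1}` and `δ' φ_{i-1,m-i} + δ'' φ_{i,m-1-i} = 0` for `1 ≤ i ≤ p`. Only the members
`φ i j` of the family with `i ≤ p` and `i + j = m - 1` are relevant. -/
structure IsDescent (p q : ℕ) (θ : DForm E M (p + q + 1))
    (φ : ∀ i j : ℕ, (Fin i → G) → smoothForms E M j) : Prop where
  start : ∀ g, θ = -(φ 0 (p + q) g : DForm E M (p + q)).d
  step : ∀ i j : ℕ, i + 1 ≤ p → (i + 1) + j = p + q →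
    deltaOne (fun g => (φ i (j + 1) g : DForm E M (j + 1)))
      + deltaTwo (fun g => (φ (i + 1) j g : DForm E M j)) = 0

/-- The cocycle `c_a(θ)(g₁, …, g_{p+1}) = ∫_α (δ' φ_{p,m-p-1})(g₁, …, g_{p+1})`. -/
def cocycleOf {p q : ℕ} (α : SmoothChain E M q) (c : (Fin p → G) → smoothForms E M q) :
    (Fin (p + 1) → G) → ℝ := fun g =>
  α.integral fun x v => deltaOne (fun h => (c h : DForm E M q)) g x v

end Cochains

/-! ### The map `f_γ` -/

section FGamma

/-- The tuple `(u₁, …, u_k, w₁, …, w_q)`, indexed by `Fin (q + k)`. -/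
def joinArgs {X : Type*} {q k : ℕ} (u : Fin k → X) (w : Fin q → X) (i : Fin (q + k)) : X :=
  Fin.append u w (Fin.cast (Nat.add_comm q k) i)

theorem joinArgs_update {X : Type*} {q k : ℕ} [DecidableEq (Fin k)] (u : Fin k → X)
    (w : Fin q → X) (j : Fin k) (x : X) :
    joinArgs (Function.update u j x) w =
      Function.update (joinArgs u w) (Fin.cast (Nat.add_comm k q) (Fin.castAdd q j)) x := by
  funext i
  obtain ⟨i, rfl⟩ : ∃ i', i = Fin.cast (Nat.add_comm k q) i' :=
    ⟨Fin.cast (Nat.add_comm q k) i, by simp⟩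
  simp only [joinArgs]
  refine Fin.addCases (fun l => ?_) (fun l => ?_) i
  · by_cases h : l = j
    · subst h; simp
    · have h' : Fin.cast (Nat.add_comm k q) (Fin.castAdd q l)
          ≠ Fin.cast (Nat.add_comm k q) (Fin.castAdd q j) := by
        intro e; apply h; simpa [Fin.ext_iff] using e
      rw [Function.update_of_ne h']
      simp [joinArgs, h]
  · have h' : Fin.cast (Nat.add_comm k q) (Fin.natAdd k l)
        ≠ Fin.cast (Nat.add_comm k q) (Fin.castAdd q j) := by
      intro e
      have := j.2
      simp only [Fin.ext_iff, Fin.val_cast, Fin.val_natAdd, Fin.val_castAdd] at e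
      omega
    rw [Function.update_of_ne h']
    simp [joinArgs]

theorem joinArgs_castAdd {X : Type*} {q k : ℕ} (u : Fin k → X) (w : Fin q → X) (j : Fin k) :
    joinArgs u w (Fin.cast (Nat.add_comm k q) (Fin.castAdd q j)) = u j := by
  simp [joinArgs]

/-- For an alternating `(q + k)`-form `η` and vectors `w₁, …, w_q`, the alternating `k`-form
`(u₁, …, u_k) ↦ η (u₁, …, u_k, w₁, …, w_q)`. -/
def contractLast {X : Type*} [AddCommGroup X] [Module ℝ X] [TopologicalSpace X] {q k : ℕ}
    (η : X [⋀^Fin (q + k)]→L[ℝ] ℝ) (w : Fin q → X) : X [⋀^Fin k]→L[ℝ] ℝ where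
  toFun := fun u => η (joinArgs u w)
  map_update_add' := by
    intro _ u j x y
    simp only [joinArgs_update]
    exact η.map_update_add _ _ _ _
  map_update_smul' := by
    intro _ u j c x
    simp only [joinArgs_update]
    exact η.map_update_smul _ _ _ _
  map_eq_zero_of_eq' := by
    intro u i j hij hne
    refine η.map_eq_zero_of_eq _ (i := Fin.cast (Nat.add_comm k q) (Fin.castAdd q i))
      (j := Fin.cast (Nat.add_comm k q) (Fin.castAdd q j)) ?_ ?_
    · rw [joinArgs_castAdd, joinArgs_castAdd, hij]
    · intro e; apply hne; simpa [Fin.ext_iff] using e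
  cont := by
    refine η.cont.comp (continuous_pi fun i => ?_)
    obtain ⟨i, rfl⟩ : ∃ i', i = Fin.cast (Nat.add_comm k q) i' :=
      ⟨Fin.cast (Nat.add_comm q k) i, by simp⟩
    simp only [joinArgs]
    refine Fin.addCases (fun l => ?_) (fun l => ?_) i
    · simpa using continuous_apply l
    · simpa using continuous_const

variable (F : Type*) [NormedAddCommGroup F] [NormedSpace ℝ F]
  {G : Type*} [TopologicalSpace G] [ChartedSpace F G] [Group G]
  {E : Type*} [NormedAddCommGroup E] [NormedSpace ℝ E]
  {M : Type*} [TopologicalSpace M] [ChartedSpace E M] [MulAction G M]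

/-- The right Maurer–Cartan map: `v ∈ T_g G` is sent to the `X ∈ T_e G` whose right invariant
vector field `X^r` has the value `X^r(g) = v`, i.e. `X = T(h ↦ h g⁻¹) v`. -/
def rightTrivialization (g : G) : TangentSpace 𝓘(ℝ, F) g →L[ℝ] TangentSpace 𝓘(ℝ, F) (1 : G) :=
  (tangentCast (mul_inv_cancel g)).toContinuousLinearMap.comp
    (mfderiv 𝓘(ℝ, F) 𝓘(ℝ, F) (fun h : G => h * g⁻¹) g)

/-- The value at `x` of the fundamental vector field of `X ∈ T_e G`, as a linear function of
`X`. -/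
def fundamentalField (x : M) : TangentSpace 𝓘(ℝ, F) (1 : G) →L[ℝ] TangentSpace 𝓘(ℝ, E) x :=
  (tangentCast (one_smul G x)).toContinuousLinearMap.comp
    (mfderiv 𝓘(ℝ, F) 𝓘(ℝ, E) (fun h : G => h • x) 1)

/-- The integrand of `f_γ(θ)(g)`: the `q`-form
`φ_g^*(i(X̃_k) … i(X̃_1) θ)(x)(w₁, …, w_q) = θ(g x)(X̃_1(g x), …, X̃_k(g x), Tφ_g w₁, …, Tφ_g w_q)`
as an alternating function of the values `X_1^r(g), …, X_k^r(g) ∈ T_g G`. -/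
def fGammaIntegrand {q k : ℕ} (θ : DForm E M (q + k)) (g : G) (x : M)
    (w : Fin q → TangentSpace 𝓘(ℝ, E) x) : TangentSpace 𝓘(ℝ, F) g [⋀^Fin k]→L[ℝ] ℝ :=
  (contractLast (θ (g • x))
    fun j => mfderiv 𝓘(ℝ, E) 𝓘(ℝ, E) (fun y : M => g • y) x (w j)).compContinuousLinearMap
      ((fundamentalField F (g • x)).comp (rightTrivialization F g))

/-- The map `f_γ : Ω^{q+k}(M) → Ω^k(G)` attached to a smooth singular `q`-chain `γ`,
`f_γ(θ)(X_1^r, …, X_k^r)(g) = ∫_γ φ_g^*(i(X̃_k) … i(X̃_1) θ)`.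
The integral is taken in the finite-dimensional normed space of alternating forms on
`F ≅ T_g G`. -/
def fGamma {q k : ℕ} (γ : SmoothChain E M q) (θ : DForm E M (q + k)) : DForm F G k := fun g =>
  (γ.integral fun x w => (fGammaIntegrand F θ g x w).compContinuousLinearMap
      (tangentModel (E := F) g).symm.toContinuousLinearMap).compContinuousLinearMap
    (tangentModel (E := F) g).toContinuousLinearMap

end FGamma

end

/-! Let c₁ = φ_{p-1,m-p} and c₀ = φ_{p,m-p-1} be the last two members of the descent, so that δ'c₁ =
-(-1)^p d c₀. The map f_α carries this relation from M to G because of two properties. It is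
equivariant (`fGamma_act`), hence commutes with the group differential. On q-forms it also commutes
with d (`d_fGamma`): differentiating under the integral sign and applying Stokes on each simplex
leaves fibre integrals over the faces, and these cancel because α is a cycle.

The form δ'c₀ is closed, since d δ'c₀ = δ'd c₀ = ∓δ'δ'c₁ = 0. As the class of α is invariant, its
integral over gα does not depend on g (`fGamma_closed`). So δ'_G(f_α∘c₀) is the cochain of constant
functions with values c_a(ω).

For a cochain f of functions on G put K_f = f_α∘c₀ + (-1)^p δ'_G f (`correctedIntegral`). Then
δ'_G(f_α∘c₁ - d_G f) = -(-1)^p d_G K_f (`IsDescentStep.deltaOne_sub_d`), so the equation for f says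
exactly that every function K_f(g) is closed. In addition δ'_G K_f = c_a(ω), because δ'_G squares to
zero.

If G is connected and f solves the equation, each K_f(g) is a constant b(g), and Db = c_a(ω).
Conversely, if c_a(ω) = Db, then f_α∘c₀ - b is a cocycle with values in functions on G under left
translation. That complex has the contraction (hc)(g)(x) = c(g,x)(1) (`groupDiff_contraction`), and
f = -h(f_α∘c₀ - b) gives K_f = b, which is constant on G and therefore closed.

Differentiability is checked only at the identity of G, where f_α(η) equals ∫_α η
(`toFunction_fGamma_one`). Integration over α is continuous and linear for the C^∞-topology, so ∫_α
c₀ is a differentiable real cochain (`IsDiffCochain.integral`). Passing between real cochains of p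
variables and (p-1)-cochains with values in functions on G is an exponential law, proved in both
directions (`IsDiffCochain.curry`, `IsDiffCochain.uncurry`). -/

set_option linter.unusedSectionVars false

noncomputable section

/-! ### Algebra of nonhomogeneous cochains: δ'δ' = 0 and the contracting homotopy. -/

section CochainAlgebra

variable {G A B : Type*} [Group G] [AddCommGroup A] [AddCommGroup B]

/-- The axioms of a right module over a group, for an action written as a function. -/
structure IsRightAction (act : G → A → A) : Prop where
  add : ∀ g a b, act g (a + b) = act g a + act g b
  one : ∀ a, act 1 a = a
  mul : ∀ g h a, act (g * h) a = act h (act g a)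

namespace IsRightAction

variable {act : G → A → A} (H : IsRightAction act)
include H

theorem zsmul (g : G) (n : ℤ) (a : A) : act g (n • a) = n • act g a :=
  map_zsmul (AddMonoidHom.mk' (act g) (H.add g)) n a

theorem zero (g : G) : act g 0 = 0 := (AddMonoidHom.mk' (act g) (H.add g)).map_zero

theorem sum {ι : Type*} (s : Finset ι) (g : G) (f : ι → A) :
    act g (∑ i ∈ s, f i) = ∑ i ∈ s, act g (f i) :=
  map_sum (AddMonoidHom.mk' (act g) (H.add g)) f s

end IsRightAction

/-- The homogeneous cochain attached to an inhomogeneous one. -/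
def homogeneousCochain (act : G → A → A) {p : ℕ} (c : (Fin p → G) → A) (x : Fin (p + 1) → G) : A :=
  act (x (Fin.last p))⁻¹ (c fun i => (x i.castSucc)⁻¹ * x i.succ)

/-- The product of two consecutive quotients telescopes, so contracting a pair of group elements
amounts to deleting the vertex between them. -/
theorem contractNth_inv_mul {p : ℕ} (x : Fin (p + 2) → G) (j : Fin (p + 1)) :
    Fin.contractNth j (· * ·) (fun i => (x i.castSucc)⁻¹ * x i.succ) =
      fun k : Fin p => (x (j.succ.succAbove k.castSucc))⁻¹ * x (j.succ.succAbove k.succ) := by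
  funext k
  rw [Fin.succ_succAbove_succ]
  rcases lt_trichotomy (k : ℕ) j with (h | h | h)
  · rw [Fin.contractNth_apply_of_lt _ _ _ _ h, Fin.succAbove_of_castSucc_lt,
      Fin.succAbove_of_castSucc_lt]
    · exact h
    · simp only [Fin.lt_def, Fin.val_castSucc, Fin.val_succ]; omega
  · rw [Fin.contractNth_apply_of_eq _ _ _ _ h, Fin.succAbove_of_castSucc_lt,
      Fin.succAbove_of_le_castSucc]
    · simp [mul_assoc]
    · simp [Fin.le_def, h]
    · simp only [Fin.lt_def, Fin.val_castSucc, Fin.val_succ]; omega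
  · rw [Fin.contractNth_apply_of_gt _ _ _ _ h, Fin.succAbove_of_le_castSucc,
      Fin.succAbove_of_le_castSucc]
    · rfl
    · simp only [Fin.le_def, Fin.val_castSucc]; omega
    · simp only [Fin.le_def, Fin.val_castSucc, Fin.val_succ]; omega

/-- Each term of the nonhomogeneous differential deletes one vertex. For the last vertex, the action
of the last group element moves the base point from x_{p+1} to x_p, by the right action law. -/
theorem homogeneousCochain_groupDiff {act : G → A → A} (H : IsRightAction act) {p : ℕ}
    (c : (Fin p → G) → A) (x : Fin (p + 2) → G) :
    homogeneousCochain act (groupDiff act c) x =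
      ∑ i : Fin (p + 2), (-1 : ℤ) ^ (i : ℕ) • homogeneousCochain act c (x ∘ i.succAbove) := by
  rw [Fin.sum_univ_succ, Fin.sum_univ_castSucc]
  simp only [homogeneousCochain, groupDiff, H.add, H.sum, H.zsmul, Function.comp_def]
  rw [← add_assoc]
  congr 1
  · congr 1
    · simp
    · refine Finset.sum_congr rfl fun j _ => ?_
      rw [contractNth_inv_mul, Fin.val_succ]
      have : j.castSucc.succ.succAbove (Fin.last p) = Fin.last (p + 1) := by
        rw [Fin.succAbove_of_le_castSucc, Fin.succ_last]
        simp only [Fin.le_def, Fin.val_castSucc, Fin.val_last, Fin.val_succ]; omega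
      rw [this]
      simp
  · rw [← H.mul]
    simp

/-- Two vertices can be deleted in either order, and the two orders carry opposite signs; exchanging
them is a fixed-point-free involution of the index set. -/
theorem sum_sum_succAbove_eq_zero {X : Type*} {n : ℕ} (h : (Fin n → X) → A) (x : Fin (n + 2) → X) :
    ∑ i : Fin (n + 2), (-1 : ℤ) ^ (i : ℕ) •
      ∑ j : Fin (n + 1), (-1 : ℤ) ^ (j : ℕ) • h ((x ∘ i.succAbove) ∘ j.succAbove) = 0 := by
  simp only [Finset.smul_sum, smul_smul, ← Finset.sum_product']
  refine Finset.sum_involution (fun a _ => (a.1.succAbove a.2, a.2.predAbove a.1)) ?_ ?_ ?_ ?_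
  · rintro ⟨i, j⟩ -
    have : (x ∘ (i.succAbove j).succAbove) ∘ (j.predAbove i).succAbove =
        (x ∘ i.succAbove) ∘ j.succAbove := by
      funext k
      simp [Fin.succAbove_succAbove_succAbove_predAbove]
    simp only [this, ← add_smul, ← pow_add]
    rw [Fin.neg_one_pow_succAbove_add_predAbove]
    simp [pow_add]
  · rintro ⟨i, j⟩ - - e
    exact Fin.succAbove_ne i j (congrArg Prod.fst e)
  · intros; simp
  · rintro ⟨i, j⟩ -
    simp [Fin.succAbove_succAbove_predAbove, Fin.predAbove_predAbove_succAbove]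

/-- The vertices `Fin.partialProd g` have `g` as their sequence of quotients, so the simplicial
identity for homogeneous cochains applies; the remaining outer action is invertible. -/
theorem groupDiff_groupDiff {act : G → A → A} (H : IsRightAction act) {p : ℕ}
    (c : (Fin p → G) → A) : groupDiff act (groupDiff act c) = 0 := by
  funext g
  have h : homogeneousCochain act (groupDiff act (groupDiff act c)) (Fin.partialProd g) = 0 := by
    simp only [homogeneousCochain_groupDiff H]
    exact sum_sum_succAbove_eq_zero _ _
  simp only [homogeneousCochain, Fin.partialProd_right_inv] at h
  have h2 := congrArg (act (Fin.partialProd g (Fin.last (p + 2)))) h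
  rwa [← H.mul, inv_mul_cancel, H.one, H.zero] at h2

theorem groupDiff_add {act : G → A → A} (H : IsRightAction act) {p : ℕ}
    (c c' : (Fin p → G) → A) :
    groupDiff act (fun g => c g + c' g) = groupDiff act c + groupDiff act c' := by
  funext g
  simp only [groupDiff, H.add, smul_add, Finset.sum_add_distrib, Pi.add_apply]
  abel

theorem groupDiff_zsmul {act : G → A → A} (H : IsRightAction act) {p : ℕ} (n : ℤ)
    (c : (Fin p → G) → A) :
    groupDiff act (fun g => n • c g) = n • groupDiff act c := by
  funext g
  simp only [groupDiff, H.zsmul, smul_add, Finset.smul_sum, Pi.smul_apply, smul_comm n]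

/-- An equivariant additive map commutes with the differential. -/
theorem map_groupDiff {act : G → A → A} {act' : G → B → B} (F : A →+ B)
    (hF : ∀ g a, F (act g a) = act' g (F a)) {p : ℕ} (c : (Fin p → G) → A)
    (g : Fin (p + 1) → G) :
    F (groupDiff act c g) = groupDiff act' (fun h => F (c h)) g := by
  simp only [groupDiff, map_add, map_sum, map_zsmul, hF]

/-- Cochains with values in functions on the group, with the action by left translations, have a
contracting homotopy. -/
theorem groupDiff_contraction {p : ℕ} (c : (Fin (p + 1) → G) → G → A)
    (hc : groupDiff (fun g (a : G → A) x => a (g * x)) c = 0) :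
    groupDiff (fun g (a : G → A) x => a (g * x)) (fun g x => c (Fin.snoc g x) 1) =
      (-1 : ℤ) ^ (p + 1) • c := by
  funext g x
  -- In the cocycle identity at (g, x), evaluated at 1, the last term is `c g x`. The other terms
  -- form the differential of the contracted cochain: merging the last entry of g with x reproduces
  -- its translation term.
  have h := congrFun (congrFun hc (Fin.snoc g x)) 1
  simp only [groupDiff, Pi.add_apply, Pi.smul_apply, Pi.zero_apply, Finset.sum_apply,
    Fin.sum_univ_castSucc, Fin.snoc_castSucc, Fin.snoc_last, mul_one] at h ⊢
  have e1 : (fun i : Fin (p + 1) => (Fin.snoc g x : Fin (p + 2) → G) i.succ) =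
      Fin.snoc (fun i : Fin p => g i.succ) x := by
    funext i
    refine Fin.lastCases ?_ (fun i => ?_) i
    · simp [Fin.succ_last]
    · rw [← Fin.castSucc_succ]; simp only [Fin.snoc_castSucc]
  have e2 : ∀ i : Fin p, Fin.contractNth i.castSucc.castSucc (· * ·)
      (Fin.snoc g x : Fin (p + 2) → G) =
        Fin.snoc (Fin.contractNth i.castSucc (· * ·) g) x := by
    intro i
    funext k
    refine Fin.lastCases ?_ (fun k => ?_) k
    · rw [Fin.contractNth_apply_of_gt _ _ _ _ (by simp), Fin.succ_last]
      simp
    · rw [Fin.snoc_castSucc]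
      rcases lt_trichotomy (k : ℕ) i with (h | h | h)
      · rw [Fin.contractNth_apply_of_lt _ _ _ _ (by simpa using h),
          Fin.contractNth_apply_of_lt _ _ _ _ (by simpa using h), Fin.snoc_castSucc]
      · rw [Fin.contractNth_apply_of_eq _ _ _ _ (by simpa using h),
          Fin.contractNth_apply_of_eq _ _ _ _ (by simpa using h), Fin.snoc_castSucc,
          Fin.succ_castSucc, Fin.snoc_castSucc]
      · rw [Fin.contractNth_apply_of_gt _ _ _ _ (by simpa using h),
          Fin.contractNth_apply_of_gt _ _ _ _ (by simpa using h), Fin.succ_castSucc,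
          Fin.snoc_castSucc]
  have e3 : Fin.contractNth (Fin.last p).castSucc (· * ·) (Fin.snoc g x : Fin (p + 2) → G) =
      Fin.snoc (fun i : Fin p => g i.castSucc) (g (Fin.last p) * x) := by
    funext k
    refine Fin.lastCases ?_ (fun k => ?_) k
    · rw [Fin.contractNth_apply_of_eq _ _ _ _ (by simp), Fin.succ_last, Fin.snoc_last,
        Fin.snoc_castSucc, Fin.snoc_last]
    · rw [Fin.contractNth_apply_of_lt _ _ _ _ (by simp), Fin.snoc_castSucc, Fin.snoc_castSucc]
  simp only [e1, e2, e3, Fin.val_castSucc, Fin.val_last] at h ⊢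
  rw [← add_assoc] at h
  rw [eq_neg_of_add_eq_zero_left h, pow_succ _ (p + 1)]
  simp

end CochainAlgebra

/-! ### Regularity of maps into alternating forms, tested on values. -/

section AlternatingEvaluation

variable {W : Type*} [NormedAddCommGroup W] [NormedSpace ℝ W] [FiniteDimensional ℝ W]

/-- An alternating form on a finite-dimensional space is a linear function of finitely many of its
values. -/
theorem exists_eq_of_evaluations (W : Type*) [NormedAddCommGroup W] [NormedSpace ℝ W]
    [FiniteDimensional ℝ W] (k : ℕ) :
    ∃ (ι : Type) (_ : Fintype ι) (s : ι → Fin k → W) (L : (ι → ℝ) →L[ℝ] W [⋀^Fin k]→L[ℝ] ℝ),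
      ∀ a : W [⋀^Fin k]→L[ℝ] ℝ, a = L fun i => a (s i) := by
  classical
  let b := Module.finBasis ℝ W
  let J : (W [⋀^Fin k]→L[ℝ] ℝ) →ₗ[ℝ] ((Fin k → Fin (Module.finrank ℝ W)) → ℝ) :=
    { toFun := fun a i => a fun j => b (i j)
      map_add' := fun _ _ => rfl
      map_smul' := fun _ _ => rfl }
  have hJ : LinearMap.ker J = ⊥ := by
    rw [LinearMap.ker_eq_bot]
    intro a a' h
    apply ContinuousAlternatingMap.toAlternatingMap_injective
    exact AlternatingMap.coe_multilinearMap_injective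
      (Module.Basis.ext_multilinear (fun _ => b) fun i => congrFun h i)
  obtain ⟨L, hL⟩ := J.exists_leftInverse_of_injective hJ
  exact ⟨Fin k → Fin (Module.finrank ℝ W), inferInstance, fun i j => b (i j),
    LinearMap.toContinuousLinearMap L, fun a => (LinearMap.congr_fun hL a).symm⟩

variable {X : Type*} [NormedAddCommGroup X] [NormedSpace ℝ X] {k : ℕ}

theorem contDiffWithinAt_of_evaluations {n : WithTop ℕ∞} {f : X → W [⋀^Fin k]→L[ℝ] ℝ} {s : Set X}
    {x : X} (h : ∀ v, ContDiffWithinAt ℝ n (fun y => f y v) s x) : ContDiffWithinAt ℝ n f s x := by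
  obtain ⟨ι, _, v, L, hL⟩ := exists_eq_of_evaluations W k
  have : f = L ∘ fun y i => f y (v i) := funext fun y => hL (f y)
  rw [this]
  exact L.contDiff.contDiffAt.comp_contDiffWithinAt x (contDiffWithinAt_pi.2 fun i => h (v i))

theorem continuousOn_of_evaluations {Y : Type*} [TopologicalSpace Y]
    {f : Y → W [⋀^Fin k]→L[ℝ] ℝ} {s : Set Y}
    (h : ∀ v, ContinuousOn (fun y => f y v) s) : ContinuousOn f s := by
  obtain ⟨ι, _, v, L, hL⟩ := exists_eq_of_evaluations W k
  have : f = L ∘ fun y i => f y (v i) := funext fun y => hL (f y)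
  rw [this]
  exact L.continuous.comp_continuousOn (continuousOn_pi.2 fun i => h (v i))

/-- After evaluation on fixed vectors the expression is linear in `a` and a continuous multilinear
function of copies of `B`. -/
theorem ContDiffWithinAt.alternating_comp {E : Type*} [NormedAddCommGroup E] [NormedSpace ℝ E]
    {n : WithTop ℕ∞} {a : X → E [⋀^Fin k]→L[ℝ] ℝ} {B : X → W →L[ℝ] E} {s : Set X} {x : X}
    (ha : ContDiffWithinAt ℝ n a s x) (hB : ContDiffWithinAt ℝ n B s x) :
    ContDiffWithinAt ℝ n (fun y => (a y).compContinuousLinearMap (B y)) s x := by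
  refine contDiffWithinAt_of_evaluations fun v => ?_
  have h1 : ContDiffWithinAt ℝ n (fun y => (a y).toContinuousMultilinearMap) s x :=
    (ContinuousAlternatingMap.toContinuousMultilinearMapCLM (𝕜 := ℝ) (E := E) (F := ℝ) (ι := Fin k)
      ℝ).contDiff.contDiffAt.comp_contDiffWithinAt x ha
  have h2 : ContDiffWithinAt ℝ n (fun y =>
      ContinuousMultilinearMap.compContinuousLinearMapContinuousMultilinear ℝ
        (fun _ : Fin k => W) (fun _ => E) ℝ fun _ => B y) s x :=
    (ContinuousMultilinearMap.contDiff _).contDiffAt.comp_contDiffWithinAt x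
      (contDiffWithinAt_pi.2 fun _ => hB)
  exact (ContinuousMultilinearMap.apply ℝ (fun _ : Fin k => W) ℝ
    v).contDiff.contDiffAt.comp_contDiffWithinAt x (h2.clm_apply h1)

end AlternatingEvaluation

/-! ### Manifold derivatives as maps between fixed model spaces. -/

section ModelDerivatives

variable {E : Type*} [NormedAddCommGroup E] [NormedSpace ℝ E]
  {M : Type*} [TopologicalSpace M] [ChartedSpace E M]
  {E' : Type*} [NormedAddCommGroup E'] [NormedSpace ℝ E']
  {N : Type*} [TopologicalSpace N] [ChartedSpace E' N]
  {E'' : Type*} [NormedAddCommGroup E''] [NormedSpace ℝ E'']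
  {N' : Type*} [TopologicalSpace N'] [ChartedSpace E'' N']
  {W : Type*} [NormedAddCommGroup W] [NormedSpace ℝ W]

variable (E E') in
/-- The manifold derivative as a map between the model spaces. -/
def mD (f : M → N) (x : M) : E →L[ℝ] E' := mfderiv 𝓘(ℝ, E) 𝓘(ℝ, E') f x

variable (E E') in
/-- The manifold derivative within a set as a map between the model spaces. -/
def mDW (f : M → N) (s : Set M) (x : M) : E →L[ℝ] E' := mfderivWithin 𝓘(ℝ, E) 𝓘(ℝ, E') f s x

theorem mDW_eq_fderivWithin (f : W → E') (s : Set W) (x : W) :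
    mDW W E' f s x = fderivWithin ℝ f s x := mfderivWithin_eq_fderivWithin

theorem mD_eq_fderiv (f : W → E') (x : W) : mD W E' f x = fderiv ℝ f x := mfderiv_eq_fderiv

theorem mD_comp {f : M → N} {g : N → N'} {x : M} (hg : MDifferentiableAt 𝓘(ℝ, E') 𝓘(ℝ, E'') g (f x))
    (hf : MDifferentiableAt 𝓘(ℝ, E) 𝓘(ℝ, E') f x) :
    mD E E'' (fun y => g (f y)) x = (mD E' E'' g (f x)).comp (mD E E' f x) :=
  mfderiv_comp x hg hf

theorem mDW_comp {f : M → N} {g : N → N'} {s : Set M} {t : Set N} {x : M}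
    (hg : MDifferentiableWithinAt 𝓘(ℝ, E') 𝓘(ℝ, E'') g t (f x))
    (hf : MDifferentiableWithinAt 𝓘(ℝ, E) 𝓘(ℝ, E') f s x) (h : MapsTo f s t)
    (hs : UniqueMDiffWithinAt 𝓘(ℝ, E) s x) :
    mDW E E'' (fun y => g (f y)) s x = (mDW E' E'' g t (f x)).comp (mDW E E' f s x) :=
  mfderivWithin_comp x hg hf h hs

theorem mD_comp_mDW {f : M → N} {g : N → N'} {s : Set M} {x : M}
    (hg : MDifferentiableAt 𝓘(ℝ, E') 𝓘(ℝ, E'') g (f x))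
    (hf : MDifferentiableWithinAt 𝓘(ℝ, E) 𝓘(ℝ, E') f s x)
    (hs : UniqueMDiffWithinAt 𝓘(ℝ, E) s x) :
    mDW E E'' (fun y => g (f y)) s x = (mD E' E'' g (f x)).comp (mDW E E' f s x) :=
  mfderiv_comp_mfderivWithin x hg hf hs

theorem mDW_eq_mD {f : M → N} {s : Set M} {x : M} (hs : s ∈ 𝓝 x) : mDW E E' f s x = mD E E' f x :=
  mfderivWithin_of_mem_nhds hs

theorem mDW_congr {f g : M → N} {s : Set M} {x : M} (h : f =ᶠ[𝓝[s] x] g) (hx : f x = g x) :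
    mDW E E' f s x = mDW E E' g s x := by
  have := Filter.EventuallyEq.mfderivWithin_eq (I := 𝓘(ℝ, E)) (I' := 𝓘(ℝ, E')) h hx
  exact this

theorem mD_congr {f g : M → N} {x : M} (h : f =ᶠ[𝓝 x] g) : mD E E' f x = mD E E' g x := by
  have := Filter.EventuallyEq.mfderiv_eq (I := 𝓘(ℝ, E)) (I' := 𝓘(ℝ, E')) h
  exact this

theorem mD_id (x : M) : mD E E (fun y : M => y) x = ContinuousLinearMap.id ℝ E :=
  mfderiv_id

end ModelDerivatives

/-! ### Pullback of forms, also along maps defined on sets with corners, and its compatibility with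
d. -/

section Pullback

variable {E : Type*} [NormedAddCommGroup E] [NormedSpace ℝ E]
  {M : Type*} [TopologicalSpace M] [ChartedSpace E M]
  {E' : Type*} [NormedAddCommGroup E'] [NormedSpace ℝ E']
  {N : Type*} [TopologicalSpace N] [ChartedSpace E' N]
  {W : Type*} [NormedAddCommGroup W] [NormedSpace ℝ W]
  {k : ℕ}

/-- The value of a form at a point as an alternating form on the model space. -/
def DForm.val (η : DForm E M k) (x : M) : E [⋀^Fin k]→L[ℝ] ℝ := η x

theorem DForm.ext_val {η θ : DForm E M k} (h : ∀ x, η.val x = θ.val x) : η = θ := funext h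

/-- The pullback of a form along a map defined on a subset of a normed space. -/
def pullbackWithin (Φ : W → M) (S : Set W) (η : DForm E M k) (w : W) : W [⋀^Fin k]→L[ℝ] ℝ :=
  (η.val (Φ w)).compContinuousLinearMap (mDW W E Φ S w)

theorem DForm.chartRep_eq (η : DForm E M k) (x₀ : M) (y : E) :
    η.chartRep x₀ y = (η.val ((extChartAt 𝓘(ℝ, E) x₀).symm y)).compContinuousLinearMap
      (mD E E (extChartAt 𝓘(ℝ, E) x₀).symm y) := rfl

theorem DForm.d_val (η : DForm E M k) (x : M) :
    η.d.val x = (extDeriv (η.chartRep x) (extChartAt 𝓘(ℝ, E) x x)).compContinuousLinearMap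
      (mD E E (extChartAt 𝓘(ℝ, E) x) x) := rfl

theorem DForm.pullback_val (f : M → N) (η : DForm E' N k) (x : M) :
    (η.pullback f : DForm E M k).val x = (η.val (f x)).compContinuousLinearMap (mD E E' f x) := rfl

theorem mdifferentiableAt_extChartAt_symm' [IsManifold 𝓘(ℝ, E) ∞ M] {x₀ : M} {y : E}
    (hy : y ∈ (extChartAt 𝓘(ℝ, E) x₀).target) :
    MDifferentiableAt 𝓘(ℝ, E) 𝓘(ℝ, E) (extChartAt 𝓘(ℝ, E) x₀).symm y :=
  (((contMDiffOn_extChartAt_symm (n := ∞) x₀).contMDiffAt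
    ((isOpen_extChartAt_target x₀).mem_nhds hy))).mdifferentiableAt (by simp)

theorem mdifferentiableAt_extChartAt'' [IsManifold 𝓘(ℝ, E) ∞ M] {x₀ x : M}
    (hx : x ∈ (extChartAt 𝓘(ℝ, E) x₀).source) :
    MDifferentiableAt 𝓘(ℝ, E) 𝓘(ℝ, E) (extChartAt 𝓘(ℝ, E) x₀) x :=
  (contMDiffAt_extChartAt' (n := ∞) (by simpa using hx)).mdifferentiableAt (by simp)

theorem mD_extChartAt_symm_comp [IsManifold 𝓘(ℝ, E) ∞ M] {x₀ x : M}
    (hx : x ∈ (extChartAt 𝓘(ℝ, E) x₀).source) :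
    (mD E E (extChartAt 𝓘(ℝ, E) x₀).symm (extChartAt 𝓘(ℝ, E) x₀ x)).comp
      (mD E E (extChartAt 𝓘(ℝ, E) x₀) x) = ContinuousLinearMap.id ℝ E := by
  rw [← mD_comp (mdifferentiableAt_extChartAt_symm' ((extChartAt 𝓘(ℝ, E) x₀).map_source hx))
    (mdifferentiableAt_extChartAt'' hx), ← mD_id (E := E) x]
  refine mD_congr ?_
  filter_upwards [(isOpen_extChartAt_source x₀).mem_nhds hx] with z hz
  exact (extChartAt 𝓘(ℝ, E) x₀).left_inv hz

theorem mD_extChartAt_comp_symm [IsManifold 𝓘(ℝ, E) ∞ M] {x₀ : M} {y : E}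
    (hy : y ∈ (extChartAt 𝓘(ℝ, E) x₀).target) :
    (mD E E (extChartAt 𝓘(ℝ, E) x₀) ((extChartAt 𝓘(ℝ, E) x₀).symm y)).comp
      (mD E E (extChartAt 𝓘(ℝ, E) x₀).symm y) = ContinuousLinearMap.id ℝ E := by
  rw [← mD_comp (mdifferentiableAt_extChartAt'' ((extChartAt 𝓘(ℝ, E) x₀).map_target hy))
    (mdifferentiableAt_extChartAt_symm' hy), ← mD_id (E := E) y]
  refine mD_congr ?_
  filter_upwards [(isOpen_extChartAt_target x₀).mem_nhds hy] with z hz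
  exact (extChartAt 𝓘(ℝ, E) x₀).right_inv hz

/-- A form is recovered from its coordinate expressions. -/
theorem DForm.val_eq_chartRep [IsManifold 𝓘(ℝ, E) ∞ M] (η : DForm E M k) {x₀ x : M}
    (hx : x ∈ (extChartAt 𝓘(ℝ, E) x₀).source) :
    η.val x = (η.chartRep x₀ (extChartAt 𝓘(ℝ, E) x₀ x)).compContinuousLinearMap
      (mD E E (extChartAt 𝓘(ℝ, E) x₀) x) := by
  rw [DForm.chartRep_eq, (extChartAt 𝓘(ℝ, E) x₀).left_inv hx]
  have := mD_extChartAt_symm_comp hx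
  ext v
  simp only [ContinuousAlternatingMap.compContinuousLinearMap_apply]
  congr 1
  funext i
  exact (DFunLike.congr_fun this (v i)).symm

theorem contDiffWithinAt_chart_comp [IsManifold 𝓘(ℝ, E) ∞ M] {Φ : W → M} {S : Set W} {w : W}
    {x₀ : M} (hΦ : ContMDiffWithinAt 𝓘(ℝ, W) 𝓘(ℝ, E) ∞ Φ S w)
    (hx : Φ w ∈ (extChartAt 𝓘(ℝ, E) x₀).source) :
    ContDiffWithinAt ℝ ∞ (fun z => extChartAt 𝓘(ℝ, E) x₀ (Φ z)) S w :=
  ((contMDiffAt_extChartAt' (n := ∞) (by simpa using hx)).comp_contMDiffWithinAt w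
    hΦ).contDiffWithinAt

/-- The coordinate expression of a pullback. -/
theorem pullbackWithin_eq_chartRep [IsManifold 𝓘(ℝ, E) ∞ M] (η : DForm E M k) {Φ : W → M}
    {S : Set W} {w : W} (hS : UniqueDiffWithinAt ℝ S w) {x₀ : M}
    (hΦ : ContMDiffWithinAt 𝓘(ℝ, W) 𝓘(ℝ, E) ∞ Φ S w)
    (hx : Φ w ∈ (extChartAt 𝓘(ℝ, E) x₀).source) :
    pullbackWithin Φ S η w =
      (η.chartRep x₀ (extChartAt 𝓘(ℝ, E) x₀ (Φ w))).compContinuousLinearMap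
        (fderivWithin ℝ (fun z => extChartAt 𝓘(ℝ, E) x₀ (Φ z)) S w) := by
  rw [pullbackWithin, η.val_eq_chartRep hx, ← mDW_eq_fderivWithin,
    mD_comp_mDW (mdifferentiableAt_extChartAt'' hx) (hΦ.mdifferentiableWithinAt (by simp))
      hS.uniqueMDiffWithinAt]
  rfl

omit [NormedSpace ℝ W] in
theorem eventually_mem_source_of_continuousWithinAt {Φ : W → M} {S : Set W} {w : W}
    (hΦ : ContinuousWithinAt Φ S w) :
    ∀ᶠ z in 𝓝[S] w, Φ z ∈ (extChartAt 𝓘(ℝ, E) (Φ w)).source :=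
  hΦ ((isOpen_extChartAt_source (Φ w)).mem_nhds (mem_extChartAt_source (Φ w)))

/-- Fixing the chart at `Φ w` turns the pullback near `w` into one between normed spaces, where
calculus within a set is available. -/
theorem pullbackWithin_eventuallyEq [IsManifold 𝓘(ℝ, E) ∞ M] (η : DForm E M k) {Φ : W → M}
    {S : Set W} {w : W} (hw : w ∈ S) (hS : UniqueDiffOn ℝ S)
    (hΦ : ContMDiffOn 𝓘(ℝ, W) 𝓘(ℝ, E) ∞ Φ S) :
    pullbackWithin Φ S η =ᶠ[𝓝[S] w] fun z =>
      (η.chartRep (Φ w) (extChartAt 𝓘(ℝ, E) (Φ w) (Φ z))).compContinuousLinearMap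
        (fderivWithin ℝ (fun z => extChartAt 𝓘(ℝ, E) (Φ w) (Φ z)) S z) := by
  filter_upwards [eventually_mem_source_of_continuousWithinAt (E := E) (hΦ w hw).continuousWithinAt,
    self_mem_nhdsWithin] with z hz hzS
  exact pullbackWithin_eq_chartRep η (hS z hzS) (hΦ z hzS) hz

theorem DForm.IsSmooth.contDiffAt {η : DForm E M k} (hη : η.IsSmooth)
    {x₀ : M} {y : E} (hy : y ∈ (extChartAt 𝓘(ℝ, E) x₀).target) :
    ContDiffAt ℝ ∞ (η.chartRep x₀) y :=
  (hη x₀).contDiffAt ((isOpen_extChartAt_target x₀).mem_nhds hy)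

/-- The pullback of a smooth form is smooth. -/
theorem contDiffOn_pullbackWithin [FiniteDimensional ℝ W] [IsManifold 𝓘(ℝ, E) ∞ M]
    {η : DForm E M k} (hη : η.IsSmooth) {Φ : W → M} {S : Set W} (hS : UniqueDiffOn ℝ S)
    (hΦ : ContMDiffOn 𝓘(ℝ, W) 𝓘(ℝ, E) ∞ Φ S) : ContDiffOn ℝ ∞ (pullbackWithin Φ S η) S := by
  intro w hw
  refine ContDiffWithinAt.congr_of_eventuallyEq_of_mem ?_
    (pullbackWithin_eventuallyEq η hw hS hΦ) hw
  have hu := contDiffWithinAt_chart_comp (hΦ w hw) (mem_extChartAt_source (I := 𝓘(ℝ, E)) (Φ w))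
  refine ContDiffWithinAt.alternating_comp ?_ (hu.fderivWithin_right hS (by simp) hw)
  exact ContDiffAt.comp_contDiffWithinAt w (g := η.chartRep (Φ w))
    (hη.contDiffAt (mem_extChartAt_target (Φ w))) hu

/-- The exterior derivative commutes with pullbacks. -/
theorem extDerivWithin_pullbackWithin [IsManifold 𝓘(ℝ, E) ∞ M]
    {η : DForm E M k} (hη : η.IsSmooth) {Φ : W → M} {S : Set W} (hS : UniqueDiffOn ℝ S)
    (hΦ : ContMDiffOn 𝓘(ℝ, W) 𝓘(ℝ, E) ∞ Φ S) {w : W} (hw : w ∈ S)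
    (hw' : w ∈ closure (interior S)) :
    extDerivWithin (pullbackWithin Φ S η) S w = pullbackWithin Φ S η.d w := by
  have hx := mem_extChartAt_source (I := 𝓘(ℝ, E)) (Φ w)
  have hu := contDiffWithinAt_chart_comp (hΦ w hw) hx
  rw [(pullbackWithin_eventuallyEq η hw hS hΦ).extDerivWithin_eq_of_mem hw]
  have hω : DifferentiableWithinAt ℝ (η.chartRep (Φ w)) univ (extChartAt 𝓘(ℝ, E) (Φ w) (Φ w)) :=
    (hη.contDiffAt (mem_extChartAt_target (Φ w))).differentiableAt
      (by simp) |>.differentiableWithinAt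
  -- Commuting d with a pullback rests on symmetry of second derivatives; within a set this is where
  -- membership in the closure of the interior is needed.
  rw [extDerivWithin_pullback (f := fun z => extChartAt 𝓘(ℝ, E) (Φ w) (Φ z)) (r := ∞) hω
    hu (by rw [minSmoothness_of_isRCLikeNormedField]; exact ENat.LEInfty.out) hS hw' hw (mapsTo_univ _ _), extDerivWithin_univ,
    pullbackWithin, DForm.d_val, ← mDW_eq_fderivWithin,
    mD_comp_mDW (mdifferentiableAt_extChartAt'' hx) ((hΦ w hw).mdifferentiableWithinAt (by simp))
      (hS w hw).uniqueMDiffWithinAt]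
  rfl

theorem chartRep_pullback [IsManifold 𝓘(ℝ, E) ∞ M] {f : M → N}
    (hf : ContMDiff 𝓘(ℝ, E) 𝓘(ℝ, E') ∞ f) (η : DForm E' N k) (x₀ : M) {y : E}
    (hy : y ∈ (extChartAt 𝓘(ℝ, E) x₀).target) :
    (η.pullback f : DForm E M k).chartRep x₀ y =
      pullbackWithin (fun z => f ((extChartAt 𝓘(ℝ, E) x₀).symm z))
        (extChartAt 𝓘(ℝ, E) x₀).target η y := by
  rw [DForm.chartRep_eq, DForm.pullback_val, pullbackWithin,
    mDW_eq_mD ((isOpen_extChartAt_target x₀).mem_nhds hy),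
    mD_comp (hf.mdifferentiableAt (by simp)) (mdifferentiableAt_extChartAt_symm' hy)]
  rfl

theorem contMDiffOn_comp_extChartAt_symm [IsManifold 𝓘(ℝ, E) ∞ M] {f : M → N}
    (hf : ContMDiff 𝓘(ℝ, E) 𝓘(ℝ, E') ∞ f) (x₀ : M) :
    ContMDiffOn 𝓘(ℝ, E) 𝓘(ℝ, E') ∞ (fun z => f ((extChartAt 𝓘(ℝ, E) x₀).symm z))
      (extChartAt 𝓘(ℝ, E) x₀).target :=
  hf.comp_contMDiffOn (contMDiffOn_extChartAt_symm x₀)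

theorem DForm.IsSmooth.pullback [FiniteDimensional ℝ E] [IsManifold 𝓘(ℝ, E) ∞ M]
    [IsManifold 𝓘(ℝ, E') ∞ N] {f : M → N}
    (hf : ContMDiff 𝓘(ℝ, E) 𝓘(ℝ, E') ∞ f) {η : DForm E' N k} (hη : η.IsSmooth) :
    (η.pullback f : DForm E M k).IsSmooth := fun x₀ =>
  (contDiffOn_pullbackWithin hη (isOpen_extChartAt_target x₀).uniqueDiffOn
    (contMDiffOn_comp_extChartAt_symm hf x₀)).congr fun _ hy => chartRep_pullback hf η x₀ hy

theorem DForm.d_pullback [IsManifold 𝓘(ℝ, E) ∞ M]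
    [IsManifold 𝓘(ℝ, E') ∞ N] {f : M → N}
    (hf : ContMDiff 𝓘(ℝ, E) 𝓘(ℝ, E') ∞ f) {η : DForm E' N k} (hη : η.IsSmooth) :
    (η.pullback f : DForm E M k).d = η.d.pullback f := by
  refine DForm.ext_val fun x => ?_
  have hx := mem_extChartAt_source (I := 𝓘(ℝ, E)) x
  have ht := mem_extChartAt_target (I := 𝓘(ℝ, E)) x
  have ho := isOpen_extChartAt_target (I := 𝓘(ℝ, E)) x
  have he : (η.pullback f : DForm E M k).chartRep x =ᶠ[𝓝 (extChartAt 𝓘(ℝ, E) x x)]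
      pullbackWithin (fun z => f ((extChartAt 𝓘(ℝ, E) x).symm z))
        (extChartAt 𝓘(ℝ, E) x).target η := by
    filter_upwards [ho.mem_nhds ht] with y hy
    exact chartRep_pullback hf η x hy
  rw [DForm.d_val, he.extDeriv_eq, ← extDerivWithin_univ,
    ← show extDerivWithin (pullbackWithin (fun z => f ((extChartAt 𝓘(ℝ, E) x).symm z))
        (extChartAt 𝓘(ℝ, E) x).target η) (extChartAt 𝓘(ℝ, E) x).target (extChartAt 𝓘(ℝ, E) x x) =
      extDerivWithin _ univ (extChartAt 𝓘(ℝ, E) x x) by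
      simp only [extDerivWithin, fderivWithin_univ, fderivWithin_of_isOpen ho ht],
    extDerivWithin_pullbackWithin hη ho.uniqueDiffOn (contMDiffOn_comp_extChartAt_symm hf x) ht
      (by rw [ho.interior_eq]; exact subset_closure ht), ← chartRep_pullback hf η.d x ht,
    ← DForm.val_eq_chartRep _ hx]

/-- Differentiability at the chart centres is all that is asked, so that the lemma also covers fibre
integrals, for which only differentiability is proved. -/
theorem DForm.d_add {η θ : DForm E M k}
    (hη : ∀ x, DifferentiableAt ℝ (η.chartRep x) (extChartAt 𝓘(ℝ, E) x x))
    (hθ : ∀ x, DifferentiableAt ℝ (θ.chartRep x) (extChartAt 𝓘(ℝ, E) x x)) :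
    (η + θ).d = η.d + θ.d := by
  refine DForm.ext_val fun x => ?_
  rw [DForm.d_val, DForm.chartRep_add, extDeriv_add (hη x) (hθ x)]
  rfl

theorem DForm.IsSmooth.differentiableAt {η : DForm E M k} (hη : η.IsSmooth) (x : M) :
    DifferentiableAt ℝ (η.chartRep x) (extChartAt 𝓘(ℝ, E) x x) :=
  (hη.contDiffAt (mem_extChartAt_target x)).differentiableAt (by simp)

theorem DForm.d_smul (c : ℝ) (η : DForm E M k) : (c • η).d = c • η.d := by
  refine DForm.ext_val fun x => ?_
  rw [DForm.d_val, DForm.chartRep_smul, extDeriv_smul]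
  rfl

variable (E M k) in
/-- The exterior derivative as a linear map on smooth forms. -/
def DForm.dLinear : smoothForms E M k →ₗ[ℝ] DForm E M (k + 1) where
  toFun η := (η : DForm E M k).d
  map_add' η θ := by
    rw [Submodule.coe_add]
    exact DForm.d_add (DForm.IsSmooth.differentiableAt η.2) (DForm.IsSmooth.differentiableAt θ.2)
  map_smul' c η := by
    rw [Submodule.coe_smul]
    exact DForm.d_smul c _

end Pullback

/-! ### Geometry of the standard simplex and iterated integration over it. -/

section CornerSimplex

theorem isClosed_cornerSimplex (q : ℕ) : IsClosed (cornerSimplex q) := by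
  have : cornerSimplex q = (⋂ j, {t : Fin q → ℝ | 0 ≤ t j}) ∩ {t | ∑ j, t j ≤ 1} := by
    ext t; simp [cornerSimplex]
  rw [this]
  exact (isClosed_iInter fun j => isClosed_le continuous_const (continuous_apply j)).inter
    (isClosed_le (continuous_finsetSum _ fun j _ => continuous_apply j) continuous_const)

theorem cornerSimplex_subset_Icc (q : ℕ) : cornerSimplex q ⊆ Icc 0 1 := fun t ht =>
  ⟨fun j => ht.1 j, fun j => (Finset.single_le_sum (f := t) (fun i _ => ht.1 i)
    (Finset.mem_univ j)).trans ht.2⟩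

theorem isCompact_cornerSimplex (q : ℕ) : IsCompact (cornerSimplex q) :=
  isCompact_Icc.of_isClosed_subset (isClosed_cornerSimplex q) (cornerSimplex_subset_Icc q)

theorem measurableSet_cornerSimplex (q : ℕ) : MeasurableSet (cornerSimplex q) :=
  (isClosed_cornerSimplex q).measurableSet

theorem convex_cornerSimplex (q : ℕ) : Convex ℝ (cornerSimplex q) := by
  intro x hx y hy a b ha hb hab
  refine ⟨fun j => ?_, ?_⟩
  · simpa using add_nonneg (mul_nonneg ha (hx.1 j)) (mul_nonneg hb (hy.1 j))
  · simp only [Pi.add_apply, Pi.smul_apply, smul_eq_mul, Finset.sum_add_distrib, ← Finset.mul_sum]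
    nlinarith [hx.2, hy.2]

theorem nonempty_interior_cornerSimplex (q : ℕ) : (interior (cornerSimplex q)).Nonempty := by
  refine ⟨fun _ => 1 / (q + 1), ?_⟩
  have ho : IsOpen ((⋂ j, {t : Fin q → ℝ | 0 < t j}) ∩ {t | ∑ j, t j < 1}) :=
    (isOpen_iInter_of_finite fun j => isOpen_lt continuous_const (continuous_apply j)).inter
      (isOpen_lt (continuous_finsetSum _ fun j _ => continuous_apply j) continuous_const)
  refine interior_maximal ?_ ho ⟨?_, ?_⟩
  · rintro t ⟨h1, h2⟩
    exact ⟨fun j => (mem_iInter.1 h1 j).le, h2.le⟩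
  · refine mem_iInter.2 fun j => ?_
    simp only [mem_ofPred_eq]; positivity
  · simp only [mem_ofPred_eq, Finset.sum_const, Finset.card_univ, Fintype.card_fin, nsmul_eq_mul]
    rw [mul_one_div, div_lt_one (by positivity)]
    linarith

theorem uniqueDiffOn_cornerSimplex (q : ℕ) : UniqueDiffOn ℝ (cornerSimplex q) :=
  uniqueDiffOn_convex (convex_cornerSimplex q) (nonempty_interior_cornerSimplex q)

theorem cornerSimplex_subset_closure_interior (q : ℕ) :
    cornerSimplex q ⊆ closure (interior (cornerSimplex q)) := by
  rw [(convex_cornerSimplex q).closure_interior_eq_closure_of_nonempty_interior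
    (nonempty_interior_cornerSimplex q)]
  exact subset_closure

/-- The simplex is fibred over its j-th coordinate face by the intervals [0, 1 - ∑ s]; Fubini and
the fundamental theorem of calculus are used along these. -/
theorem insertNth_mem_cornerSimplex {n : ℕ} (j : Fin (n + 1)) (r : ℝ) (s : Fin n → ℝ) :
    (j.insertNth r s : Fin (n + 1) → ℝ) ∈ cornerSimplex (n + 1) ↔
      s ∈ cornerSimplex n ∧ r ∈ Icc 0 (1 - ∑ l, s l) := by
  simp only [cornerSimplex, mem_ofPred_eq, Fin.forall_iff_succAbove j, Fin.insertNth_apply_same,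
    Fin.insertNth_apply_succAbove, Fin.sum_insertNth, mem_Icc]
  constructor
  · rintro ⟨⟨h1, h2⟩, h3⟩
    exact ⟨⟨h2, by linarith⟩, h1, by linarith⟩
  · rintro ⟨⟨h1, h2⟩, h3, h4⟩
    exact ⟨⟨h3, h1⟩, by linarith⟩

/-- Integration over the simplex along the `j`-th coordinate first. -/
theorem setIntegral_cornerSimplex_succ {n : ℕ} (j : Fin (n + 1)) {g : (Fin (n + 1) → ℝ) → ℝ}
    (hg : IntegrableOn g (cornerSimplex (n + 1))) :
    ∫ t in cornerSimplex (n + 1), g t =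
      ∫ s in cornerSimplex n, ∫ r in (0 : ℝ)..(1 - ∑ l, s l), g (j.insertNth r s) := by
  have hmp := (volume_preserving_piFinSuccAbove (fun _ : Fin (n + 1) => ℝ) j).symm
  rw [← integral_indicator (measurableSet_cornerSimplex _), ← hmp.integral_comp
    (MeasurableEquiv.measurableEmbedding _), Measure.volume_eq_prod, integral_prod_symm]
  · rw [← integral_indicator (measurableSet_cornerSimplex _)]
    congr 1
    funext s
    by_cases hs : s ∈ cornerSimplex n
    · rw [indicator_of_mem hs, intervalIntegral.integral_of_le (by linarith [hs.2]),
        ← integral_Icc_eq_integral_Ioc, ← integral_indicator measurableSet_Icc]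
      congr 1
      funext r
      by_cases hr : r ∈ Icc 0 (1 - ∑ l, s l)
      · rw [indicator_of_mem hr, indicator_of_mem]
        · rfl
        · exact (insertNth_mem_cornerSimplex j r s).2 ⟨hs, hr⟩
      · rw [indicator_of_notMem hr, indicator_of_notMem]
        exact fun h => hr ((insertNth_mem_cornerSimplex j r s).1 h).2
    · rw [indicator_of_notMem hs]
      refine integral_eq_zero_of_ae (Filter.Eventually.of_forall fun r => ?_)
      refine indicator_of_notMem (fun h => hs ?_) _
      exact ((insertNth_mem_cornerSimplex j r s).1 h).1
  · rw [← Measure.volume_eq_prod]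
    exact (hmp.integrable_comp_emb (MeasurableEquiv.measurableEmbedding _)).2
      ((integrable_indicator_iff (measurableSet_cornerSimplex _)).2 hg)

theorem continuous_insertNth {n : ℕ} (j : Fin (n + 1)) :
    Continuous fun p : ℝ × (Fin n → ℝ) => (j.insertNth p.1 p.2 : Fin (n + 1) → ℝ) :=
  Continuous.finInsertNth j continuous_fst continuous_snd

/-- Integrating first along the j-th coordinate, the fundamental theorem of calculus leaves the two
ends of each fibre: one on the slanted face, one on the j-th coordinate face. -/
theorem setIntegral_partialDeriv {n : ℕ} (j : Fin (n + 1)) {f : (Fin (n + 1) → ℝ) → ℝ}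
    (hf : ContDiffOn ℝ 1 f (cornerSimplex (n + 1))) :
    ∫ t in cornerSimplex (n + 1), fderivWithin ℝ f (cornerSimplex (n + 1)) t (Pi.single j 1) =
      ∫ s in cornerSimplex n,
        (f (j.insertNth (1 - ∑ l, s l) s) - f (j.insertNth 0 s)) := by
  have hc : ContinuousOn (fun t => fderivWithin ℝ f (cornerSimplex (n + 1)) t (Pi.single j 1))
      (cornerSimplex (n + 1)) :=
    (hf.continuousOn_fderivWithin (uniqueDiffOn_cornerSimplex _) le_rfl).clm_apply
      continuousOn_const
  rw [setIntegral_cornerSimplex_succ j (hc.integrableOn_compact (isCompact_cornerSimplex _))]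
  refine setIntegral_congr_fun (measurableSet_cornerSimplex n) fun s hs => ?_
  have h0 : (0 : ℝ) ≤ 1 - ∑ l, s l := by linarith [hs.2]
  have hmap : MapsTo (fun r : ℝ => (j.insertNth r s : Fin (n + 1) → ℝ)) (Icc 0 (1 - ∑ l, s l))
      (cornerSimplex (n + 1)) := fun r hr => (insertNth_mem_cornerSimplex j r s).2 ⟨hs, hr⟩
  have hcont : Continuous fun r : ℝ => (j.insertNth r s : Fin (n + 1) → ℝ) :=
    (continuous_insertNth j).comp (continuous_id.prodMk continuous_const)
  have hderiv : ∀ r, HasDerivAt (fun r : ℝ => (j.insertNth r s : Fin (n + 1) → ℝ))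
      (Pi.single j 1) r := by
    intro r
    rw [hasDerivAt_pi]
    intro i
    refine Fin.succAboveCases j ?_ (fun i => ?_) i
    · simpa using hasDerivAt_id' r
    · simpa using hasDerivAt_const r (s i)
  refine intervalIntegral.integral_eq_sub_of_hasDerivAt_of_le h0
    (hf.continuousOn.comp hcont.continuousOn hmap) (fun r hr => ?_) ?_
  · have h1 : HasFDerivWithinAt f (fderivWithin ℝ f (cornerSimplex (n + 1)) (j.insertNth r s))
        (cornerSimplex (n + 1)) (j.insertNth r s) :=
      (hf.differentiableOn (by simp) _ (hmap (Ioo_subset_Icc_self hr))).hasFDerivWithinAt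
    exact (h1.comp_hasDerivWithinAt r (hderiv r).hasDerivWithinAt hmap).hasDerivAt
      (Icc_mem_nhds hr.1 hr.2)
  · refine ContinuousOn.intervalIntegrable ?_
    rw [uIcc_of_le h0]
    exact hc.comp hcont.continuousOn hmap

theorem insertNth_succ_cons {n : ℕ} (k : Fin (n + 1)) (r a : ℝ) (s : Fin n → ℝ) :
    (k.succ.insertNth r (Fin.cons a s : Fin (n + 1) → ℝ) : Fin (n + 2) → ℝ) =
      Fin.cons a (k.insertNth r s : Fin (n + 1) → ℝ) := by
  funext i
  refine Fin.cases ?_ (fun i => ?_) i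
  · have : (0 : Fin (n + 2)) = k.succ.succAbove 0 := by simp
    rw [Fin.cons_zero, this, Fin.insertNth_apply_succAbove, Fin.cons_zero]
  · rw [Fin.cons_succ]
    refine Fin.succAboveCases k ?_ (fun i => ?_) i
    · rw [Fin.insertNth_apply_same, Fin.insertNth_apply_same]
    · rw [← Fin.succ_succAbove_succ, Fin.insertNth_apply_succAbove, Fin.insertNth_apply_succAbove,
        Fin.cons_succ]

/-- The integral over the slanted face does not depend on the coordinate that is eliminated. -/
theorem setIntegral_slantedFace {n : ℕ} (j : Fin (n + 1)) {f : (Fin (n + 1) → ℝ) → ℝ}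
    (hf : ContinuousOn f (cornerSimplex (n + 1))) :
    ∫ s in cornerSimplex n, f (j.insertNth (1 - ∑ l, s l) s) =
      ∫ s in cornerSimplex n, f (Fin.cons (1 - ∑ l, s l) s) := by
  have hint : ∀ (i : Fin (n + 1)), IntegrableOn (fun s : Fin n → ℝ =>
      f (i.insertNth (1 - ∑ l, s l) s)) (cornerSimplex n) := by
    intro i
    refine ContinuousOn.integrableOn_compact (isCompact_cornerSimplex _) (hf.comp ?_ ?_)
    · exact ((continuous_insertNth i).comp ((continuous_const.sub
        (continuous_finsetSum _ fun l _ => continuous_apply l)).prodMk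
          continuous_id)).continuousOn
    · intro s hs
      exact (insertNth_mem_cornerSimplex i _ s).2 ⟨hs, by linarith [hs.2], le_rfl⟩
  refine Fin.cases ?_ (fun k => ?_) j
  · simp
  · obtain _ | n := n
    · exact k.elim0
    have h0 := hint 0
    have hz : ∀ (r : ℝ) (s : Fin (n + 1) → ℝ), ((0 : Fin (n + 2)).insertNth r s :
      Fin (n + 2) → ℝ) = Fin.cons r s := fun r s => Fin.insertNth_zero' r s
    simp only [hz] at h0
    rw [setIntegral_cornerSimplex_succ 0 (hint _), setIntegral_cornerSimplex_succ k h0]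
    refine setIntegral_congr_fun (measurableSet_cornerSimplex n) fun s _ => ?_
    -- With the other coordinates fixed, both integrals run over the same segment of the slanted
    -- face in opposite directions. The reflection r ↦ 1 - ∑ s - r identifies them.
    have := intervalIntegral.integral_comp_sub_left (a := 0) (b := 1 - ∑ l, s l)
      (fun r => f (Fin.cons (1 - ∑ l, (k.insertNth r s : Fin (n + 1) → ℝ) l)
        (k.insertNth r s : Fin (n + 1) → ℝ))) (1 - ∑ l, s l)
    rw [sub_self, sub_zero] at this
    rw [← this]
    refine intervalIntegral.integral_congr fun r _ => ?_
    simp only [Fin.insertNth_zero', insertNth_succ_cons, Fin.sum_insertNth, Fin.sum_cons]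
    congr 3
    · ring
    · ring

end CornerSimplex

/-! ### Stokes' theorem on the standard simplex. -/

section SimplexStokes

theorem faceInclusion_succ {n : ℕ} (j : Fin (n + 1)) (s : Fin n → ℝ) :
    faceInclusion j.succ s = j.insertNth 0 s := by
  funext i
  rw [faceInclusion, insertNth_succ_cons, Fin.cons_succ]

theorem faceInclusion_zero {n : ℕ} (s : Fin n → ℝ) :
    faceInclusion (0 : Fin (n + 2)) s = Fin.cons (1 - ∑ l, s l) s := by
  funext i
  simp [faceInclusion]

theorem fderiv_faceInclusion_succ {n : ℕ} (j : Fin (n + 1)) (s : Fin n → ℝ) (l : Fin n) :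
    fderiv ℝ (faceInclusion j.succ) s (Pi.single l 1) = Pi.single (j.succAbove l) 1 := by
  rw [show faceInclusion j.succ = fun s : Fin n → ℝ => (j.insertNth 0 s : Fin (n + 1) → ℝ) from
    funext (faceInclusion_succ j)]
  have hd : HasFDerivAt (fun s : Fin n → ℝ => (j.insertNth 0 s : Fin (n + 1) → ℝ))
      (ContinuousLinearMap.pi (j.insertNth (0 : (Fin n → ℝ) →L[ℝ] ℝ)
        fun i => (ContinuousLinearMap.proj i : (Fin n → ℝ) →L[ℝ] ℝ))) s := by
    rw [hasFDerivAt_pi]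
    intro i
    refine Fin.succAboveCases j ?_ (fun i => ?_) i
    · simpa using hasFDerivAt_const (0 : ℝ) s
    · simpa using hasFDerivAt_apply i s
  rw [hd.fderiv]
  funext i
  refine Fin.succAboveCases j ?_ (fun i => ?_) i
  · simp [(Fin.succAbove_ne j l).symm]
  · simp [Pi.single_apply]

theorem fderiv_faceInclusion_zero {n : ℕ} (s : Fin n → ℝ) (l : Fin n) :
    fderiv ℝ (faceInclusion (0 : Fin (n + 2))) s (Pi.single l 1) =
      Pi.single l.succ 1 - Pi.single 0 1 := by
  rw [show faceInclusion (0 : Fin (n + 2)) = fun s : Fin n → ℝ =>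
    (Fin.cons (1 - ∑ l, s l) s : Fin (n + 1) → ℝ) from funext faceInclusion_zero]
  have hd : HasFDerivAt (fun s : Fin n → ℝ => (Fin.cons (1 - ∑ l, s l) s : Fin (n + 1) → ℝ))
      (ContinuousLinearMap.pi fun i => Fin.cases (motive := fun _ => (Fin n → ℝ) →L[ℝ] ℝ)
        (-∑ l, ContinuousLinearMap.proj l) (fun i => ContinuousLinearMap.proj i) i) s := by
    rw [hasFDerivAt_pi]
    intro i
    refine Fin.cases ?_ (fun i => ?_) i
    · simp only [Fin.cons_zero, Fin.cases_zero]
      exact (HasFDerivAt.fun_sum fun l _ => hasFDerivAt_apply l s).const_sub 1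
    · simpa using hasFDerivAt_apply i s
  rw [hd.fderiv]
  funext i
  refine Fin.cases ?_ (fun i => ?_) i
  · simp
  · simp [Pi.single_apply]

variable {V : Type*} [AddCommGroup V] [Module ℝ V]

/-- An alternating form that vanishes as soon as one argument is `e` does not change when multiples
of `e` are subtracted from the arguments. -/
theorem MultilinearMap.map_sub_const_eq {n : ℕ} (b : MultilinearMap ℝ (fun _ : Fin n => V) ℝ)
    {e : V} (hb : ∀ v j, v j = e → b v = 0) (v : Fin n → V) :
    b (fun l => v l - e) = b v := by
  classical
  -- The arguments are modified one at a time; each change costs a term having `e` as an argument,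
  -- which vanishes.
  suffices H : ∀ s : Finset (Fin n), b (s.piecewise (fun l => v l - e) v) = b v by
    simpa using H Finset.univ
  intro s
  induction s using Finset.induction_on with
  | empty => simp
  | insert j s hj ih =>
    rw [Finset.piecewise_insert, b.map_update_sub, hb (Function.update _ j e) j (by simp), sub_zero,
      ← ih]
    congr 1
    rw [Function.update_eq_self_iff, Finset.piecewise_eq_of_notMem _ _ _ hj]

/-- Let L be the sum of the coordinates and w = L ∧ a. Since w is alternating, it has the same value
on (e₀, e₁ - e₀, …) as on (e₀, e₁, …). As L kills each difference and is 1 on each basis vector, the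
first value is the left side and the second the right side. This evaluates a form on the slanted
face through forms on the coordinate frames. -/
theorem ContinuousAlternatingMap.map_sub_first {n : ℕ}
    (a : (Fin (n + 1) → ℝ) [⋀^Fin n]→L[ℝ] ℝ) :
    a (fun l => Pi.single l.succ 1 - Pi.single 0 1) =
      ∑ j : Fin (n + 1), (-1 : ℝ) ^ (j : ℕ) * a (fun l => Pi.single (j.succAbove l) 1) := by
  let L : (Fin (n + 1) → ℝ) →L[ℝ] ℝ := ∑ i, ContinuousLinearMap.proj i
  have hL : ∀ i, L (Pi.single i 1) = 1 := fun i => by simp [L]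
  let w : (Fin (n + 1) → ℝ) [⋀^Fin (n + 1)]→L[ℝ] ℝ :=
    ContinuousAlternatingMap.alternatizeUncurryFin (L.smulRight a)
  have hw : ∀ v, w v = ∑ j : Fin (n + 1), (-1 : ℝ) ^ (j : ℕ) * (L (v j) * a (j.removeNth v)) := by
    intro v
    simp [w, ContinuousAlternatingMap.alternatizeUncurryFin_apply]
  have key := MultilinearMap.map_sub_const_eq
    (w.toAlternatingMap.toMultilinearMap.curryLeft (Pi.single 0 1)) (e := Pi.single 0 1)
    (fun v j hj => w.toAlternatingMap.map_eq_zero_of_eq (i := 0) (j := j.succ) _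
      (by simp [hj]) (Fin.succ_ne_zero j).symm) (fun l => Pi.single l.succ 1)
  have e1 : w (Fin.cons (Pi.single 0 1) fun l : Fin n =>
      (Pi.single l.succ 1 - Pi.single 0 1 : Fin (n + 1) → ℝ)) =
      a (fun l => Pi.single l.succ 1 - Pi.single 0 1) := by
    rw [hw, Fin.sum_univ_succ, Finset.sum_eq_zero]
    · simp [hL, Fin.removeNth_zero]
    · intro j _
      simp [hL, map_sub]
  have e2 : w (Fin.cons (Pi.single 0 1) fun l : Fin n =>
      (Pi.single l.succ 1 : Fin (n + 1) → ℝ)) =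
      ∑ j : Fin (n + 1), (-1 : ℝ) ^ (j : ℕ) * a (fun l => Pi.single (j.succAbove l) 1) := by
    have : (Fin.cons (Pi.single 0 1) fun l : Fin n => (Pi.single l.succ 1 : Fin (n + 1) → ℝ)) =
        fun i : Fin (n + 1) => (Pi.single i 1 : Fin (n + 1) → ℝ) := by
      funext i
      refine Fin.cases rfl (fun i => rfl) i
    rw [this, hw]
    simp only [hL, one_mul]
    rfl
  rw [← e1, ← e2]
  exact key

/-- Stokes' theorem on the standard simplex. -/
theorem setIntegral_extDerivWithin_cornerSimplex {n : ℕ}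
    {μ : (Fin (n + 1) → ℝ) → (Fin (n + 1) → ℝ) [⋀^Fin n]→L[ℝ] ℝ}
    (hμ : ContDiffOn ℝ 1 μ (cornerSimplex (n + 1))) :
    ∫ t in cornerSimplex (n + 1),
        extDerivWithin μ (cornerSimplex (n + 1)) t (fun j => Pi.single j 1) =
      ∑ i : Fin (n + 2), (-1 : ℝ) ^ (i : ℕ) *
        ∫ s in cornerSimplex n, μ (faceInclusion i s)
          fun l => fderiv ℝ (faceInclusion i) s (Pi.single l 1) := by
  have hU := uniqueDiffOn_cornerSimplex (n + 1)
  let f : Fin (n + 1) → (Fin (n + 1) → ℝ) → ℝ := fun j t =>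
    μ t fun l => Pi.single (j.succAbove l) 1
  have hf : ∀ j, ContDiffOn ℝ 1 (f j) (cornerSimplex (n + 1)) := fun j =>
    (ContinuousAlternatingMap.apply ℝ (Fin (n + 1) → ℝ) ℝ
      (fun l => Pi.single (j.succAbove l) 1)).contDiff.comp_contDiffOn hμ
  have hc : ∀ j, ContinuousOn (fun t => fderivWithin ℝ (f j) (cornerSimplex (n + 1)) t
      (Pi.single j 1)) (cornerSimplex (n + 1)) := fun j =>
    ((hf j).continuousOn_fderivWithin hU le_rfl).clm_apply continuousOn_const
  have hfi : ∀ (j : Fin (n + 1)) (g : (Fin n → ℝ) → ℝ), Continuous g →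
      (∀ s ∈ cornerSimplex n, g s ∈ Icc 0 (1 - ∑ l, s l)) →
      IntegrableOn (fun s => f j (j.insertNth (g s) s)) (cornerSimplex n) := by
    intro j g hg hgs
    refine ContinuousOn.integrableOn_compact (isCompact_cornerSimplex _)
      ((hf j).continuousOn.comp ((continuous_insertNth j).comp
        (hg.prodMk continuous_id)).continuousOn fun s hs =>
          (insertNth_mem_cornerSimplex j _ s).2 ⟨hs, hgs s hs⟩)
  have hsum : Continuous fun s : Fin n → ℝ => 1 - ∑ l, s l :=
    continuous_const.sub (continuous_finsetSum _ fun l _ => continuous_apply l)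
  have hcons : ∀ j, IntegrableOn (fun s : Fin n → ℝ => f j (Fin.cons (1 - ∑ l, s l) s))
      (cornerSimplex n) := by
    intro j
    refine ContinuousOn.integrableOn_compact (isCompact_cornerSimplex _)
      ((hf j).continuousOn.comp (t := cornerSimplex (n + 1)) ?_ fun s hs => ?_)
    · have := (continuous_insertNth (0 : Fin (n + 1))).comp (hsum.prodMk continuous_id)
      simpa [Function.comp_def, Fin.insertNth_zero'] using this.continuousOn
    · have := (insertNth_mem_cornerSimplex 0 (1 - ∑ l, s l) s).2 ⟨hs, by linarith [hs.2], le_rfl⟩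
      simpa [Fin.insertNth_zero'] using this
  have h1 : ∫ t in cornerSimplex (n + 1),
        extDerivWithin μ (cornerSimplex (n + 1)) t (fun j => Pi.single j 1) =
      ∑ j : Fin (n + 1), (-1 : ℝ) ^ (j : ℕ) * ∫ t in cornerSimplex (n + 1),
        fderivWithin ℝ (f j) (cornerSimplex (n + 1)) t (Pi.single j 1) := by
    simp only [← integral_const_mul]
    rw [← integral_finsetSum]
    · refine setIntegral_congr_fun (measurableSet_cornerSimplex _) fun t ht => ?_
      rw [extDerivWithin_apply (hμ.differentiableOn (by simp) t ht) (hU t ht)]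
      refine Finset.sum_congr rfl fun j _ => ?_
      rw [← Int.cast_smul_eq_zsmul ℝ, smul_eq_mul]
      push_cast
      rfl
    · intro j _
      exact ((hc j).integrableOn_compact (isCompact_cornerSimplex _)).const_mul _
  rw [h1]
  conv_rhs => rw [Fin.sum_univ_succ]
  simp only [fderiv_faceInclusion_zero, fderiv_faceInclusion_succ,
    ContinuousAlternatingMap.map_sub_first, faceInclusion_zero, faceInclusion_succ]
  rw [integral_finsetSum _ fun j _ => (hcons j).const_mul _]
  simp only [integral_const_mul, Fin.val_zero, pow_zero, one_mul]
  -- The face opposite the origin has been split into one term per coordinate, and the others are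
  -- already indexed by a coordinate; the identity now holds separately for each j.
  rw [← Finset.sum_add_distrib]
  refine Finset.sum_congr rfl fun j _ => ?_
  rw [setIntegral_partialDeriv j (hf j), integral_sub (hfi j _ hsum fun s hs =>
      ⟨by linarith [hs.2], le_rfl⟩) (hfi j _ continuous_const fun s hs =>
      ⟨le_rfl, by linarith [hs.2]⟩), setIntegral_slantedFace j (hf j).continuousOn, Fin.val_succ]
  simp only [f]
  ring

end SimplexStokes

/-! ### Integrals over smooth singular chains: Stokes and naturality. -/

section ChainIntegrals

variable {E : Type*} [NormedAddCommGroup E] [NormedSpace ℝ E]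
  {M : Type*} [TopologicalSpace M] [ChartedSpace E M]
  {E' : Type*} [NormedAddCommGroup E'] [NormedSpace ℝ E']
  {N : Type*} [TopologicalSpace N] [ChartedSpace E' N] {q k : ℕ}

/-- The extension of a smooth singular simplex to the ambient space. -/
abbrev SmoothSimplex.ext (σ : SmoothSimplex E M q) : (Fin q → ℝ) → M := simplexExtend σ.toFun

/-- The standard frame of `ℝ^q`. -/
def stdFrame (q : ℕ) : Fin q → Fin q → ℝ := fun j => Pi.single j 1

theorem SmoothSimplex.integral_form (σ : SmoothSimplex E M q) (η : DForm E M q) :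
    σ.integral (fun x v => η x v) =
      ∫ t in cornerSimplex q, pullbackWithin σ.ext (cornerSimplex q) η t (stdFrame q) := rfl

theorem SmoothSimplex.mdifferentiableWithinAt (σ : SmoothSimplex E M q) {t : Fin q → ℝ}
    (ht : t ∈ cornerSimplex q) :
    MDifferentiableWithinAt 𝓘(ℝ, Fin q → ℝ) 𝓘(ℝ, E) σ.ext (cornerSimplex q) t :=
  (σ.smooth t ht).mdifferentiableWithinAt (by simp)

theorem SmoothSimplex.ext_face (σ : SmoothSimplex E M (q + 1)) (i : Fin (q + 2)) {t : Fin q → ℝ}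
    (ht : t ∈ cornerSimplex q) : (σ.face i).ext t = σ.ext (faceInclusion i t) := by
  rw [SmoothSimplex.ext, SmoothSimplex.ext, simplexExtend_of_mem _ ht,
    simplexExtend_of_mem _ (faceInclusion_mapsTo i ht)]
  rfl

theorem SmoothSimplex.mDW_face (σ : SmoothSimplex E M (q + 1)) (i : Fin (q + 2)) {t : Fin q → ℝ}
    (ht : t ∈ cornerSimplex q) :
    mDW (Fin q → ℝ) E (σ.face i).ext (cornerSimplex q) t =
      (mDW (Fin (q + 1) → ℝ) E σ.ext (cornerSimplex (q + 1)) (faceInclusion i t)).comp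
        (fderiv ℝ (faceInclusion i) t) := by
  have hU := uniqueDiffOn_cornerSimplex q t ht
  have hd : DifferentiableAt ℝ (faceInclusion i) t :=
    (faceInclusion_contDiff i).contDiffAt.differentiableAt (by simp)
  rw [← hd.fderivWithin hU, ← mDW_eq_fderivWithin,
    ← mDW_comp (σ.mdifferentiableWithinAt (faceInclusion_mapsTo i ht))
      hd.mdifferentiableAt.mdifferentiableWithinAt (faceInclusion_mapsTo i)
      hU.uniqueMDiffWithinAt]
  exact mDW_congr (by filter_upwards [self_mem_nhdsWithin] with s hs using σ.ext_face i hs)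
    (σ.ext_face i ht)

theorem SmoothChain.integral_eq_linearCombination {V : Type*} [NormedAddCommGroup V]
    [NormedSpace ℝ V] (α : SmoothChain E M q) (η : ∀ x : M, (Fin q → TangentSpace 𝓘(ℝ, E) x) → V) :
    α.integral η = Finsupp.linearCombination ℝ (fun σ : SmoothSimplex E M q => σ.integral η) α := rfl

/-- Stated for an arbitrary function `J` of simplices, so that it serves both for integrals of forms
and for the fibre integrals over faces in `d_fGamma`. -/
theorem SmoothChain.linearCombination_boundary {V : Type*} [AddCommGroup V] [Module ℝ V]
    (β : SmoothChain E M (q + 1)) (J : SmoothSimplex E M q → V) :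
    Finsupp.linearCombination ℝ J (SmoothChain.boundary β) =
      β.sum fun σ r => r • ∑ i : Fin (q + 2), (-1 : ℝ) ^ (i : ℕ) • J (σ.face i) := by
  rw [SmoothChain.boundary, map_finsuppSum]
  refine Finsupp.sum_congr fun σ _ => ?_
  simp only [map_sum, Finsupp.linearCombination_single, Finset.smul_sum, smul_smul, mul_comm]

variable [IsManifold 𝓘(ℝ, E) ∞ M] [IsManifold 𝓘(ℝ, E') ∞ N]

theorem SmoothSimplex.integral_d (σ : SmoothSimplex E M (q + 1)) {η : DForm E M q}
    (hη : η.IsSmooth) :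
    σ.integral (fun x v => η.d x v) =
      ∑ i : Fin (q + 2), (-1 : ℝ) ^ (i : ℕ) • (σ.face i).integral fun x v => η x v := by
  have hU := uniqueDiffOn_cornerSimplex (q + 1)
  have hs := contDiffOn_pullbackWithin hη hU σ.smooth
  have hst := setIntegral_extDerivWithin_cornerSimplex (hs.of_le (by simp))
  simp only [SmoothSimplex.integral_form, smul_eq_mul]
  calc _ = ∫ t in cornerSimplex (q + 1), extDerivWithin (pullbackWithin σ.ext
        (cornerSimplex (q + 1)) η) (cornerSimplex (q + 1)) t (stdFrame (q + 1)) := by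
        refine setIntegral_congr_fun (measurableSet_cornerSimplex _) fun t ht => ?_
        rw [extDerivWithin_pullbackWithin hη hU σ.smooth ht
          (cornerSimplex_subset_closure_interior _ ht)]
    _ = _ := hst
    _ = _ := by
      refine Finset.sum_congr rfl fun i _ => ?_
      congr 1
      refine setIntegral_congr_fun (measurableSet_cornerSimplex _) fun t ht => ?_
      rw [pullbackWithin, pullbackWithin, σ.mDW_face i ht, σ.ext_face i ht]
      rfl

/-- Stokes' theorem for smooth singular chains. -/
theorem SmoothChain.integral_boundary (β : SmoothChain E M (q + 1)) {η : DForm E M q}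
    (hη : η.IsSmooth) :
    (SmoothChain.boundary β).integral (fun x v => η x v) = β.integral fun x v => η.d x v := by
  rw [SmoothChain.integral_eq_linearCombination, SmoothChain.linearCombination_boundary,
    SmoothChain.integral]
  exact Finsupp.sum_congr fun σ _ => by rw [σ.integral_d hη]

omit [IsManifold 𝓘(ℝ, E) ∞ M] [IsManifold 𝓘(ℝ, E') ∞ N] in
theorem SmoothSimplex.ext_map {f : M → N} (hf : ContMDiff 𝓘(ℝ, E) 𝓘(ℝ, E') ∞ f)
    (σ : SmoothSimplex E M q) : (σ.map f hf).ext = fun t => f (σ.ext t) := by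
  funext t
  simp only [SmoothSimplex.ext, simplexExtend, SmoothSimplex.map]
  split_ifs <;> rfl

omit [IsManifold 𝓘(ℝ, E) ∞ M] [IsManifold 𝓘(ℝ, E') ∞ N] in
theorem SmoothSimplex.integral_map {f : M → N} (hf : ContMDiff 𝓘(ℝ, E) 𝓘(ℝ, E') ∞ f)
    (σ : SmoothSimplex E M q) (η : DForm E' N q) :
    (σ.map f hf).integral (fun x v => η x v) =
      σ.integral fun x v => (η.pullback f : DForm E M q) x v := by
  simp only [SmoothSimplex.integral_form]
  refine setIntegral_congr_fun (measurableSet_cornerSimplex _) fun t ht => ?_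
  simp only [pullbackWithin, σ.ext_map hf, DForm.pullback_val]
  rw [mD_comp_mDW (hf.mdifferentiableAt (by simp)) (σ.mdifferentiableWithinAt ht)
    (uniqueDiffOn_cornerSimplex q t ht).uniqueMDiffWithinAt]
  rfl

omit [IsManifold 𝓘(ℝ, E) ∞ M] [IsManifold 𝓘(ℝ, E') ∞ N] in
theorem SmoothChain.integral_mapDomain {f : M → N} (hf : ContMDiff 𝓘(ℝ, E) 𝓘(ℝ, E') ∞ f)
    (α : SmoothChain E M q) (η : DForm E' N q) :
    SmoothChain.integral (α.mapDomain (SmoothSimplex.map f hf)) (fun x v => η x v) =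
      α.integral fun x v => (η.pullback f : DForm E M q) x v := by
  rw [SmoothChain.integral_eq_linearCombination, SmoothChain.integral_eq_linearCombination,
    Finsupp.linearCombination_mapDomain]
  congr 2
  funext σ
  exact σ.integral_map hf η

end ChainIntegrals

/-! ### Differentiation under the integral over the simplex. -/

section ParametricIntegral

variable {F : Type*} [NormedAddCommGroup F] [NormedSpace ℝ F] [FiniteDimensional ℝ F] {q : ℕ}

/-- The derivative in the parameter is continuous, hence bounded on the product of a small closed
ball with the compact simplex; this constant dominates. Openness of `U` makes the derivative within
the product a genuine derivative in the parameter. -/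
theorem hasFDerivAt_setIntegral_cornerSimplex {H : F × (Fin q → ℝ) → ℝ} {U : Set F}
    (hU : IsOpen U) (hH : ContDiffOn ℝ 1 H (U ×ˢ cornerSimplex q)) {y₀ : F} (hy₀ : y₀ ∈ U) :
    HasFDerivAt (fun y => ∫ t in cornerSimplex q, H (y, t))
      (∫ t in cornerSimplex q, (fderivWithin ℝ H (U ×ˢ cornerSimplex q) (y₀, t)).comp
        (ContinuousLinearMap.inl ℝ F (Fin q → ℝ))) y₀ := by
  have hS : UniqueDiffOn ℝ (U ×ˢ cornerSimplex q) :=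
    hU.uniqueDiffOn.prod (uniqueDiffOn_cornerSimplex q)
  have hT := measurableSet_cornerSimplex q
  obtain ⟨ε, hε, hball⟩ := Metric.isOpen_iff.1 hU y₀ hy₀
  have hcb : Metric.closedBall y₀ (ε / 2) ⊆ U :=
    (Metric.closedBall_subset_ball (by linarith)).trans hball
  have hc : ContinuousOn (fun p => (fderivWithin ℝ H (U ×ˢ cornerSimplex q) p).comp
      (ContinuousLinearMap.inl ℝ F (Fin q → ℝ))) (U ×ˢ cornerSimplex q) :=
    (hH.continuousOn_fderivWithin hS le_rfl).clm_comp continuousOn_const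
  have hK : IsCompact (Metric.closedBall y₀ (ε / 2) ×ˢ cornerSimplex q) :=
    (isCompact_closedBall y₀ _).prod (isCompact_cornerSimplex q)
  obtain ⟨C, hC⟩ := hK.exists_bound_of_continuousOn
    (hc.mono (prod_mono hcb subset_rfl))
  have hslice : ∀ y ∈ U, ContinuousOn (fun t => H (y, t)) (cornerSimplex q) := fun y hy =>
    hH.continuousOn.comp (Continuous.continuousOn (by fun_prop)) fun t ht => ⟨hy, ht⟩
  refine (hasFDerivAt_integral_of_dominated_of_fderiv_le (𝕜 := ℝ)
    (F' := fun y t => (fderivWithin ℝ H (U ×ˢ cornerSimplex q) (y, t)).comp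
        (ContinuousLinearMap.inl ℝ F (Fin q → ℝ))) (bound := fun _ => C)
    (Metric.ball_mem_nhds y₀ (half_pos hε)) ?_ ?_ ?_ ?_ ?_ ?_)
  · filter_upwards [hU.mem_nhds hy₀] with y hy
    exact (hslice y hy).aestronglyMeasurable hT
  · exact (hslice y₀ hy₀).integrableOn_compact (isCompact_cornerSimplex q)
  · refine ContinuousOn.aestronglyMeasurable (hc.comp (f := fun t => (y₀, t))
      (Continuous.continuousOn (by fun_prop)) fun t ht => ⟨hy₀, ht⟩) hT
  · filter_upwards [ae_restrict_mem hT] with t ht y hy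
    exact hC (y, t) ⟨Metric.ball_subset_closedBall hy, ht⟩
  · exact (continuousOn_const (c := C)).integrableOn_compact (isCompact_cornerSimplex q)
  · filter_upwards [ae_restrict_mem hT] with t ht y hy
    have hyU := hcb (Metric.ball_subset_closedBall hy)
    have h1 := (hH.differentiableOn (by simp) (y, t) ⟨hyU, ht⟩).hasFDerivWithinAt
    have h2 : HasFDerivWithinAt (fun y : F => (y, t)) (ContinuousLinearMap.inl ℝ F (Fin q → ℝ))
        U y := by
      have := (hasFDerivAt_id (𝕜 := ℝ) y).prodMk (hasFDerivAt_const (𝕜 := ℝ) t y)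
      exact this.hasFDerivWithinAt
    exact (h1.comp y h2 (show MapsTo (fun y : F => (y, t)) U (U ×ˢ cornerSimplex q)
      from fun z hz => ⟨hz, ht⟩)).hasFDerivAt (hU.mem_nhds hyU)

end ParametricIntegral

/-! ### The map f_γ as fibre integration over translates of simplices, and its equivariance. -/

section FibreIntegration

variable {F : Type*} [NormedAddCommGroup F] [NormedSpace ℝ F]
  {G : Type*} [TopologicalSpace G] [ChartedSpace F G] [Group G]
  {E : Type*} [NormedAddCommGroup E] [NormedSpace ℝ E]
  {M : Type*} [TopologicalSpace M] [ChartedSpace E M]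
  [MulAction G M] {q k : ℕ}

theorem comp_joinArgs {X Y : Type*} (f : X → Y) (u : Fin k → X) (w : Fin q → X) :
    (fun i => f (joinArgs u w i)) = joinArgs (fun i => f (u i)) (fun j => f (w j)) := by
  funext i
  obtain ⟨i, rfl⟩ : ∃ i', i = Fin.cast (Nat.add_comm k q) i' :=
    ⟨Fin.cast (Nat.add_comm q k) i, by simp⟩
  simp only [joinArgs]
  refine Fin.addCases (fun l => ?_) (fun l => ?_) i <;> simp

theorem joinArgs_one {X : Type*} (u : Fin 1 → X) (w : Fin q → X) :
    (joinArgs u w : Fin (q + 1) → X) = Fin.cons (u 0) w := by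
  funext i
  refine Fin.cases ?_ (fun i => ?_) i
  · have : (0 : Fin (q + 1)) = Fin.cast (Nat.add_comm 1 q) (Fin.castAdd q 0) := rfl
    rw [this, joinArgs_castAdd, ← this, Fin.cons_zero]
  · rw [Fin.cons_succ, joinArgs, show Fin.cast (Nat.add_comm q 1) i.succ = Fin.natAdd 1 i by
      ext; simp [add_comm], Fin.append_right]

theorem joinArgs_zero {X : Type*} (u : Fin 0 → X) (w : Fin q → X) :
    (joinArgs u w : Fin (q + 0) → X) = w := by
  funext i
  rw [joinArgs, show Fin.cast (Nat.add_comm q 0) i = Fin.natAdd 0 i by ext; simp,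
    Fin.append_right]

variable [LieGroup 𝓘(ℝ, F) ∞ G]

/-- The integrand of the fibre integral of a form over a smooth singular simplex. -/
def fibreIntegrand (σ : SmoothSimplex E M q) (θ : DForm E M (q + k)) (g : G) (u : Fin k → F)
    (t : Fin q → ℝ) : ℝ :=
  θ.val (g • σ.ext t) (joinArgs (fun i => mD F E (fun h : G => h • σ.ext t) g (u i))
    fun j => mD E E (fun y => g • y) (σ.ext t)
      (mDW (Fin q → ℝ) E σ.ext (cornerSimplex q) t (stdFrame q j)))

/-- The family of translates of a smooth singular simplex, in the chart of the group at `g`. -/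
def translates (g : G) (σ : SmoothSimplex E M q) (p : F × (Fin q → ℝ)) : M :=
  (extChartAt 𝓘(ℝ, F) g).symm p.1 • σ.ext p.2

variable (F) in
/-- The domain of `translates`. -/
def translatesDomain (g : G) (q : ℕ) : Set (F × (Fin q → ℝ)) :=
  (extChartAt 𝓘(ℝ, F) g).target ×ˢ cornerSimplex q

omit [LieGroup 𝓘(ℝ, F) ∞ G] [Group G] in
theorem uniqueDiffOn_translatesDomain (g : G) (q : ℕ) :
    UniqueDiffOn ℝ (translatesDomain F g q) :=
  (isOpen_extChartAt_target g).uniqueDiffOn.prod (uniqueDiffOn_cornerSimplex q)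

omit [LieGroup 𝓘(ℝ, F) ∞ G] [Group G] in
theorem translatesDomain_subset (g : G) (q : ℕ) :
    translatesDomain F g q ⊆ closure (interior (translatesDomain F g q)) := by
  rw [translatesDomain, interior_prod_eq, closure_prod_eq, (isOpen_extChartAt_target g).interior_eq]
  exact prod_mono subset_closure (cornerSimplex_subset_closure_interior q)

variable [ContMDiffSMul 𝓘(ℝ, F) 𝓘(ℝ, E) ∞ G M]

theorem contMDiffOn_translates (g : G) (σ : SmoothSimplex E M q) :
    ContMDiffOn 𝓘(ℝ, F × (Fin q → ℝ)) 𝓘(ℝ, E) ∞ (translates (F := F) g σ)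
      (translatesDomain F g q) := by
  have h1 : ContMDiffOn 𝓘(ℝ, F × (Fin q → ℝ)) 𝓘(ℝ, F) ∞
      (fun p : F × (Fin q → ℝ) => (extChartAt 𝓘(ℝ, F) g).symm p.1) (translatesDomain F g q) :=
    (contMDiffOn_extChartAt_symm g).comp contDiff_fst.contMDiff.contMDiffOn fun p hp => hp.1
  have h2 : ContMDiffOn 𝓘(ℝ, F × (Fin q → ℝ)) 𝓘(ℝ, E) ∞
      (fun p : F × (Fin q → ℝ) => σ.ext p.2) (translatesDomain F g q) :=
    σ.smooth.comp contDiff_snd.contMDiff.contMDiffOn fun p hp => hp.2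
  exact h1.smul h2

omit [LieGroup 𝓘(ℝ, F) ∞ G] in
theorem contMDiff_orbit (x : M) : ContMDiff 𝓘(ℝ, F) 𝓘(ℝ, E) ∞ fun h : G => h • x :=
  contMDiff_id.smul contMDiff_const

theorem contMDiff_translation (F : Type*) [NormedAddCommGroup F] [NormedSpace ℝ F]
    {G : Type*} [TopologicalSpace G] [ChartedSpace F G] [Group G]
    (E : Type*) [NormedAddCommGroup E] [NormedSpace ℝ E]
    {M : Type*} [TopologicalSpace M] [ChartedSpace E M] [MulAction G M]
    [ContMDiffSMul 𝓘(ℝ, F) 𝓘(ℝ, E) ∞ G M] (g : G) :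
    ContMDiff 𝓘(ℝ, E) 𝓘(ℝ, E) ∞ fun x : M => g • x :=
  ContMDiffSMul.contMDiff_const_smul (I := 𝓘(ℝ, F)) g

/-- Because h x = (h g⁻¹)(g x), the derivative of the orbit map at g is the right trivialization
followed by the fundamental field at g x. Contracting with fundamental fields along right invariant
fields is thus pulling back along (g, t) ↦ g σ(t). -/
theorem mD_orbit (g : G) (x : M) :
    mD F E (fun h : G => h • x) g =
      (mD F E (fun h : G => h • (g • x)) 1).comp (mD F F (fun h : G => h * g⁻¹) g) := by
  have h := mD_comp (f := fun h : G => h * g⁻¹) (g := fun h : G => h • (g • x)) (x := g)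
    ((contMDiff_orbit (F := F) (E := E) (g • x)).mdifferentiableAt (by simp))
    ((contMDiff_mul_right (I := 𝓘(ℝ, F)) (n := ∞) (a := g⁻¹)).mdifferentiableAt (by simp))
  rw [mul_inv_cancel] at h
  rw [← h]
  congr 1
  funext h
  rw [smul_smul, inv_mul_cancel_right]

theorem mDW_translates_left (g : G) (σ : SmoothSimplex E M q) {y : F}
    (hy : y ∈ (extChartAt 𝓘(ℝ, F) g).target) {t : Fin q → ℝ} (ht : t ∈ cornerSimplex q) (a : F) :
    mDW (F × (Fin q → ℝ)) E (translates g σ) (translatesDomain F g q) (y, t) (a, 0) =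
      mD F E (fun h : G => h • σ.ext t) ((extChartAt 𝓘(ℝ, F) g).symm y)
        (mD F F (extChartAt 𝓘(ℝ, F) g).symm y a) := by
  have ho := isOpen_extChartAt_target (I := 𝓘(ℝ, F)) g
  have hd : HasFDerivAt (fun y : F => (y, t)) (ContinuousLinearMap.inl ℝ F (Fin q → ℝ)) y :=
    (hasFDerivAt_id (𝕜 := ℝ) y).prodMk (hasFDerivAt_const (𝕜 := ℝ) t y)
  have h1 := mDW_comp (f := fun y : F => (y, t)) (g := translates (F := F) g σ)
    (s := (extChartAt 𝓘(ℝ, F) g).target) (t := translatesDomain F g q) (x := y)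
    ((contMDiffOn_translates g σ (y, t) ⟨hy, ht⟩).mdifferentiableWithinAt (by simp))
    hd.differentiableAt.mdifferentiableAt.mdifferentiableWithinAt (fun z hz => ⟨hz, ht⟩)
    (ho.uniqueDiffOn y hy).uniqueMDiffWithinAt
  have h2 := mD_comp (f := (extChartAt 𝓘(ℝ, F) g).symm) (g := fun h : G => h • σ.ext t) (x := y)
    ((contMDiff_orbit (F := F) (E := E) (σ.ext t)).mdifferentiableAt (by simp))
    (mdifferentiableAt_extChartAt_symm' hy)
  rw [mDW_eq_mD (ho.mem_nhds hy), mDW_eq_mD (ho.mem_nhds hy), mD_eq_fderiv, hd.fderiv] at h1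
  have h3 := DFunLike.congr_fun (h1.symm.trans h2) a
  exact h3

theorem mDW_translates_right (g : G) (σ : SmoothSimplex E M q) {y : F}
    (hy : y ∈ (extChartAt 𝓘(ℝ, F) g).target) {t : Fin q → ℝ} (ht : t ∈ cornerSimplex q)
    (b : Fin q → ℝ) :
    mDW (F × (Fin q → ℝ)) E (translates g σ) (translatesDomain F g q) (y, t) (0, b) =
      mD E E (fun x : M => (extChartAt 𝓘(ℝ, F) g).symm y • x) (σ.ext t)
        (mDW (Fin q → ℝ) E σ.ext (cornerSimplex q) t b) := by
  have hU := uniqueDiffOn_cornerSimplex q t ht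
  have hd : HasFDerivAt (fun t : Fin q → ℝ => (y, t)) (ContinuousLinearMap.inr ℝ F (Fin q → ℝ)) t :=
    (hasFDerivAt_const (𝕜 := ℝ) y t).prodMk (hasFDerivAt_id (𝕜 := ℝ) t)
  have h1 := mDW_comp (f := fun t : Fin q → ℝ => (y, t)) (g := translates (F := F) g σ)
    (s := cornerSimplex q) (t := translatesDomain F g q) (x := t)
    ((contMDiffOn_translates g σ (y, t) ⟨hy, ht⟩).mdifferentiableWithinAt (by simp))
    hd.differentiableAt.mdifferentiableAt.mdifferentiableWithinAt (fun z hz => ⟨hy, hz⟩)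
    hU.uniqueMDiffWithinAt
  have h2 := mD_comp_mDW (f := σ.ext) (g := fun x : M => (extChartAt 𝓘(ℝ, F) g).symm y • x)
    (x := t) (s := cornerSimplex q)
    ((contMDiff_translation F E _).mdifferentiableAt (by simp))
    (σ.mdifferentiableWithinAt ht) hU.uniqueMDiffWithinAt
  rw [mDW_eq_fderivWithin (fun t : Fin q → ℝ => (y, t)),
    hd.hasFDerivWithinAt.fderivWithin hU] at h1
  have h3 := DFunLike.congr_fun (h1.symm.trans h2) b
  exact h3

/-- The fibre integrand in terms of the pullback of the form to the product of a chart of the group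
and the simplex. -/
theorem pullbackWithin_translates (θ : DForm E M (q + k)) (g : G) (σ : SmoothSimplex E M q) {y : F}
    (hy : y ∈ (extChartAt 𝓘(ℝ, F) g).target) {t : Fin q → ℝ} (ht : t ∈ cornerSimplex q)
    (u : Fin k → F) :
    pullbackWithin (translates (F := F) g σ) (translatesDomain F g q) θ (y, t)
        (joinArgs (fun i => (u i, 0)) fun j => (0, stdFrame q j)) =
      fibreIntegrand σ θ ((extChartAt 𝓘(ℝ, F) g).symm y)
        (fun i => mD F F (extChartAt 𝓘(ℝ, F) g).symm y (u i)) t := by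
  rw [pullbackWithin, ContinuousAlternatingMap.compContinuousLinearMap_apply, Function.comp_def,
    comp_joinArgs, fibreIntegrand]
  simp only [mDW_translates_left g σ hy ht, mDW_translates_right g σ hy ht]
  rfl

theorem fibreIntegrand_eq_pullbackWithin (θ : DForm E M (q + k)) (g : G) (σ : SmoothSimplex E M q)
    {t : Fin q → ℝ} (ht : t ∈ cornerSimplex q) (u : Fin k → F) :
    fibreIntegrand σ θ g u t =
      pullbackWithin (translates g σ) (translatesDomain F g q) θ (extChartAt 𝓘(ℝ, F) g g, t)
        (joinArgs (fun i => (mD F F (extChartAt 𝓘(ℝ, F) g) g (u i), 0))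
          fun j => (0, stdFrame q j)) := by
  rw [pullbackWithin_translates θ g σ (mem_extChartAt_target g) ht, extChartAt_to_inv]
  congr 1
  funext i
  exact (DFunLike.congr_fun (mD_extChartAt_symm_comp (mem_extChartAt_source g)) (u i)).symm

theorem continuousOn_fibreIntegrand [FiniteDimensional ℝ F] [IsManifold 𝓘(ℝ, E) ∞ M]
    {θ : DForm E M (q + k)} (hθ : θ.IsSmooth) (g : G) (σ : SmoothSimplex E M q) (u : Fin k → F) :
    ContinuousOn (fibreIntegrand σ θ g u) (cornerSimplex q) := by
  have h := (contDiffOn_pullbackWithin hθ (uniqueDiffOn_translatesDomain (F := F) g q)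
    (contMDiffOn_translates (F := F) g σ)).continuousOn
  have h2 : ContinuousOn (fun t => pullbackWithin (translates g σ) (translatesDomain F g q) θ
      (extChartAt 𝓘(ℝ, F) g g, t)) (cornerSimplex q) :=
    h.comp (Continuous.continuousOn (by fun_prop)) fun t ht => ⟨mem_extChartAt_target g, ht⟩
  refine ((ContinuousAlternatingMap.apply ℝ (F × (Fin q → ℝ)) ℝ
    (joinArgs (fun i => (mD F F (extChartAt 𝓘(ℝ, F) g) g (u i), 0))
          fun j => (0, stdFrame q j))).continuous.comp_continuousOn h2).congr fun t ht => ?_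
  exact fibreIntegrand_eq_pullbackWithin θ g σ ht u

theorem integrableOn_fibreIntegrand [FiniteDimensional ℝ F] [IsManifold 𝓘(ℝ, E) ∞ M]
    {θ : DForm E M (q + k)} (hθ : θ.IsSmooth) (g : G) (σ : SmoothSimplex E M q) (u : Fin k → F) :
    IntegrableOn (fibreIntegrand σ θ g u) (cornerSimplex q) :=
  (continuousOn_fibreIntegrand hθ g σ u).integrableOn_compact (isCompact_cornerSimplex q)

/-- The values of `fGamma` on smooth forms. -/
theorem fGamma_apply [FiniteDimensional ℝ F] [IsManifold 𝓘(ℝ, E) ∞ M]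
    {θ : DForm E M (q + k)} (hθ : θ.IsSmooth) (γ : SmoothChain E M q) (g : G) (u : Fin k → F) :
    (fGamma F γ θ : DForm F G k).val g u =
      γ.sum fun σ r => r * ∫ t in cornerSimplex q, fibreIntegrand σ θ g u t := by
  let I : SmoothSimplex E M q → (Fin q → ℝ) → F [⋀^Fin k]→L[ℝ] ℝ := fun σ t =>
    (fGammaIntegrand F θ g (σ.ext t) fun j =>
      mDW (Fin q → ℝ) E σ.ext (cornerSimplex q) t (stdFrame q j)).compContinuousLinearMap
      (tangentModel (E := F) g).symm.toContinuousLinearMap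
  have hI : ∀ σ t u, I σ t u = fibreIntegrand σ θ g u t := by
    intro σ t u
    rw [fibreIntegrand, mD_orbit]
    rfl
  have hint : ∀ σ, IntegrableOn (I σ) (cornerSimplex q) := fun σ =>
    (continuousOn_of_evaluations fun v => by
      simpa only [hI] using continuousOn_fibreIntegrand hθ g σ v).integrableOn_compact
        (isCompact_cornerSimplex q)
  have h1 : (fGamma F γ θ : DForm F G k).val g u =
      (γ.sum fun σ r => r • ∫ t in cornerSimplex q, I σ t) u := rfl
  have h2 := map_finsuppSum (ContinuousAlternatingMap.apply ℝ F ℝ u) γ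
    fun σ r => r • ∫ t in cornerSimplex q, I σ t
  rw [h1]
  refine h2.trans (Finsupp.sum_congr fun σ _ => ?_)
  rw [map_smul, smul_eq_mul, ← ContinuousLinearMap.integral_comp_comm _ (hint σ)]
  simp only [← hI]
  rfl

omit [LieGroup 𝓘(ℝ, F) ∞ G] [ContMDiffSMul 𝓘(ℝ, F) 𝓘(ℝ, E) ∞ G M] in
theorem fibreIntegrand_add (σ : SmoothSimplex E M q) (θ θ' : DForm E M (q + k)) (g : G)
    (u : Fin k → F) (t : Fin q → ℝ) :
    fibreIntegrand σ (θ + θ') g u t = fibreIntegrand σ θ g u t + fibreIntegrand σ θ' g u t := rfl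

theorem fGamma_add [FiniteDimensional ℝ F] [IsManifold 𝓘(ℝ, E) ∞ M]
    {θ θ' : DForm E M (q + k)} (hθ : θ.IsSmooth) (hθ' : θ'.IsSmooth) (γ : SmoothChain E M q) :
    (fGamma F γ (θ + θ') : DForm F G k) = fGamma F γ θ + fGamma F γ θ' := by
  refine DForm.ext_val fun g => ContinuousAlternatingMap.ext fun u => ?_
  have h : (θ + θ').IsSmooth := (smoothForms E M (q + k)).add_mem hθ hθ'
  have e : (fGamma F γ θ + fGamma F γ θ' : DForm F G k).val g u =
    (fGamma F γ θ : DForm F G k).val g u + (fGamma F γ θ' : DForm F G k).val g u := rfl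
  rw [e, fGamma_apply h, fGamma_apply hθ, fGamma_apply hθ', ← Finsupp.sum_add]
  refine Finsupp.sum_congr fun σ _ => ?_
  simp only [fibreIntegrand_add]
  rw [integral_add (integrableOn_fibreIntegrand hθ g σ u) (integrableOn_fibreIntegrand hθ' g σ u),
    mul_add]

theorem DForm.IsSmooth.act [FiniteDimensional ℝ E] [IsManifold 𝓘(ℝ, E) ∞ M] (F : Type*)
    [NormedAddCommGroup F] [NormedSpace ℝ F] {G : Type*} [TopologicalSpace G] [ChartedSpace F G]
    [Group G] [MulAction G M] [ContMDiffSMul 𝓘(ℝ, F) 𝓘(ℝ, E) ∞ G M] {k : ℕ} (h : G)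
    {θ : DForm E M k} (hθ : θ.IsSmooth) : (DForm.act h θ).IsSmooth :=
  hθ.pullback (contMDiff_translation F E h)

/-- Differentiating h(gx) = (hg)x in g and in x: pulling back by h on M becomes left translation by
h on G. -/
theorem fibreIntegrand_act (h : G) (θ : DForm E M (q + k)) (g : G) (σ : SmoothSimplex E M q)
    (u : Fin k → F) (t : Fin q → ℝ) :
    fibreIntegrand σ (DForm.act h θ) g u t =
      fibreIntegrand σ θ (h * g) (fun i => mD F F (fun g' : G => h * g') g (u i)) t := by
  have e1 := mD_comp (f := fun g' : G => g' • σ.ext t) (g := fun x : M => h • x) (x := g)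
    ((contMDiff_translation F E _).mdifferentiableAt (by simp))
    ((contMDiff_orbit (F := F) (E := E) (σ.ext t)).mdifferentiableAt (by simp))
  have e2 := mD_comp (f := fun g' : G => h * g') (g := fun g' : G => g' • σ.ext t) (x := g)
    ((contMDiff_orbit (F := F) (E := E) (σ.ext t)).mdifferentiableAt (by simp))
    ((contMDiff_mul_left (I := 𝓘(ℝ, F)) (n := ∞) (a := h)).mdifferentiableAt (by simp))
  have e3 := mD_comp (f := fun x : M => g • x) (g := fun x : M => h • x) (x := σ.ext t)
    ((contMDiff_translation F E _).mdifferentiableAt (by simp))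
    ((contMDiff_translation F E _).mdifferentiableAt (by simp))
  simp only [smul_smul] at e1 e3
  rw [fibreIntegrand, fibreIntegrand, DForm.act, DForm.pullback_val,
    ContinuousAlternatingMap.compContinuousLinearMap_apply, Function.comp_def, comp_joinArgs,
    smul_smul]
  congr 2
  · funext i
    exact DFunLike.congr_fun (e1.symm.trans e2) (u i)
  · funext j
    rw [e3]
    rfl

theorem fGamma_act [FiniteDimensional ℝ F] [FiniteDimensional ℝ E] [IsManifold 𝓘(ℝ, E) ∞ M]
    {θ : DForm E M (q + k)} (hθ : θ.IsSmooth) (γ : SmoothChain E M q) (h : G) :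
    (fGamma F γ (DForm.act h θ) : DForm F G k) = DForm.act h (fGamma F γ θ : DForm F G k) := by
  refine DForm.ext_val fun g => ContinuousAlternatingMap.ext fun u => ?_
  have e : (DForm.act h (fGamma F γ θ : DForm F G k)).val g u =
    (fGamma F γ θ : DForm F G k).val (h * g) fun i => mD F F (fun g' : G => h * g') g (u i) := rfl
  rw [e, fGamma_apply (hθ.act F h), fGamma_apply hθ]
  simp only [fibreIntegrand_act]

end FibreIntegration

/-! ### Forms of degree zero as functions. -/

section ZeroForms

variable {F : Type*} [NormedAddCommGroup F] [NormedSpace ℝ F]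
  {G : Type*} [TopologicalSpace G] [ChartedSpace F G]

/-- The function underlying a form of degree zero. -/
def DForm.toFunction (f : DForm F G 0) (g : G) : ℝ := f.val g Fin.elim0

theorem DForm.ext_toFunction {f f' : DForm F G 0} (h : ∀ g, f.toFunction g = f'.toFunction g) :
    f = f' :=
  DForm.ext_val fun g => ContinuousAlternatingMap.ext fun u => by
    rw [Subsingleton.elim u Fin.elim0]; exact h g

theorem DForm.chartRep_zero_form (f : DForm F G 0) (x₀ : G) (y : F) :
    f.chartRep x₀ y = ContinuousAlternatingMap.constOfIsEmpty ℝ F (Fin 0)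
      (f.toFunction ((extChartAt 𝓘(ℝ, F) x₀).symm y)) :=
  ContinuousAlternatingMap.ext fun u => by
    rw [DForm.chartRep_eq, ContinuousAlternatingMap.compContinuousLinearMap_apply,
      Subsingleton.elim (_ ∘ u) Fin.elim0]
    rfl

theorem DForm.d_zero_form (f : DForm F G 0) (g : G) (u : Fin 1 → F) :
    f.d.val g u = fderiv ℝ (fun y => f.toFunction ((extChartAt 𝓘(ℝ, F) g).symm y))
      (extChartAt 𝓘(ℝ, F) g g) (mD F F (extChartAt 𝓘(ℝ, F) g) g (u 0)) := by
  rw [DForm.d_val, show f.chartRep g = _ from funext (f.chartRep_zero_form g),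
    extDeriv_constOfIsEmpty]
  rfl

theorem DForm.differentiableAt_zero_form {f : DForm F G 0} {x₀ : G} {y : F}
    (h : DifferentiableAt ℝ (fun y => f.toFunction ((extChartAt 𝓘(ℝ, F) x₀).symm y)) y) :
    DifferentiableAt ℝ (f.chartRep x₀) y := by
  rw [show f.chartRep x₀ = _ from funext (f.chartRep_zero_form x₀)]
  exact (ContinuousAlternatingMap.constOfIsEmptyLIE ℝ F ℝ (Fin 0)).differentiable.differentiableAt.comp
    y h

end ZeroForms

/-! ### Fibre integration over cycles: closed forms and commutation with d. -/

section FibreIntegralDerivative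

variable {F : Type*} [NormedAddCommGroup F] [NormedSpace ℝ F] [FiniteDimensional ℝ F]
  {G : Type*} [TopologicalSpace G] [ChartedSpace F G] [Group G]
  {E : Type*} [NormedAddCommGroup E] [NormedSpace ℝ E]
  {M : Type*} [TopologicalSpace M] [ChartedSpace E M] [IsManifold 𝓘(ℝ, E) ∞ M]
  [MulAction G M] [LieGroup 𝓘(ℝ, F) ∞ G] [ContMDiffSMul 𝓘(ℝ, F) 𝓘(ℝ, E) ∞ G M] {q k : ℕ}

theorem DForm.IsSmooth.d [FiniteDimensional ℝ E] {η : DForm E M k} (hη : η.IsSmooth) :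
    η.d.IsSmooth := by
  intro x₀
  have ho := isOpen_extChartAt_target (I := 𝓘(ℝ, E)) x₀
  have hs := contMDiffOn_extChartAt_symm (I := 𝓘(ℝ, E)) (n := ∞) x₀
  have h1 := contDiffOn_pullbackWithin hη ho.uniqueDiffOn hs
  have h2 : ContDiffOn ℝ ∞ (extDerivWithin (pullbackWithin (extChartAt 𝓘(ℝ, E) x₀).symm
      (extChartAt 𝓘(ℝ, E) x₀).target η) (extChartAt 𝓘(ℝ, E) x₀).target)
      (extChartAt 𝓘(ℝ, E) x₀).target :=
    (ContinuousAlternatingMap.alternatizeUncurryFinCLM ℝ E ℝ).contDiff.comp_contDiffOn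
      (h1.fderivWithin ho.uniqueDiffOn (by simp))
  refine h2.congr fun y hy => ?_
  rw [extDerivWithin_pullbackWithin hη ho.uniqueDiffOn hs hy
    (by rw [ho.interior_eq]; exact subset_closure hy), DForm.chartRep_eq, pullbackWithin,
    mDW_eq_mD (ho.mem_nhds hy)]

theorem fibreIntegrand_zero (σ : SmoothSimplex E M q) (η : DForm E M q) (g : G)
    (t : Fin q → ℝ) :
    fibreIntegrand (F := F) (k := 0) σ η g Fin.elim0 t =
      pullbackWithin σ.ext (cornerSimplex q) (DForm.act g η) t (stdFrame q) := by
  rw [fibreIntegrand, joinArgs_zero]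
  rfl

theorem fGamma_zero_apply {η : DForm E M q} (hη : η.IsSmooth) (α : SmoothChain E M q) (g : G) :
    (fGamma F (k := 0) α η : DForm F G 0).toFunction g =
      α.integral fun x v => DForm.act g η x v := by
  rw [DForm.toFunction, fGamma_apply (k := 0) hη]
  simp only [fibreIntegrand_zero]
  rfl

/-- The integral of a closed form over the translates of a cycle with invariant class. -/
theorem fGamma_closed {η : DForm E M q} (hη : η.IsSmooth) (hd : η.d = 0) {α : SmoothChain E M q}
    (hα : α.HasInvariantClass F G) (g : G) :
    (fGamma F (k := 0) α η : DForm F G 0).toFunction g = α.integral fun x v => η x v := by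
  obtain ⟨β, hβ⟩ := hα g
  rw [fGamma_zero_apply hη]
  -- As gα - α is the boundary of β and η is closed, Stokes on β equates the integrals over gα and
  -- α; the former is the integral over α of the pullback of η by g.
  have h1 := SmoothChain.integral_mapDomain (contMDiff_translation F E g) α η
  have h2 := SmoothChain.integral_boundary β hη
  rw [hβ, hd, SmoothChain.integral_eq_linearCombination, map_sub,
    ← SmoothChain.integral_eq_linearCombination, ← SmoothChain.integral_eq_linearCombination,
    h1] at h2
  have h3 : (β.integral fun x v => (0 : DForm E M (q + 1)) x v) = 0 := by
    have : ∀ σ : SmoothSimplex E M (q + 1),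
        σ.integral (fun x v => (0 : DForm E M (q + 1)) x v) = 0 := fun σ => by
      rw [SmoothSimplex.integral_form]
      exact integral_eq_zero_of_ae (Filter.Eventually.of_forall fun _ => rfl)
    simp [SmoothChain.integral, this]
  rw [h3, sub_eq_zero] at h2
  exact h2

/-- The function whose integral over the simplex is the fibre integral of a form of degree `q`. -/
def fibreDensity (σ : SmoothSimplex E M q) (η : DForm E M q) (g : G) (p : F × (Fin q → ℝ)) : ℝ :=
  pullbackWithin (translates g σ) (translatesDomain F g q) η p fun j => (0, stdFrame q j)

theorem fGamma_chart {η : DForm E M q} (hη : η.IsSmooth) (α : SmoothChain E M q) (g : G) {y : F}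
    (hy : y ∈ (extChartAt 𝓘(ℝ, F) g).target) :
    (fGamma F (k := 0) α η : DForm F G 0).toFunction ((extChartAt 𝓘(ℝ, F) g).symm y) =
      α.sum fun σ r => r * ∫ t in cornerSimplex q, fibreDensity σ η g (y, t) := by
  rw [DForm.toFunction, fGamma_apply (k := 0) hη]
  refine Finsupp.sum_congr fun σ _ => ?_
  congr 1
  refine setIntegral_congr_fun (measurableSet_cornerSimplex q) fun t ht => ?_
  have := pullbackWithin_translates (k := 0) η g σ hy ht Fin.elim0
  rw [joinArgs_zero] at this
  rw [fibreDensity, this]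
  congr 1
  exact Subsingleton.elim _ _

theorem contDiffOn_fibreDensity {η : DForm E M q} (hη : η.IsSmooth) (σ : SmoothSimplex E M q)
    (g : G) : ContDiffOn ℝ ∞ (fibreDensity (F := F) σ η g) (translatesDomain F g q) :=
  (ContinuousAlternatingMap.apply ℝ (F × (Fin q → ℝ)) ℝ
    fun j => (0, stdFrame q j)).contDiff.comp_contDiffOn
    (contDiffOn_pullbackWithin hη (uniqueDiffOn_translatesDomain (F := F) g q)
      (contMDiffOn_translates g σ))

theorem hasFDerivAt_fGamma {η : DForm E M q} (hη : η.IsSmooth) (α : SmoothChain E M q) (g : G)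
    {y : F} (hy : y ∈ (extChartAt 𝓘(ℝ, F) g).target) :
    HasFDerivAt (fun y => (fGamma F (k := 0) α η : DForm F G 0).toFunction
        ((extChartAt 𝓘(ℝ, F) g).symm y))
      (α.sum fun σ r => r • ∫ t in cornerSimplex q,
        (fderivWithin ℝ (fibreDensity σ η g) (translatesDomain F g q) (y, t)).comp
          (ContinuousLinearMap.inl ℝ F (Fin q → ℝ))) y := by
  have ho := isOpen_extChartAt_target (I := 𝓘(ℝ, F)) g
  have h : HasFDerivAt (fun y => α.sum fun σ r => r * ∫ t in cornerSimplex q,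
      fibreDensity σ η g (y, t))
      (α.sum fun σ r => r • ∫ t in cornerSimplex q,
        (fderivWithin ℝ (fibreDensity σ η g) (translatesDomain F g q) (y, t)).comp
          (ContinuousLinearMap.inl ℝ F (Fin q → ℝ))) y :=
    HasFDerivAt.fun_sum fun σ _ => (hasFDerivAt_setIntegral_cornerSimplex ho
      ((contDiffOn_fibreDensity hη σ g).of_le (by simp)) hy).const_mul _
  refine h.congr_of_eventuallyEq ?_
  filter_upwards [ho.mem_nhds hy] with z hz using fGamma_chart hη α g hz

theorem setIntegral_fderivWithin_apply {η : DForm E M q} (hη : η.IsSmooth)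
    (σ : SmoothSimplex E M q) (g : G) {y : F} (hy : y ∈ (extChartAt 𝓘(ℝ, F) g).target) (a : F) :
    (∫ t in cornerSimplex q,
        (fderivWithin ℝ (fibreDensity σ η g) (translatesDomain F g q) (y, t)).comp
          (ContinuousLinearMap.inl ℝ F (Fin q → ℝ))) a =
      ∫ t in cornerSimplex q,
        fderivWithin ℝ (fibreDensity σ η g) (translatesDomain F g q) (y, t) (a, 0) := by
  have hc : ContinuousOn (fun t => (fderivWithin ℝ (fibreDensity σ η g) (translatesDomain F g q)
      (y, t)).comp (ContinuousLinearMap.inl ℝ F (Fin q → ℝ))) (cornerSimplex q) :=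
    (((contDiffOn_fibreDensity hη σ g).continuousOn_fderivWithin
      (uniqueDiffOn_translatesDomain g q) (by simp)).comp (f := fun t => (y, t))
        (Continuous.continuousOn (by fun_prop)) fun t ht => ⟨hy, ht⟩).clm_comp continuousOn_const
  exact (ContinuousLinearMap.integral_comp_comm (ContinuousLinearMap.apply ℝ ℝ a)
    (hc.integrableOn_compact (isCompact_cornerSimplex q))).symm

/-- The contraction of the pulled back form with a vector of the group direction. -/
def contractedForm (σ : SmoothSimplex E M (q + 1)) (η : DForm E M (q + 1)) (g : G) (a y : F)
    (t : Fin (q + 1) → ℝ) : (Fin (q + 1) → ℝ) [⋀^Fin q]→L[ℝ] ℝ :=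
  ((pullbackWithin (translates g σ) (translatesDomain F g (q + 1)) η (y, t)).curryLeft
    (a, 0)).compContinuousLinearMap (ContinuousLinearMap.inr ℝ F (Fin (q + 1) → ℝ))

theorem contractedForm_apply (σ : SmoothSimplex E M (q + 1)) (η : DForm E M (q + 1)) (g : G)
    (a y : F) (t : Fin (q + 1) → ℝ) (v : Fin q → Fin (q + 1) → ℝ) :
    contractedForm σ η g a y t v =
      pullbackWithin (translates g σ) (translatesDomain F g (q + 1)) η (y, t)
        (Fin.cons (a, 0) fun j => (0, v j)) := rfl

theorem contDiffOn_slice {η : DForm E M q} (hη : η.IsSmooth) (σ : SmoothSimplex E M q) (g : G)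
    {y : F} (hy : y ∈ (extChartAt 𝓘(ℝ, F) g).target) :
    ContDiffOn ℝ ∞ (fun t => pullbackWithin (translates g σ) (translatesDomain F g q) η (y, t))
      (cornerSimplex q) :=
  (contDiffOn_pullbackWithin hη (uniqueDiffOn_translatesDomain (F := F) g q)
    (contMDiffOn_translates g σ)).comp (contDiff_prodMk_right y).contDiffOn fun _ ht => ⟨hy, ht⟩

theorem contDiffOn_contractedForm {η : DForm E M (q + 1)} (hη : η.IsSmooth)
    (σ : SmoothSimplex E M (q + 1)) (g : G) (a : F)
    {y : F} (hy : y ∈ (extChartAt 𝓘(ℝ, F) g).target) :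
    ContDiffOn ℝ ∞ (contractedForm σ η g a y) (cornerSimplex (q + 1)) := fun t ht =>
  contDiffWithinAt_of_evaluations fun v =>
    (ContinuousAlternatingMap.apply ℝ (F × (Fin (q + 1) → ℝ)) ℝ
      (Fin.cons (a, 0) fun j => (0, v j))).contDiff.contDiffAt.comp_contDiffWithinAt t
        (contDiffOn_slice hη σ g hy t ht)

theorem fderivWithin_slice {H : F × (Fin q → ℝ) → ℝ} {g : G}
    (hH : DifferentiableOn ℝ H (translatesDomain F g q)) {y : F}
    (hy : y ∈ (extChartAt 𝓘(ℝ, F) g).target) {t : Fin q → ℝ} (ht : t ∈ cornerSimplex q)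
    (b : Fin q → ℝ) :
    fderivWithin ℝ H (translatesDomain F g q) (y, t) (0, b) =
      fderivWithin ℝ (fun t => H (y, t)) (cornerSimplex q) t b := by
  have h1 := (hH (y, t) ⟨hy, ht⟩).hasFDerivWithinAt
  have h2 : HasFDerivWithinAt (fun t : Fin q → ℝ => (y, t))
      (ContinuousLinearMap.inr ℝ F (Fin q → ℝ)) (cornerSimplex q) t :=
    ((hasFDerivAt_const (𝕜 := ℝ) y t).prodMk (hasFDerivAt_id (𝕜 := ℝ) t)).hasFDerivWithinAt
  have h3 := (h1.comp t h2 (show MapsTo (fun t : Fin q → ℝ => (y, t)) (cornerSimplex q)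
    (translatesDomain F g q) from fun z hz => ⟨hy, hz⟩)).fderivWithin
      (uniqueDiffOn_cornerSimplex q t ht)
  exact (DFunLike.congr_fun h3 b).symm

/-- Over a point there are no simplex directions, so d reduces to the derivative along the group. -/
theorem pullbackWithin_d_zero {η : DForm E M 0} (hη : η.IsSmooth)
    (σ : SmoothSimplex E M 0) (g : G) (a : F) {y : F}
    (hy : y ∈ (extChartAt 𝓘(ℝ, F) g).target) {t : Fin 0 → ℝ} (ht : t ∈ cornerSimplex 0) :
    pullbackWithin (translates g σ) (translatesDomain F g 0) η.d (y, t)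
        (Fin.cons (a, 0) fun j => (0, stdFrame 0 j)) =
      fderivWithin ℝ (fibreDensity σ η g) (translatesDomain F g 0) (y, t) (a, 0) := by
  have hU := uniqueDiffOn_translatesDomain (F := F) g 0
  have hΩ := contDiffOn_pullbackWithin hη hU (contMDiffOn_translates g σ)
  rw [← extDerivWithin_pullbackWithin hη hU (contMDiffOn_translates g σ) ⟨hy, ht⟩
    (translatesDomain_subset g _ ⟨hy, ht⟩), extDerivWithin_apply
    (hΩ.differentiableOn (by simp) _ ⟨hy, ht⟩) (hU _ ⟨hy, ht⟩), Fin.sum_univ_succ]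
  simp only [Fin.val_zero, pow_zero, one_smul, Finset.univ_eq_empty, Finset.sum_empty, add_zero,
    Fin.removeNth_zero, Fin.tail_cons, Fin.cons_zero]
  rfl

/-- In the coordinate formula for d on constant vectors, the term that omits the group vector is the
derivative in the parameter. Each remaining term keeps the group vector in first place, and the
shift of index by one gives minus the exterior derivative, along the simplex, of the contracted
form. -/
theorem pullbackWithin_d_succ {η : DForm E M (q + 1)} (hη : η.IsSmooth)
    (σ : SmoothSimplex E M (q + 1)) (g : G) (a : F) {y : F}
    (hy : y ∈ (extChartAt 𝓘(ℝ, F) g).target) {t : Fin (q + 1) → ℝ}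
    (ht : t ∈ cornerSimplex (q + 1)) :
    pullbackWithin (translates g σ) (translatesDomain F g (q + 1)) η.d (y, t)
        (Fin.cons (a, 0) fun j => (0, stdFrame (q + 1) j)) =
      fderivWithin ℝ (fibreDensity σ η g) (translatesDomain F g (q + 1)) (y, t) (a, 0) -
        extDerivWithin (contractedForm σ η g a y) (cornerSimplex (q + 1)) t (stdFrame (q + 1)) := by
  have hU := uniqueDiffOn_translatesDomain (F := F) g (q + 1)
  have hΩ := contDiffOn_pullbackWithin hη hU (contMDiffOn_translates g σ)
  rw [← extDerivWithin_pullbackWithin hη hU (contMDiffOn_translates g σ) ⟨hy, ht⟩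
    (translatesDomain_subset g _ ⟨hy, ht⟩), extDerivWithin_apply
    (hΩ.differentiableOn (by simp) _ ⟨hy, ht⟩) (hU _ ⟨hy, ht⟩), Fin.sum_univ_succ,
    extDerivWithin_apply ((contDiffOn_contractedForm hη σ g a hy).differentiableOn (by simp) t ht)
      (uniqueDiffOn_cornerSimplex _ t ht), sub_eq_add_neg, ← Finset.sum_neg_distrib]
  congr 1
  · simp only [Fin.val_zero, pow_zero, one_smul, Fin.removeNth_zero, Fin.tail_cons, Fin.cons_zero]
    rfl
  · refine Finset.sum_congr rfl fun j _ => ?_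
    rw [Fin.cons_succ, fderivWithin_slice _ hy ht]
    · rw [Fin.val_succ, pow_succ, mul_neg_one, neg_smul]
      congr 3
      refine congrArg (fun f : (Fin (q + 1) → ℝ) → ℝ =>
        fderivWithin ℝ f (cornerSimplex (q + 1)) t) (funext fun t => ?_)
      rw [contractedForm_apply]
      congr 1
      funext i
      refine Fin.cases ?_ (fun i => ?_) i
      · simp [Fin.removeNth]
      · simp [Fin.removeNth]
    · exact ((ContinuousAlternatingMap.apply ℝ (F × (Fin (q + 1) → ℝ)) ℝ
        _).contDiff.comp_contDiffOn hΩ).differentiableOn (by simp)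

/-- The boundary terms in the derivative of a fibre integral. -/
theorem setIntegral_contractedForm {η : DForm E M (q + 1)} (hη : η.IsSmooth)
    (σ : SmoothSimplex E M (q + 1)) (g : G) (u : Fin 1 → F) :
    ∫ t in cornerSimplex (q + 1), extDerivWithin (contractedForm σ η g
        (mD F F (extChartAt 𝓘(ℝ, F) g) g (u 0)) (extChartAt 𝓘(ℝ, F) g g)) (cornerSimplex (q + 1)) t
          (stdFrame (q + 1)) =
      ∑ i : Fin (q + 2), (-1 : ℝ) ^ (i : ℕ) •
        ∫ s in cornerSimplex q, fibreIntegrand (σ.face i) η g u s := by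
  have hy := mem_extChartAt_target (I := 𝓘(ℝ, F)) g
  refine (setIntegral_extDerivWithin_cornerSimplex
    ((contDiffOn_contractedForm hη σ g _ hy).of_le (by simp))).trans ?_
  refine Finset.sum_congr rfl fun i _ => ?_
  rw [smul_eq_mul]
  congr 1
  refine setIntegral_congr_fun (measurableSet_cornerSimplex q) fun s hs => ?_
  have hs' := faceInclusion_mapsTo i hs
  rw [contractedForm_apply, fibreIntegrand, joinArgs_one, pullbackWithin,
    ContinuousAlternatingMap.compContinuousLinearMap_apply, σ.mDW_face i hs, σ.ext_face i hs]
  have e : translates g σ (extChartAt 𝓘(ℝ, F) g g, faceInclusion i s) =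
      g • σ.ext (faceInclusion i s) := by
    rw [translates, extChartAt_to_inv]
  rw [e]
  congr 1
  funext j
  refine Fin.cases ?_ (fun j => ?_) j
  · simp only [Function.comp_apply, Fin.cons_zero]
    rw [mDW_translates_left g σ hy hs', extChartAt_to_inv]
    congr 1
    exact DFunLike.congr_fun (mD_extChartAt_symm_comp (mem_extChartAt_source g)) (u 0)
  · simp only [Function.comp_apply, Fin.cons_succ]
    rw [mDW_translates_right g σ hy hs', extChartAt_to_inv]
    rfl

/-- Fibre integration over a cycle commutes with the exterior derivative. -/
theorem d_fGamma [FiniteDimensional ℝ E] {η : DForm E M q} (hη : η.IsSmooth)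
    {α : SmoothChain E M q} (hα : α.IsCycle) :
    (fGamma F (k := 0) α η : DForm F G 0).d = fGamma F (k := 1) α η.d := by
  refine DForm.ext_val fun g => ContinuousAlternatingMap.ext fun u => ?_
  have hy := mem_extChartAt_target (I := 𝓘(ℝ, F)) g
  rw [DForm.d_zero_form, (hasFDerivAt_fGamma hη α g hy).fderiv, fGamma_apply (k := 1) hη.d]
  set a := mD F F (extChartAt 𝓘(ℝ, F) g) g (u 0) with ha
  have h1 : (α.sum fun σ r => r • ∫ t in cornerSimplex q,
        (fderivWithin ℝ (fibreDensity σ η g) (translatesDomain F g q)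
          (extChartAt 𝓘(ℝ, F) g g, t)).comp (ContinuousLinearMap.inl ℝ F (Fin q → ℝ))) a =
      α.sum fun σ r => r * ∫ t in cornerSimplex q,
        fderivWithin ℝ (fibreDensity σ η g) (translatesDomain F g q)
          (extChartAt 𝓘(ℝ, F) g g, t) (a, 0) := by
    refine (map_finsuppSum (ContinuousLinearMap.apply ℝ ℝ a) _ _).trans
      (Finsupp.sum_congr fun σ _ => ?_)
    rw [map_smul, smul_eq_mul, ← setIntegral_fderivWithin_apply hη σ g hy]
    rfl
  rw [h1]
  have h2 : ∀ (σ : SmoothSimplex E M q), ∀ t ∈ cornerSimplex q,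
      fibreIntegrand (k := 1) σ η.d g u t =
        pullbackWithin (translates g σ) (translatesDomain F g q) η.d (extChartAt 𝓘(ℝ, F) g g, t)
          (Fin.cons (a, 0) fun j => (0, stdFrame q j)) := fun σ t ht => by
    rw [fibreIntegrand_eq_pullbackWithin _ g σ ht, joinArgs_one]
  -- Degree zero is separate: the simplex has no faces and the cycle condition is empty.
  obtain _ | q := q
  · refine Finsupp.sum_congr fun σ _ => ?_
    congr 1
    refine setIntegral_congr_fun (measurableSet_cornerSimplex 0) fun t ht => ?_
    rw [h2 σ t ht, pullbackWithin_d_zero hη σ g a hy ht]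
  · have h3 : ∀ σ : SmoothSimplex E M (q + 1),
        ∫ t in cornerSimplex (q + 1), fibreIntegrand (k := 1) σ η.d g u t =
          (∫ t in cornerSimplex (q + 1),
            fderivWithin ℝ (fibreDensity σ η g) (translatesDomain F g (q + 1))
              (extChartAt 𝓘(ℝ, F) g g, t) (a, 0)) -
          ∑ i : Fin (q + 2), (-1 : ℝ) ^ (i : ℕ) •
            ∫ s in cornerSimplex q, fibreIntegrand (σ.face i) η g u s := by
      intro σ
      rw [← setIntegral_contractedForm hη σ g u, ← integral_sub]
      · refine setIntegral_congr_fun (measurableSet_cornerSimplex _) fun t ht => ?_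
        rw [h2 σ t ht, pullbackWithin_d_succ hη σ g a hy ht]
      · refine ContinuousOn.integrableOn_compact (isCompact_cornerSimplex _) ?_
        exact (((contDiffOn_fibreDensity hη σ g).continuousOn_fderivWithin
          (uniqueDiffOn_translatesDomain g _) (by simp)).comp
            (f := fun t => (extChartAt 𝓘(ℝ, F) g g, t)) (Continuous.continuousOn (by fun_prop))
              fun t ht => ⟨hy, ht⟩).clm_apply continuousOn_const
      · refine ContinuousOn.integrableOn_compact (isCompact_cornerSimplex _) ?_
        exact (ContinuousAlternatingMap.apply ℝ _ ℝ _).continuous.comp_continuousOn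
          ((ContinuousAlternatingMap.alternatizeUncurryFinCLM ℝ _ ℝ).continuous.comp_continuousOn
            ((contDiffOn_contractedForm hη σ g _ hy).continuousOn_fderivWithin
              (uniqueDiffOn_cornerSimplex _) (by simp)))
    -- The face terms, summed over α, are a linear function of the boundary of α and so vanish.
    have h4 := SmoothChain.linearCombination_boundary α fun τ =>
      ∫ s in cornerSimplex q, fibreIntegrand (k := 1) τ η g u s
    rw [show SmoothChain.boundary α = 0 from hα, map_zero] at h4
    simp only [h3, mul_sub]
    rw [Finsupp.sum_sub, eq_comm, sub_eq_self]
    exact h4.symm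

end FibreIntegralDerivative

/-! ### The G-module of smooth forms, f_γ on cochains, and the last step of the descent. -/

section SmoothAction

variable {F : Type*} [NormedAddCommGroup F] [NormedSpace ℝ F]
  {G : Type*} [TopologicalSpace G] [ChartedSpace F G] [Group G]
  {E : Type*} [NormedAddCommGroup E] [NormedSpace ℝ E]
  {M : Type*} [TopologicalSpace M] [ChartedSpace E M]
  [MulAction G M] [ContMDiffSMul 𝓘(ℝ, F) 𝓘(ℝ, E) ∞ G M] {p q k : ℕ}

theorem isRightAction_act (F : Type*) [NormedAddCommGroup F] [NormedSpace ℝ F]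
    {G : Type*} [TopologicalSpace G] [ChartedSpace F G] [Group G]
    (E : Type*) [NormedAddCommGroup E] [NormedSpace ℝ E]
    (M : Type*) [TopologicalSpace M] [ChartedSpace E M]
    [MulAction G M] [ContMDiffSMul 𝓘(ℝ, F) 𝓘(ℝ, E) ∞ G M] (k : ℕ) :
    IsRightAction (DForm.act : G → DForm E M k → DForm E M k) where
  add _ _ _ := rfl
  one θ := by
    refine DForm.ext_val fun x => ?_
    rw [DForm.act, DForm.pullback_val]
    simp only [one_smul, mD_id]
    rfl
  mul g h θ := by
    refine DForm.ext_val fun x => ?_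
    have e := mD_comp (f := fun x : M => h • x) (g := fun x : M => g • x) (x := x)
      ((contMDiff_translation F E _).mdifferentiableAt (by simp))
      ((contMDiff_translation F E _).mdifferentiableAt (by simp))
    simp only [DForm.act, DForm.pullback_val]
    simp only [mul_smul, e]
    rfl

theorem isRightAction_translation (G A : Type*) [Group G] [AddCommGroup A] :
    IsRightAction (fun (g : G) (a : G → A) x => a (g * x)) where
  add _ _ _ := rfl
  one a := by simp
  mul g h a := by simp [mul_assoc]

variable [FiniteDimensional ℝ E] [IsManifold 𝓘(ℝ, E) ∞ M]

variable (F) in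
/-- The action of the group on smooth forms. -/
def smoothAct (g : G) (θ : smoothForms E M k) : smoothForms E M k :=
  ⟨DForm.act g (θ : DForm E M k), DForm.IsSmooth.act F g θ.2⟩

theorem coe_groupDiff (c : (Fin p → G) → smoothForms E M k) (g : Fin (p + 1) → G) :
    ((groupDiff (smoothAct F) c g : smoothForms E M k) : DForm E M k) =
      deltaOne (fun h => (c h : DForm E M k)) g :=
  map_groupDiff (smoothForms E M k).subtype.toAddMonoidHom (fun _ _ => rfl) c g

theorem isSmooth_deltaOne (F : Type*) [NormedAddCommGroup F] [NormedSpace ℝ F]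
    {G : Type*} [TopologicalSpace G] [ChartedSpace F G] [Group G]
    [MulAction G M] [ContMDiffSMul 𝓘(ℝ, F) 𝓘(ℝ, E) ∞ G M]
    (c : (Fin p → G) → smoothForms E M k) (g : Fin (p + 1) → G) :
    (deltaOne (fun h => (c h : DForm E M k)) g).IsSmooth := by
  rw [← coe_groupDiff (F := F)]
  exact (groupDiff (smoothAct F) c g).2

theorem d_deltaOne (F : Type*) [NormedAddCommGroup F] [NormedSpace ℝ F]
    {G : Type*} [TopologicalSpace G] [ChartedSpace F G] [Group G]
    [MulAction G M] [ContMDiffSMul 𝓘(ℝ, F) 𝓘(ℝ, E) ∞ G M]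
    (c : (Fin p → G) → smoothForms E M k) (g : Fin (p + 1) → G) :
    (deltaOne (fun h => (c h : DForm E M k)) g).d = deltaOne (fun h => (c h : DForm E M k).d) g := by
  rw [← coe_groupDiff (F := F)]
  have h : ∀ (g : G) (θ : smoothForms E M k),
      DForm.dLinear E M k (smoothAct F g θ) = DForm.act g (DForm.dLinear E M k θ) := by
    intro g θ
    change (DForm.act g (θ : DForm E M k)).d = DForm.act g (θ : DForm E M k).d
    exact DForm.d_pullback (contMDiff_translation F E g) θ.2
  exact map_groupDiff (DForm.dLinear E M k).toAddMonoidHom h c g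

variable [FiniteDimensional ℝ F] [LieGroup 𝓘(ℝ, F) ∞ G]

variable (F k) in
/-- The map `f_γ` as a homomorphism on smooth forms. -/
def fGammaHom (γ : SmoothChain E M q) : smoothForms E M (q + k) →+ DForm F G k :=
  AddMonoidHom.mk' (fun θ => fGamma F γ (θ : DForm E M (q + k))) fun θ θ' => by
    rw [Submodule.coe_add]
    exact fGamma_add θ.2 θ'.2 γ

theorem deltaOne_fGamma (γ : SmoothChain E M q) (c : (Fin p → G) → smoothForms E M (q + k))
    (g : Fin (p + 1) → G) :
    deltaOne (fun h => (fGamma F γ (c h : DForm E M (q + k)) : DForm F G k)) g =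
      fGamma F γ (deltaOne (fun h => (c h : DForm E M (q + k))) g) := by
  rw [← coe_groupDiff (F := F)]
  have h : ∀ (g : G) (θ : smoothForms E M (q + k)),
      fGammaHom (G := G) F k γ (smoothAct F g θ) = DForm.act g (fGammaHom F k γ θ) := by
    intro g θ
    change fGamma F γ (DForm.act g (θ : DForm E M (q + k))) = DForm.act g (fGamma F γ θ.1)
    exact fGamma_act θ.2 γ g
  exact (map_groupDiff (fGammaHom F k γ) h c g).symm

/-- The relation between two consecutive members of a descent. -/
structure IsDescentStep (c₁ : (Fin p → G) → smoothForms E M (q + 1))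
    (c₀ : (Fin (p + 1) → G) → smoothForms E M q) : Prop where
  eq_zero : deltaOne (fun g => (c₁ g : DForm E M (q + 1)))
      + deltaTwo (fun g => (c₀ g : DForm E M q)) = 0

variable {c₁ : (Fin p → G) → smoothForms E M (q + 1)}
  {c₀ : (Fin (p + 1) → G) → smoothForms E M q}

theorem IsDescentStep.deltaOne_eq (H : IsDescentStep c₁ c₀) (g : Fin (p + 1) → G) :
    deltaOne (fun g => (c₁ g : DForm E M (q + 1))) g =
      -((-1 : ℤ) ^ (p + 1) • (c₀ g : DForm E M q).d) :=
  eq_neg_of_add_eq_zero_left (congrFun H.eq_zero g)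

theorem neg_one_pow_smul_smul {A : Type*} [AddCommGroup A] (n : ℕ) (a : A) :
    (-1 : ℤ) ^ n • (-1 : ℤ) ^ n • a = a := by
  rw [smul_smul, ← mul_pow, neg_one_mul, neg_neg, one_pow, one_smul]

-- The relation expresses d c₀ as a multiple of δ'c₁; since d commutes with δ', the claim reduces to
-- δ'δ'c₁ = 0.
include F in
theorem IsDescentStep.d_deltaOne_eq_zero (H : IsDescentStep c₁ c₀) (g : Fin (p + 2) → G) :
    (deltaOne (fun h => (c₀ h : DForm E M q)) g).d = 0 := by
  have hact := isRightAction_act F (G := G) E M (q + 1)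
  rw [d_deltaOne F]
  have h : (fun h => (c₀ h : DForm E M q).d) =
      fun h => (-1 : ℤ) ^ (p + 2) • deltaOne (fun g => (c₁ g : DForm E M (q + 1))) h := by
    funext h
    rw [H.deltaOne_eq, pow_succ _ (p + 1), mul_neg_one, neg_smul, smul_neg, neg_neg,
      neg_one_pow_smul_smul]
  have h2 := groupDiff_groupDiff hact fun g => (c₁ g : DForm E M (q + 1))
  rw [h, deltaOne, groupDiff_zsmul hact, h2, smul_zero, Pi.zero_apply]

/-- The coboundary of the fibre integrals of the last member of the descent is the cocycle. -/
theorem IsDescentStep.toFunction_deltaOne (H : IsDescentStep c₁ c₀) {α : SmoothChain E M q}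
    (hα : α.HasInvariantClass F G) (g : Fin (p + 2) → G) (x : G) :
    (deltaOne (fun h => (fGamma F (k := 0) α (c₀ h : DForm E M q) : DForm F G 0)) g).toFunction x =
      cocycleOf α c₀ g := by
  rw [deltaOne_fGamma (k := 0)]
  exact fGamma_closed (isSmooth_deltaOne F c₀ g) (H.d_deltaOne_eq_zero (F := F) g) hα x

/-- The coboundary of the fibre integrals of the previous member of the descent. -/
theorem IsDescentStep.deltaOne_fGamma_eq (H : IsDescentStep c₁ c₀) {α : SmoothChain E M q}
    (hα : α.IsCycle) (g : Fin (p + 1) → G) :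
    deltaOne (fun h => (fGamma F (k := 1) α (c₁ h : DForm E M (q + 1)) : DForm F G 1)) g =
      -((-1 : ℤ) ^ (p + 1) • (fGamma F (k := 0) α (c₀ g : DForm E M q) : DForm F G 0).d) := by
  rw [deltaOne_fGamma, H.deltaOne_eq, d_fGamma (c₀ g).2 hα]
  have h := map_zsmul (fGammaHom (G := G) F 1 α) ((-1 : ℤ) ^ (p + 1))
    ⟨(c₀ g : DForm E M q).d, DForm.IsSmooth.d (c₀ g).2⟩
  have h2 := map_neg (fGammaHom (G := G) F 1 α) ((-1 : ℤ) ^ (p + 1) •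
    (⟨(c₀ g : DForm E M q).d, DForm.IsSmooth.d (c₀ g).2⟩ : smoothForms E M (q + 1)))
  rw [h] at h2
  exact h2

end SmoothAction

/-! ### Functions on G: the translation action, and constancy of closed functions. -/

section ZeroFormFunctions

variable {F : Type*} [NormedAddCommGroup F] [NormedSpace ℝ F]
  {G : Type*} [TopologicalSpace G] [ChartedSpace F G]

variable (F G) in
/-- The function underlying a form of degree zero, as a homomorphism. -/
def toFunctionHom : DForm F G 0 →+ (G → ℝ) where
  toFun := DForm.toFunction
  map_zero' := rfl
  map_add' _ _ := rfl

variable (F) in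
/-- A function as a form of degree zero. -/
def DForm.ofFunction (f : G → ℝ) : DForm F G 0 := fun x =>
  (ContinuousAlternatingMap.constOfIsEmpty ℝ F (Fin 0) (f x) : F [⋀^Fin 0]→L[ℝ] ℝ)

theorem DForm.toFunction_ofFunction (f : G → ℝ) : (DForm.ofFunction F f).toFunction = f := rfl

theorem DForm.toFunction_act [Group G] (h : G) (f : DForm F G 0) (x : G) :
    (DForm.act h f).toFunction x = f.toFunction (h * x) := by
  rw [DForm.toFunction, DForm.act, DForm.pullback_val,
    ContinuousAlternatingMap.compContinuousLinearMap_apply, DForm.toFunction]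
  exact congrArg _ (Subsingleton.elim _ _)

theorem toFunction_deltaOne_eq [Group G] {p : ℕ} (c : (Fin p → G) → DForm F G 0)
    (g : Fin (p + 1) → G) :
    (deltaOne c g).toFunction =
      groupDiff (fun g (a : G → ℝ) x => a (g * x)) (fun h => (c h).toFunction) g :=
  map_groupDiff (toFunctionHom F G) (fun g a => funext fun x => DForm.toFunction_act g a x) c g

theorem DForm.d_ofFunction_const (r : ℝ) : (DForm.ofFunction F fun _ : G => r).d = 0 := by
  refine DForm.ext_val fun g => ContinuousAlternatingMap.ext fun u => ?_
  rw [DForm.d_zero_form]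
  simp only [DForm.toFunction_ofFunction]
  simp
  rfl

theorem DForm.isSmooth_of_toFunction {f : DForm F G 0}
    (h : ∀ x₀ : G, ContDiffOn ℝ ∞ (fun y => f.toFunction ((extChartAt 𝓘(ℝ, F) x₀).symm y))
      (extChartAt 𝓘(ℝ, F) x₀).target) : f.IsSmooth := by
  intro x₀
  rw [show f.chartRep x₀ = _ from funext (f.chartRep_zero_form x₀)]
  exact (ContinuousAlternatingMap.constOfIsEmptyLIE ℝ F ℝ (Fin 0)).contDiff.comp_contDiffOn (h x₀)

theorem DForm.IsSmooth.toFunction {f : DForm F G 0} (h : f.IsSmooth) (x₀ : G) :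
    ContDiffOn ℝ ∞ (fun y => f.toFunction ((extChartAt 𝓘(ℝ, F) x₀).symm y))
      (extChartAt 𝓘(ℝ, F) x₀).target := by
  refine ((ContinuousAlternatingMap.apply ℝ F ℝ
    Fin.elim0).contDiff.comp_contDiffOn (h x₀)).congr fun y _ => ?_
  rw [Function.comp_apply, f.chartRep_zero_form]
  rfl

/-- A form of degree zero with vanishing exterior derivative on a connected manifold is constant. -/
theorem DForm.toFunction_eq_of_d_eq_zero [IsManifold 𝓘(ℝ, F) ∞ G] [ConnectedSpace G]
    {f : DForm F G 0} (hf : f.d = 0)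
    (h : ∀ x₀ : G, DifferentiableOn ℝ (fun y => f.toFunction ((extChartAt 𝓘(ℝ, F) x₀).symm y))
      (extChartAt 𝓘(ℝ, F) x₀).target) (x y : G) : f.toFunction x = f.toFunction y := by
  -- The definition of d sees each point only in its own preferred chart, so the hypothesis first
  -- gives vanishing at chart centres; `hzero` carries this to any chart by a coordinate change.
  have hcenter : ∀ x : G, fderiv ℝ (fun y => f.toFunction ((extChartAt 𝓘(ℝ, F) x).symm y))
      (extChartAt 𝓘(ℝ, F) x x) = 0 := by
    intro x
    ext a
    have h1 := f.d_zero_form x fun _ => mD F F (extChartAt 𝓘(ℝ, F) x).symm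
      (extChartAt 𝓘(ℝ, F) x x) a
    have h2 := DFunLike.congr_fun (mD_extChartAt_comp_symm (mem_extChartAt_target x)) a
    rw [extChartAt_to_inv] at h2
    rw [hf] at h1
    rw [ContinuousLinearMap.comp_apply, ContinuousLinearMap.id_apply] at h2
    rw [h2] at h1
    exact h1.symm
  have hzero : ∀ x₀ : G, ∀ y ∈ (extChartAt 𝓘(ℝ, F) x₀).target,
      fderiv ℝ (fun y => f.toFunction ((extChartAt 𝓘(ℝ, F) x₀).symm y)) y = 0 := by
    intro x₀ y hy
    set x := (extChartAt 𝓘(ℝ, F) x₀).symm y with hx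
    have hτ : DifferentiableAt ℝ (fun z => extChartAt 𝓘(ℝ, F) x
        ((extChartAt 𝓘(ℝ, F) x₀).symm z)) y := by
      have := contDiffWithinAt_chart_comp (x₀ := x) (contMDiffOn_extChartAt_symm (n := ∞) x₀ y hy)
        (mem_extChartAt_source (I := 𝓘(ℝ, F)) x)
      exact (this.contDiffAt ((isOpen_extChartAt_target x₀).mem_nhds hy)).differentiableAt (by simp)
    have hd : HasFDerivAt (fun y => f.toFunction ((extChartAt 𝓘(ℝ, F) x).symm y))
        (0 : F →L[ℝ] ℝ) (extChartAt 𝓘(ℝ, F) x x) := by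
      rw [← hcenter x]
      exact ((h x).differentiableAt
        ((isOpen_extChartAt_target x).mem_nhds (mem_extChartAt_target x))).hasFDerivAt
    have hc := HasFDerivAt.comp y (f := fun z => extChartAt 𝓘(ℝ, F) x
        ((extChartAt 𝓘(ℝ, F) x₀).symm z)) hd hτ.hasFDerivAt
    rw [ContinuousLinearMap.zero_comp] at hc
    refine (hc.congr_of_eventuallyEq ?_).fderiv
    have hcont : ContinuousAt (extChartAt 𝓘(ℝ, F) x₀).symm y :=
      (continuousOn_extChartAt_symm x₀).continuousAt ((isOpen_extChartAt_target x₀).mem_nhds hy)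
    filter_upwards [hcont ((isOpen_extChartAt_source (I := 𝓘(ℝ, F)) x).mem_nhds
      (mem_extChartAt_source x))] with z hz
    simp only [Function.comp_apply]
    rw [(extChartAt 𝓘(ℝ, F) x).left_inv hz]
  -- On a ball inside a chart target, vanishing derivative gives constancy; connectedness then makes
  -- it global.
  have hloc : IsLocallyConstant f.toFunction := by
    rw [IsLocallyConstant.iff_eventually_eq]
    intro x₀
    have ht := mem_extChartAt_target (I := 𝓘(ℝ, F)) x₀
    obtain ⟨ε, hε, hball⟩ := Metric.isOpen_iff.1 (isOpen_extChartAt_target (I := 𝓘(ℝ, F)) x₀) _ ht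
    filter_upwards [(isOpen_extChartAt_source (I := 𝓘(ℝ, F)) x₀).mem_nhds
      (mem_extChartAt_source x₀), continuousAt_extChartAt (I := 𝓘(ℝ, F)) x₀
        (Metric.ball_mem_nhds _ hε)] with z hz hzb
    have : f.toFunction ((extChartAt 𝓘(ℝ, F) x₀).symm (extChartAt 𝓘(ℝ, F) x₀ z)) =
        f.toFunction ((extChartAt 𝓘(ℝ, F) x₀).symm (extChartAt 𝓘(ℝ, F) x₀ x₀)) :=
      Metric.isOpen_ball.is_const_of_fderiv_eq_zero
      (convex_ball (extChartAt 𝓘(ℝ, F) x₀ x₀) ε).isPreconnected ((h x₀).mono hball)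
      (fun y hy => hzero x₀ y (hball hy)) hzb (Metric.mem_ball_self hε)
    rwa [(extChartAt 𝓘(ℝ, F) x₀).left_inv hz, extChartAt_to_inv] at this
  exact hloc.apply_eq_of_preconnectedSpace x y

end ZeroFormFunctions

/-! ### Continuous partial derivatives imply Fréchet differentiability. -/

section PartialDerivatives

/-- Induction on the dimension: splitting off the first coordinate gives a function of two variables
with continuous partial Fréchet derivatives, the second one supplied by the induction hypothesis. -/
theorem hasFDerivAt_of_continuousOn_partialDerivs : ∀ (n : ℕ) {U : Set (Fin n → ℝ)}, IsOpen U →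
    ∀ {f : (Fin n → ℝ) → ℝ} {D : Fin n → (Fin n → ℝ) → ℝ},
      (∀ x ∈ U, ∀ i, HasLineDerivAt ℝ f (D i x) x (Pi.single i 1)) →
      (∀ i, ContinuousOn (D i) U) → ∀ {x}, x ∈ U →
      HasFDerivAt f (∑ i, D i x • (ContinuousLinearMap.proj i : (Fin n → ℝ) →L[ℝ] ℝ)) x
  | 0, _, _, f, _, _, _, x, _ => by
    simpa using hasFDerivAt_of_subsingleton f x
  | n + 1, U, hU, f, D, h, hD, x, hx => by
    have hcons : Continuous fun v : ℝ × (Fin n → ℝ) => (Fin.cons v.1 v.2 : Fin (n + 1) → ℝ) :=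
      Continuous.finCons continuous_fst continuous_snd
    let g : ℝ → (Fin n → ℝ) → ℝ := fun a s => f (Fin.cons a s)
    let f₁ : ℝ → (Fin n → ℝ) → ℝ →L[ℝ] ℝ := fun a s =>
      D 0 (Fin.cons a s) • ContinuousLinearMap.id ℝ ℝ
    let f₂ : ℝ → (Fin n → ℝ) → (Fin n → ℝ) →L[ℝ] ℝ := fun a s =>
      ∑ i : Fin n, D i.succ (Fin.cons a s) • ContinuousLinearMap.proj i
    let V : Set (ℝ × (Fin n → ℝ)) := {v | (Fin.cons v.1 v.2 : Fin (n + 1) → ℝ) ∈ U}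
    have hV : IsOpen V := hU.preimage hcons
    let u : ℝ × (Fin n → ℝ) := (x 0, Fin.tail x)
    have hu : u ∈ V := by
      change (Fin.cons (x 0) (Fin.tail x) : Fin (n + 1) → ℝ) ∈ U
      rwa [Fin.cons_self_tail]
    have hDc : ∀ i, ContinuousOn (fun v : ℝ × (Fin n → ℝ) =>
        D i (Fin.cons v.1 v.2 : Fin (n + 1) → ℝ)) V := fun i =>
      (hD i).comp hcons.continuousOn fun v hv => hv
    have key := hasStrictFDerivAt_uncurry_coprod (𝕜 := ℝ) (u := u) (f := g) (f₁ := f₁) (f₂ := f₂)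
      (by
        filter_upwards [hV.mem_nhds hu] with v hv
        have h1 : HasDerivAt (fun t : ℝ => f (Fin.cons v.1 v.2 + t • Pi.single 0 1))
          (D 0 (Fin.cons v.1 v.2)) 0 := h _ hv 0
        rw [← sub_self v.1] at h1
        have h2 := h1.comp_sub_const v.1 v.1
        have h3 : (fun b : ℝ => f (Fin.cons v.1 v.2 + (b - v.1) • Pi.single 0 1)) =
            fun b => g b v.2 := by
          funext b
          refine congrArg f (funext fun i => ?_)
          refine Fin.cases ?_ (fun i => ?_) i <;> simp
        rw [h3] at h2
        refine h2.hasFDerivAt.congr_fderiv ?_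
        ext
        simp [f₁, Function.HasUncurry.uncurry])
      (by
        filter_upwards [hV.mem_nhds hu] with v hv
        have hW : IsOpen {s : Fin n → ℝ | (v.1, s) ∈ V} :=
          hV.preimage (continuous_const.prodMk continuous_id)
        refine hasFDerivAt_of_continuousOn_partialDerivs n hW
          (D := fun i s => D i.succ (Fin.cons v.1 s)) (fun s hs i => ?_) (fun i => ?_)
          (show v.2 ∈ {s : Fin n → ℝ | (v.1, s) ∈ V} from hv)
        · have h1 : HasDerivAt (fun t : ℝ => f (Fin.cons v.1 s + t • Pi.single i.succ 1))
            (D i.succ (Fin.cons v.1 s)) 0 := h _ hs i.succ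
          have h3 : (fun t : ℝ => f (Fin.cons v.1 s + t • Pi.single i.succ 1)) =
              fun t => g v.1 (s + t • Pi.single i 1) := by
            funext t
            refine congrArg f (funext fun j => ?_)
            refine Fin.cases ?_ (fun j => ?_) j <;> simp [Pi.single_apply]
          rw [h3] at h1
          exact h1
        · exact (hDc i.succ).comp (continuous_const.prodMk continuous_id).continuousOn
            fun s hs => hs)
      (((hDc 0).continuousAt (hV.mem_nhds hu)).smul continuousAt_const)
      (by
        have : ContinuousAt (fun v : ℝ × (Fin n → ℝ) => ∑ i : Fin n,
            D i.succ (Fin.cons v.1 v.2 : Fin (n + 1) → ℝ) •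
              (ContinuousLinearMap.proj i : (Fin n → ℝ) →L[ℝ] ℝ)) u :=
          tendsto_finsetSum _ fun i _ =>
            ((hDc i.succ).continuousAt (hV.mem_nhds hu)).smul continuousAt_const
        exact this)
    let P : (Fin (n + 1) → ℝ) →L[ℝ] ℝ × (Fin n → ℝ) :=
      (ContinuousLinearMap.proj 0).prod (ContinuousLinearMap.pi fun i =>
        ContinuousLinearMap.proj i.succ)
    have hcomp := HasFDerivAt.comp x (f := P) key.hasFDerivAt P.hasFDerivAt
    have hfun : (↿g ∘ P) = f := by
      funext y
      change f (Fin.cons (y 0) (Fin.tail y)) = f y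
      rw [Fin.cons_self_tail]
    rw [hfun] at hcomp
    refine hcomp.congr_fderiv ?_
    ext y
    have hself : (Fin.cons (x 0) (Fin.tail x) : Fin (n + 1) → ℝ) = x := Fin.cons_self_tail x
    simp [Fin.sum_univ_succ, f₁, f₂, P, u, Function.HasUncurry.uncurry, hself]

variable {X : Type*} [NormedAddCommGroup X] [NormedSpace ℝ X] [FiniteDimensional ℝ X]

theorem hasFDerivAt_of_continuousOn_lineDerivs {ι : Type*} [Fintype ι]
    (b : Module.Basis ι ℝ X) {U : Set X} (hU : IsOpen U) {f : X → ℝ} {D : ι → X → ℝ}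
    (h : ∀ x ∈ U, ∀ i, HasLineDerivAt ℝ f (D i x) x (b i)) (hD : ∀ i, ContinuousOn (D i) U)
    {x : X} (hx : x ∈ U) :
    HasFDerivAt f (∑ i, D i x • LinearMap.toContinuousLinearMap (b.coord i)) x := by
  classical
  let e := Fintype.equivFin ι
  let b' := b.reindex e
  let L : X ≃L[ℝ] (Fin (Fintype.card ι) → ℝ) := b'.equivFun.toContinuousLinearEquiv
  have hL : ∀ i, L.symm (Pi.single i 1) = b (e.symm i) := fun i => by
    have : b'.equivFun.symm (Pi.single i 1) = b' i := by
      rw [LinearEquiv.symm_apply_eq]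
      funext j
      rw [Module.Basis.equivFun_self]
      simp [Pi.single_apply, eq_comm]
    rw [← b.reindex_apply e i, ← this]
    rfl
  have key := hasFDerivAt_of_continuousOn_partialDerivs _ (hU.preimage L.symm.continuous)
    (f := f ∘ L.symm) (D := fun i y => D (e.symm i) (L.symm y))
    (fun y hy i => by
      have h1 := h (L.symm y) hy (e.symm i)
      unfold HasLineDerivAt at h1 ⊢
      convert h1 using 1
      funext t
      rw [Function.comp_apply, map_add, map_smul, hL])
    (fun i => (hD _).comp L.symm.continuous.continuousOn fun y hy => hy) (x := L x)
    (by simpa using hx)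
  have hcomp := HasFDerivAt.comp x (f := L) key L.hasFDerivAt
  have hfun : (f ∘ L.symm) ∘ L = f := by funext y; simp
  rw [hfun] at hcomp
  refine hcomp.congr_fderiv ?_
  ext y
  simp only [sum_apply, smul_apply,
    ContinuousLinearMap.comp_apply, ContinuousLinearEquiv.symm_apply_apply]
  refine (Fintype.sum_equiv e _ _ fun i => ?_).symm
  rw [Equiv.symm_apply_apply]
  congr 1
  change b.coord i y = b'.equivFun y (e i)
  simp [b']

/-- A function with directional derivatives of class `C^n` along a basis is of class `C^{n+1}`. -/
theorem contDiffOn_succ_of_lineDerivs {ι : Type*} [Fintype ι]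
    (b : Module.Basis ι ℝ X) {U : Set X} (hU : IsOpen U) {f : X → ℝ} {D : ι → X → ℝ} {n : ℕ}
    (h : ∀ x ∈ U, ∀ i, HasLineDerivAt ℝ f (D i x) x (b i))
    (hD : ∀ i, ContDiffOn ℝ n (D i) U) : ContDiffOn ℝ (n + 1 : ℕ) f U := by
  have hf : ∀ x ∈ U, HasFDerivAt f (∑ i, D i x • LinearMap.toContinuousLinearMap (b.coord i)) x :=
    fun x hx => hasFDerivAt_of_continuousOn_lineDerivs b hU h (fun i => (hD i).continuousOn) hx
  push_cast
  rw [contDiffOn_succ_iff_fderiv_of_isOpen hU]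
  refine ⟨fun x hx => (hf x hx).differentiableAt.differentiableWithinAt, by simp, ?_⟩
  refine ContDiffOn.congr (f := fun x => ∑ i, D i x • LinearMap.toContinuousLinearMap (b.coord i))
    (ContDiffOn.sum fun i _ => (hD i).smul contDiffOn_const) fun x hx => (hf x hx).fderiv

end PartialDerivatives

/-! ### Smoothness with values in topological vector spaces, compared with the usual notion. -/

section ContDiffTVS

variable {X : Type*} [NormedAddCommGroup X] [NormedSpace ℝ X]
  {A : Type*} [AddCommGroup A] [Module ℝ A] [TopologicalSpace A]

theorem ContDiffTVS.of_succ : ∀ {n : ℕ} {f : X → A} {U : Set X},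
    ContDiffTVS (n + 1) f U → ContDiffTVS n f U
  | 0, _, _, h => h.1
  | _ + 1, _, _, ⟨hc, f', hf', h⟩ => ⟨hc, f', hf', fun v => (h v).of_succ⟩

theorem ContDiffTVS.continuousLinear_comp {B : Type*} [AddCommGroup B] [Module ℝ B]
    [TopologicalSpace B] (ℓ : A →ₗ[ℝ] B) (hℓ : Continuous ℓ) : ∀ {n : ℕ} {f : X → A} {U : Set X},
    ContDiffTVS n f U → ContDiffTVS n (fun x => ℓ (f x)) U
  | 0, _, _, h => hℓ.comp_continuousOn h
  | _ + 1, f, _, ⟨hc, f', hf', h⟩ => by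
    refine ⟨hℓ.comp_continuousOn hc, fun x v => ℓ (f' x v), fun x hx v => ?_, fun v =>
      continuousLinear_comp ℓ hℓ (h v)⟩
    have := (hℓ.tendsto _).comp (hf' x hx v)
    simpa [Function.comp_def] using this

/-- The definition gives directional derivatives with no linearity in the direction. Those along a
basis already suffice, by induction on the order. -/
theorem ContDiffTVS.contDiffOn [FiniteDimensional ℝ X] : ∀ {n : ℕ} {f : X → ℝ} {U : Set X},
    IsOpen U → ContDiffTVS n f U → ContDiffOn ℝ n f U
  | 0, _, _, _, h => contDiffOn_zero.2 h
  | _ + 1, _, _, hU, ⟨_, f', hf', h⟩ =>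
    contDiffOn_succ_of_lineDerivs (Module.finBasis ℝ X) hU
      (D := fun i x => f' x (Module.finBasis ℝ X i))
      (fun x hx i => hasLineDerivAt_iff_tendsto_slope_zero.2 (hf' x hx _))
      fun i => (h _).contDiffOn hU

theorem contDiffTVS_of_contDiffOn {U : Set X} (hU : IsOpen U) : ∀ (n : ℕ) {f : X → ℝ},
    ContDiffOn ℝ ∞ f U → ContDiffTVS n f U
  | 0, _, h => h.continuousOn
  | n + 1, f, h => by
    refine ⟨h.continuousOn, fun x v => fderiv ℝ f x v, fun x hx v => ?_, fun v =>
      contDiffTVS_of_contDiffOn hU n ?_⟩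
    · exact (((h.differentiableOn (by simp)).differentiableAt
        (hU.mem_nhds hx)).hasFDerivAt.hasLineDerivAt v).tendsto_slope_zero
    · exact (h.fderiv_of_isOpen hU (by simp)).clm_apply contDiffOn_const

end ContDiffTVS

/-! ### The C^∞-topology on forms and continuity of integration. -/

section FormTopology

variable {E : Type*} [NormedAddCommGroup E] [NormedSpace ℝ E]
  {M : Type*} [TopologicalSpace M] [ChartedSpace E M] {q k : ℕ}

theorem tendsto_smoothForms_iff {ι : Type*} {l : Filter ι} {Φ : ι → smoothForms E M k}
    {θ : smoothForms E M k} :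
    Filter.Tendsto Φ l (𝓝 θ) ↔ ∀ (x₀ : M) (n : ℕ) (K : Set E), IsCompact K →
      K ⊆ (extChartAt 𝓘(ℝ, E) x₀).target →
      TendstoUniformlyOn (fun i => iteratedFDeriv ℝ n ((Φ i : DForm E M k).chartRep x₀))
        (iteratedFDeriv ℝ n ((θ : DForm E M k).chartRep x₀)) l K := by
  rw [nhds_iInf, Filter.tendsto_iInf]
  refine forall_congr' fun x₀ => ?_
  rw [nhds_iInf, Filter.tendsto_iInf]
  refine forall_congr' fun n => ?_
  rw [nhds_induced, Filter.tendsto_comap_iff, UniformOnFun.tendsto_iff_tendstoUniformlyOn]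
  exact ⟨fun h K hK hKt => h K ⟨hK, hKt⟩, fun h K hK => h K hK.1 hK.2⟩

theorem tendstoUniformlyOn_chartRep {θ : smoothForms E M k} {x₀ : M} {K : Set E} (hK : IsCompact K)
    (hKt : K ⊆ (extChartAt 𝓘(ℝ, E) x₀).target) :
    TendstoUniformlyOn (fun η : smoothForms E M k => (η : DForm E M k).chartRep x₀)
      ((θ : DForm E M k).chartRep x₀) (𝓝 θ) K := by
  have h := tendsto_smoothForms_iff.1 (Filter.tendsto_id (x := 𝓝 θ)) x₀ 0 K hK hKt
  rw [Metric.tendstoUniformlyOn_iff] at h ⊢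
  intro ε hε
  filter_upwards [h ε hε] with η hη y hy
  have := hη y hy
  rwa [iteratedFDeriv_zero_eq_comp, iteratedFDeriv_zero_eq_comp, Function.comp_apply,
    Function.comp_apply, LinearIsometryEquiv.dist_map] at this

variable [FiniteDimensional ℝ E] [IsManifold 𝓘(ℝ, E) ∞ M]

/-- Only uniform convergence of coefficients on compact sets is needed: pulling back multiplies
errors by at most a locally bounded factor, and compactness of the simplex makes local estimates
uniform. -/
theorem tendstoUniformlyOn_pullbackWithin (σ : SmoothSimplex E M q) (θ : smoothForms E M q) :
    TendstoUniformlyOn (fun (η : smoothForms E M q) t =>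
        pullbackWithin σ.ext (cornerSimplex q) (η : DForm E M q) t (stdFrame q))
      (fun t => pullbackWithin σ.ext (cornerSimplex q) (θ : DForm E M q) t (stdFrame q))
      (𝓝 θ) (cornerSimplex q) := by
  rw [← tendstoLocallyUniformlyOn_iff_tendstoUniformlyOn_of_compact (isCompact_cornerSimplex q),
    Metric.tendstoLocallyUniformlyOn_iff]
  intro ε hε t₀ ht₀
  set x₀ : M := σ.ext t₀
  set u : (Fin q → ℝ) → E := fun t => extChartAt 𝓘(ℝ, E) x₀ (σ.ext t)
  obtain ⟨K, hK, hxK, hKt⟩ := exists_compact_subset (isOpen_extChartAt_target (I := 𝓘(ℝ, E)) x₀)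
    (mem_extChartAt_target x₀)
  have hu : ContDiffWithinAt ℝ ∞ u (cornerSimplex q) t₀ :=
    contDiffWithinAt_chart_comp (σ.smooth t₀ ht₀) (mem_extChartAt_source x₀)
  have hS := uniqueDiffOn_cornerSimplex q
  -- This product bounds the value on the pushed-forward frame by the operator norm of the form;
  -- near `t₀` it stays below `β t₀ + 1`.
  let β : (Fin q → ℝ) → ℝ := fun t =>
    ∏ j, ‖fderivWithin ℝ u (cornerSimplex q) t (stdFrame q j)‖
  have hβ : ContinuousWithinAt β (cornerSimplex q) t₀ :=
    tendsto_finsetProd _ fun j _ =>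
      (((hu.fderivWithin_right (m := ∞) hS (by simp) ht₀).continuousWithinAt).clm_apply
        continuousWithinAt_const).norm
  have hβ0 : ∀ t, 0 ≤ β t := fun t => Finset.prod_nonneg fun j _ => norm_nonneg _
  have hC : 0 < β t₀ + 1 := by linarith [hβ0 t₀]
  refine ⟨{t | t ∈ cornerSimplex q ∧ σ.ext t ∈ (extChartAt 𝓘(ℝ, E) x₀).source ∧ u t ∈ K ∧
    β t < β t₀ + 1}, ?_, ?_⟩
  · filter_upwards [self_mem_nhdsWithin,
      eventually_mem_source_of_continuousWithinAt (E := E)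
        (σ.smooth t₀ ht₀).continuousWithinAt,
      hu.continuousWithinAt (mem_interior_iff_mem_nhds.1 hxK),
      hβ.eventually (gt_mem_nhds (lt_add_one (β t₀)))] with t h1 h2 h3 h4 using ⟨h1, h2, h3, h4⟩
  · have hlim := Metric.tendstoUniformlyOn_iff.1 (tendstoUniformlyOn_chartRep (θ := θ) hK hKt)
      (ε / (β t₀ + 1)) (div_pos hε hC)
    filter_upwards [hlim] with η hη t ht
    obtain ⟨h1, h2, h3, h4⟩ := ht
    rw [pullbackWithin_eq_chartRep _ (hS t h1) (σ.smooth t h1) h2,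
      pullbackWithin_eq_chartRep _ (hS t h1) (σ.smooth t h1) h2, dist_eq_norm,
      ContinuousAlternatingMap.compContinuousLinearMap_apply,
      ContinuousAlternatingMap.compContinuousLinearMap_apply, ← ContinuousAlternatingMap.sub_apply]
    have h5 := hη (u t) h3
    rw [dist_eq_norm] at h5
    refine (ContinuousAlternatingMap.le_opNorm _ _).trans_lt ?_
    change _ * β t < ε
    calc _ ≤ ‖(θ : DForm E M q).chartRep x₀ (u t) - (η : DForm E M q).chartRep x₀ (u t)‖
            * (β t₀ + 1) := by gcongr
      _ < ε / (β t₀ + 1) * (β t₀ + 1) := by gcongr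
      _ = ε := div_mul_cancel₀ _ hC.ne'

theorem SmoothSimplex.integrableOn_pullbackWithin (σ : SmoothSimplex E M q) {η : DForm E M q}
    (hη : η.IsSmooth) : IntegrableOn
      (fun t => pullbackWithin σ.ext (cornerSimplex q) η t (stdFrame q)) (cornerSimplex q) :=
  ((ContinuousAlternatingMap.apply ℝ (Fin q → ℝ) ℝ (stdFrame q)).continuous.comp_continuousOn
    (contDiffOn_pullbackWithin hη (uniqueDiffOn_cornerSimplex q)
      σ.smooth).continuousOn).integrableOn_compact (isCompact_cornerSimplex q)

/-- Integration of smooth forms over a smooth singular chain, as a linear functional. -/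
def SmoothChain.integralLinear (α : SmoothChain E M q) : smoothForms E M q →ₗ[ℝ] ℝ where
  toFun η := α.integral fun x v => (η : DForm E M q) x v
  map_add' η θ := by
    rw [SmoothChain.integral, SmoothChain.integral, SmoothChain.integral, ← Finsupp.sum_add]
    refine Finsupp.sum_congr fun σ _ => ?_
    rw [← smul_add]
    congr 1
    exact integral_add (σ.integrableOn_pullbackWithin η.2) (σ.integrableOn_pullbackWithin θ.2)
  map_smul' r η := by
    rw [SmoothChain.integral, SmoothChain.integral, RingHom.id_apply, Finsupp.smul_sum]
    refine Finsupp.sum_congr fun σ _ => ?_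
    rw [smul_comm]
    congr 1
    exact integral_smul r _

theorem SmoothChain.continuous_integralLinear (α : SmoothChain E M q) :
    Continuous α.integralLinear := by
  have hσ : ∀ σ : SmoothSimplex E M q, Continuous fun η : smoothForms E M q =>
      σ.integral fun x v => (η : DForm E M q) x v := fun σ => by
    rw [continuous_iff_continuousAt]
    intro θ
    simp only [ContinuousAt, SmoothSimplex.integral_form]
    rw [Metric.tendsto_nhds]
    intro ε hε
    -- The tolerance is divided by `v + 1`, which is positive without knowing that the simplex has
    -- positive volume.
    set v : ℝ := (volume : Measure (Fin q → ℝ)).real (cornerSimplex q)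
    have hv : 0 < v + 1 := by positivity
    filter_upwards [Metric.tendstoUniformlyOn_iff.1 (tendstoUniformlyOn_pullbackWithin σ θ)
      (ε / (v + 1)) (div_pos hε hv)] with η hη
    rw [dist_eq_norm, ← integral_sub (σ.integrableOn_pullbackWithin η.2)
      (σ.integrableOn_pullbackWithin θ.2)]
    refine (norm_setIntegral_le_of_norm_le_const (C := ε / (v + 1))
      (isCompact_cornerSimplex q).measure_lt_top fun t ht => ?_).trans_lt ?_
    · rw [← dist_eq_norm, dist_comm]
      exact (hη t ht).le
    · change ε / (v + 1) * v < ε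
      rw [div_mul_eq_mul_div, div_lt_iff₀ hv]
      nlinarith
  exact continuous_finsetSum _ fun σ _ => continuous_const.mul (hσ σ)

end FormTopology

/-! ### Differentiable real cochains in charts, and integration of form-valued cochains. -/

section RealCochains

variable {F : Type*} [NormedAddCommGroup F] [NormedSpace ℝ F] [FiniteDimensional ℝ F]
  {G : Type*} [TopologicalSpace G] [ChartedSpace F G] {p : ℕ}

theorem isOpen_pi_chartAt_target (g₀ : Fin p → G) :
    IsOpen (Set.univ.pi fun i => (chartAt F (g₀ i)).target) :=
  isOpen_set_pi Set.finite_univ fun i _ => (chartAt F (g₀ i)).open_target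

theorem isDiffCochain_real_iff {c : (Fin p → G) → ℝ} : IsDiffCochain F c ↔
    ∀ g₀ : Fin p → G, ContDiffOn ℝ ∞ (fun y : Fin p → F => c fun i => (chartAt F (g₀ i)).symm (y i))
      (Set.univ.pi fun i => (chartAt F (g₀ i)).target) :=
  ⟨fun h g₀ => contDiffOn_infty.2 fun n => (h g₀ n).contDiffOn (isOpen_pi_chartAt_target g₀),
    fun h g₀ n => contDiffTVS_of_contDiffOn (isOpen_pi_chartAt_target g₀) n (h g₀)⟩

/-- Composition of a differentiable cochain with smooth maps into the group. -/
theorem IsDiffCochain.contDiffOn_comp [IsManifold 𝓘(ℝ, F) ∞ G] {c : (Fin p → G) → ℝ}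
    (hc : IsDiffCochain F c) {W : Type*} [NormedAddCommGroup W] [NormedSpace ℝ W] {s : Set W}
    {u : W → Fin p → G} (hu : ∀ i, ContMDiffOn 𝓘(ℝ, W) 𝓘(ℝ, F) ∞ (fun w => u w i) s) :
    ContDiffOn ℝ ∞ (fun w => c (u w)) s := by
  intro w₀ hw₀
  have h1 : ContDiffWithinAt ℝ ∞ (fun w i => chartAt F (u w₀ i) (u w i)) s w₀ :=
    contDiffWithinAt_pi.2 fun i => by
      have := contDiffWithinAt_chart_comp (hu i w₀ hw₀)
        (mem_extChartAt_source (I := 𝓘(ℝ, F)) (u w₀ i))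
      simpa using this
  have h2 := isDiffCochain_real_iff.1 hc (u w₀)
  have h3 : (fun i => chartAt F (u w₀ i) (u w₀ i)) ∈
      Set.univ.pi fun i => (chartAt F (u w₀ i)).target := fun i _ => mem_chart_target F _
  have h4 := (h2.contDiffAt ((isOpen_pi_chartAt_target (u w₀)).mem_nhds h3)).comp_contDiffWithinAt
    w₀ h1
  refine h4.congr_of_eventuallyEq_of_mem ?_ hw₀
  have h5 : ∀ᶠ w in 𝓝[s] w₀, ∀ i, u w i ∈ (chartAt F (u w₀ i)).source :=
    Filter.eventually_all.2 fun i => (hu i w₀ hw₀).continuousWithinAt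
      ((chartAt F (u w₀ i)).open_source.mem_nhds (mem_chart_source F _))
  filter_upwards [h5] with w hw
  simp only [Function.comp_apply]
  congr 1
  funext i
  rw [(chartAt F (u w₀ i)).left_inv (hw i)]

theorem contMDiffOn_chart_coordinate [IsManifold 𝓘(ℝ, F) ∞ G] (g₀ : Fin p → G) (i : Fin p) :
    ContMDiffOn 𝓘(ℝ, Fin p → F) 𝓘(ℝ, F) ∞ (fun y : Fin p → F => (chartAt F (g₀ i)).symm (y i))
      (Set.univ.pi fun i => (chartAt F (g₀ i)).target) :=
  ((contMDiffOn_chart_symm (I := 𝓘(ℝ, F)) (n := ∞) (x := g₀ i))).comp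
    (contDiff_apply ℝ F i).contMDiff.contMDiffOn fun _ hy => hy i trivial

/-- This is the use of the C^∞-topology: integration over α is a continuous linear functional, and
such functionals preserve differentiability. -/
theorem IsDiffCochain.integral {E : Type*} [NormedAddCommGroup E] [NormedSpace ℝ E]
    [FiniteDimensional ℝ E] {M : Type*} [TopologicalSpace M] [ChartedSpace E M]
    [IsManifold 𝓘(ℝ, E) ∞ M] {q : ℕ} {c : (Fin p → G) → smoothForms E M q}
    (hc : IsDiffCochain F c) (α : SmoothChain E M q) :
    IsDiffCochain F fun g => α.integral fun x v => (c g : DForm E M q) x v := fun g₀ n =>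
  (hc g₀ n).continuousLinear_comp α.integralLinear α.continuous_integralLinear

end RealCochains

/-! ### Uniform convergence of iterated derivatives, raised by one order. -/

section UniformDerivatives

variable {Z W ι : Type*} [NormedAddCommGroup Z] [NormedSpace ℝ Z]
  [NormedAddCommGroup W] [NormedSpace ℝ W] {l : Filter ι}

theorem tendstoUniformlyOn_iteratedFDeriv_zero_iff {f : ι → Z → W} {f₀ : Z → W} {K : Set Z} :
    TendstoUniformlyOn (fun i => iteratedFDeriv ℝ 0 (f i)) (iteratedFDeriv ℝ 0 f₀) l K ↔
      TendstoUniformlyOn f f₀ l K := by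
  simp only [Metric.tendstoUniformlyOn_iff, iteratedFDeriv_zero_eq_comp, Function.comp_apply,
    LinearIsometryEquiv.dist_map]

/-- Up to a linear isometry, the derivative of order n + 1 of a function is the derivative of order
n of its differential. -/
theorem tendstoUniformlyOn_iteratedFDeriv_succ {U K : Set Z} (hU : IsOpen U) (hK : K ⊆ U) {n : ℕ}
    {f : ι → Z → W} {f₀ : Z → W} {D : ι → Z → Z →L[ℝ] W} {D₀ : Z → Z →L[ℝ] W}
    (hf : ∀ᶠ i in l, ∀ z ∈ U, HasFDerivAt (f i) (D i z) z)
    (hf₀ : ∀ z ∈ U, HasFDerivAt f₀ (D₀ z) z)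
    (hD : TendstoUniformlyOn (fun i => iteratedFDeriv ℝ n (D i)) (iteratedFDeriv ℝ n D₀) l K) :
    TendstoUniformlyOn (fun i => iteratedFDeriv ℝ (n + 1) (f i)) (iteratedFDeriv ℝ (n + 1) f₀)
      l K := by
  have key : ∀ {g : Z → W} {g' : Z → Z →L[ℝ] W}, (∀ z ∈ U, HasFDerivAt g (g' z) z) → ∀ z ∈ K,
      iteratedFDeriv ℝ (n + 1) g z =
        (continuousMultilinearCurryRightEquiv' ℝ n Z W).symm (iteratedFDeriv ℝ n g' z) := by
    intro g g' hg z hz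
    rw [iteratedFDeriv_succ_eq_comp_right, Function.comp_apply]
    congr 1
    refine Filter.EventuallyEq.eq_of_nhds (Filter.EventuallyEq.iteratedFDeriv ℝ ?_ n)
    filter_upwards [hU.mem_nhds (hK hz)] with y hy using (hg y hy).fderiv
  rw [Metric.tendstoUniformlyOn_iff] at hD ⊢
  intro ε hε
  filter_upwards [hf, hD ε hε] with i hi hDi z hz
  rw [key hf₀ z hz, key hi z hz, LinearIsometryEquiv.dist_map]
  exact hDi z hz

end UniformDerivatives

/-! ### Slices and difference quotients of jointly smooth maps, uniformly with all derivatives. -/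

section ParametricFamilies

universe u

variable {Y : Type*} [NormedAddCommGroup Y] [NormedSpace ℝ Y] {Z : Type u} [NormedAddCommGroup Z]
  [NormedSpace ℝ Z] {V : Set Y} {U : Set Z}

/-- Order zero is uniform continuity near a compact set. For the induction, `B` is replaced by its
partial differential in z, so the target changes from W to Z →L W; this is why W ranges over the
universe of Z. -/
theorem tendstoUniformlyOn_slice (hV : IsOpen V) (hU : IsOpen U) :
    ∀ (n : ℕ) {W : Type u} [NormedAddCommGroup W] [NormedSpace ℝ W] {B : Y × Z → W},
      ContDiffOn ℝ ∞ B (V ×ˢ U) → ∀ {y₀ : Y}, y₀ ∈ V → ∀ {K : Set Z}, IsCompact K → K ⊆ U →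
      TendstoUniformlyOn (fun y => iteratedFDeriv ℝ n fun z => B (y, z))
        (iteratedFDeriv ℝ n fun z => B (y₀, z)) (𝓝 y₀) K
  | 0, _, _, _, B, hB, y₀, hy₀, K, hK, hKU => by
    rw [tendstoUniformlyOn_iteratedFDeriv_zero_iff]
    intro u hu
    obtain ⟨v, hv, h⟩ := hK.mem_uniformity_of_prod (f := fun y z => B (y, z)) (s := V) (q := y₀)
      (hB.continuousOn.mono (prod_mono subset_rfl hKU)) hy₀ (symm_le_uniformity hu)
    rw [hV.nhdsWithin_eq hy₀] at hv
    filter_upwards [hv] with y hy z hz using h y hy z hz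
  | n + 1, _, _, _, B, hB, y₀, hy₀, K, hK, hKU => by
    have hC : ContDiffOn ℝ ∞ (fun w => (fderiv ℝ B w).comp (ContinuousLinearMap.inr ℝ Y Z))
        (V ×ˢ U) := (hB.fderiv_of_isOpen (hV.prod hU) (by simp)).clm_comp contDiffOn_const
    have hd : ∀ y ∈ V, ∀ z ∈ U, HasFDerivAt (fun z => B (y, z))
        ((fderiv ℝ B (y, z)).comp (ContinuousLinearMap.inr ℝ Y Z)) z := fun y hy z hz =>
      HasFDerivAt.comp z (g := B) (((hB.differentiableOn (by simp)).differentiableAt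
        ((hV.prod hU).mem_nhds ⟨hy, hz⟩)).hasFDerivAt) (hasFDerivAt_prodMk_right y z)
    exact tendstoUniformlyOn_iteratedFDeriv_succ hU hKU
      (by filter_upwards [hV.mem_nhds hy₀] with y hy using hd y hy) (hd y₀ hy₀)
      (tendstoUniformlyOn_slice hV hU n hC hy₀ hK hKU)

/-- Symmetry of the second derivative: it lets the limit of difference quotients be differentiated
in z. -/
theorem hasFDerivAt_partial_comm {W : Type*} [NormedAddCommGroup W] [NormedSpace ℝ W]
    {B : Y × Z → W} {w : Y × Z} (hB : ContDiffAt ℝ ∞ B w) (v : Y) :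
    HasFDerivAt (fun z => fderiv ℝ B (w.1, z) (v, 0))
      (fderiv ℝ (fun w => (fderiv ℝ B w).comp (ContinuousLinearMap.inr ℝ Y Z)) w (v, 0)) w.2 := by
  have h1 : HasFDerivAt (fderiv ℝ B) (fderiv ℝ (fderiv ℝ B) w) w :=
    ((hB.fderiv_right (m := ∞) (by simp)).differentiableAt (by simp)).hasFDerivAt
  have h2 := (HasFDerivAt.comp w.2 (g := fderiv ℝ B) h1
    (hasFDerivAt_prodMk_right w.1 w.2)).clm_apply (hasFDerivAt_const ((v, 0) : Y × Z) w.2)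
  have h3 := h1.clm_comp (hasFDerivAt_const (ContinuousLinearMap.inr ℝ Y Z) w)
  rw [h3.fderiv]
  refine h2.congr_fderiv ?_
  ext z
  have hs := hB.isSymmSndFDerivAt (by
    rw [minSmoothness_of_isRCLikeNormedField]; exact WithTop.coe_le_coe.2 le_top)
  simpa using hs (0, z) (v, 0)

/-- Order zero is a mean value estimate. Higher orders follow by applying the previous order to the
partial differential in z, whose derivative along v is the z-derivative of the expected limit. -/
theorem tendstoUniformlyOn_slope (hV : IsOpen V) (hU : IsOpen U) :
    ∀ (n : ℕ) {W : Type u} [NormedAddCommGroup W] [NormedSpace ℝ W] {B : Y × Z → W},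
      ContDiffOn ℝ ∞ B (V ×ˢ U) → ∀ {y₀ : Y}, y₀ ∈ V → ∀ (v : Y) {K : Set Z}, IsCompact K → K ⊆ U →
      TendstoUniformlyOn
        (fun s : ℝ => iteratedFDeriv ℝ n fun z => s⁻¹ • (B (y₀ + s • v, z) - B (y₀, z)))
        (iteratedFDeriv ℝ n fun z => fderiv ℝ B (y₀, z) (v, 0)) (𝓝[≠] 0) K
  | 0, _, _, _, B, hB, y₀, hy₀, v, K, hK, hKU => by
    have hd : ∀ y ∈ V, ∀ z ∈ U, HasFDerivAt B (fderiv ℝ B (y, z)) (y, z) := fun y hy z hz =>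
      ((hB.differentiableOn (by simp)).differentiableAt
        ((hV.prod hU).mem_nhds ⟨hy, hz⟩)).hasFDerivAt
    have h1 := tendstoUniformlyOn_iteratedFDeriv_zero_iff.1
      (tendstoUniformlyOn_slice hV hU 0
        (B := fun w => fderiv ℝ B w (v, 0))
        ((hB.fderiv_of_isOpen (hV.prod hU) (by simp)).clm_apply contDiffOn_const) hy₀ hK hKU)
    rw [tendstoUniformlyOn_iteratedFDeriv_zero_iff]
    rw [Metric.tendstoUniformlyOn_iff] at h1 ⊢
    intro ε hε
    have hline : Continuous fun s : ℝ => y₀ + s • v := by fun_prop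
    have h2 : ∀ᶠ s : ℝ in 𝓝 0, y₀ + s • v ∈ V ∧ ∀ z ∈ K,
        dist (fderiv ℝ B (y₀, z) (v, 0)) (fderiv ℝ B (y₀ + s • v, z) (v, 0)) < ε / 2 := by
      have h3 : Filter.Tendsto (fun s : ℝ => y₀ + s • v) (𝓝 0) (𝓝 y₀) := by
        simpa using hline.tendsto 0
      exact h3.eventually ((hV.eventually_mem hy₀).and (h1 (ε / 2) (half_pos hε)))
    obtain ⟨r, hr, hball⟩ := Metric.eventually_nhds_iff_ball.1 h2
    filter_upwards [self_mem_nhdsWithin, mem_nhdsWithin_of_mem_nhds (Metric.ball_mem_nhds 0 hr)]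
      with s hs0 hs z hz
    have hz' := hKU hz
    -- Subtracting the linear term leaves a function of t whose derivative is below ε/2 uniformly in
    -- z ∈ K, hence an error of at most ε/2 in the quotient.
    have hmv := (convex_ball (0 : ℝ) r).norm_image_sub_le_of_norm_hasDerivWithin_le
      (f := fun t : ℝ => B (y₀ + t • v, z) - t • fderiv ℝ B (y₀, z) (v, 0))
      (f' := fun t : ℝ => fderiv ℝ B (y₀ + t • v, z) (v, 0) - fderiv ℝ B (y₀, z) (v, 0))
      (C := ε / 2) (x := 0) (y := s)
      (fun t ht => by
        have hl : HasDerivAt (fun t : ℝ => (y₀ + t • v, z)) (v, 0) t := by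
          have : HasDerivAt (fun t : ℝ => y₀ + t • v) v t := by
            simpa using ((hasDerivAt_id t).smul_const v).const_add y₀
          exact this.prodMk (hasDerivAt_const t z)
        have h4 := (hd _ (hball t ht).1 z hz').comp_hasDerivAt t hl
        have h5 : HasDerivAt (fun t : ℝ => t • fderiv ℝ B (y₀, z) (v, 0))
            (fderiv ℝ B (y₀, z) (v, 0)) t := by
          simpa using (hasDerivAt_id t).smul_const (fderiv ℝ B (y₀, z) (v, 0))
        exact (h4.sub h5).hasDerivWithinAt)
      (fun t ht => by
        rw [← dist_eq_norm, dist_comm]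
        exact ((hball t ht).2 z hz).le) (Metric.mem_ball_self hr) hs
    have hs' : (0 : ℝ) < ‖s‖ := norm_pos_iff.2 hs0
    have e : s⁻¹ • (B (y₀ + s • v, z) - B (y₀, z)) - fderiv ℝ B (y₀, z) (v, 0) =
        s⁻¹ • (B (y₀ + s • v, z) - s • fderiv ℝ B (y₀, z) (v, 0) -
          (B (y₀ + (0 : ℝ) • v, z) - (0 : ℝ) • fderiv ℝ B (y₀, z) (v, 0))) := by
      have hs1 : s ≠ 0 := hs0
      simp only [zero_smul, add_zero, sub_zero, smul_sub, smul_smul, inv_mul_cancel₀ hs1, one_smul]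
      abel
    rw [dist_comm, dist_eq_norm, e, norm_smul, norm_inv]
    calc ‖s‖⁻¹ * _ ≤ ‖s‖⁻¹ * (ε / 2 * ‖s - 0‖) := by gcongr
      _ = ε / 2 := by rw [sub_zero]; field_simp
      _ < ε := half_lt_self hε
  | n + 1, _, _, _, B, hB, y₀, hy₀, v, K, hK, hKU => by
    have hC : ContDiffOn ℝ ∞ (fun w => (fderiv ℝ B w).comp (ContinuousLinearMap.inr ℝ Y Z))
        (V ×ˢ U) := (hB.fderiv_of_isOpen (hV.prod hU) (by simp)).clm_comp contDiffOn_const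
    have hd : ∀ y ∈ V, ∀ z ∈ U, HasFDerivAt (fun z => B (y, z))
        ((fderiv ℝ B (y, z)).comp (ContinuousLinearMap.inr ℝ Y Z)) z := fun y hy z hz =>
      HasFDerivAt.comp z (g := B) (((hB.differentiableOn (by simp)).differentiableAt
        ((hV.prod hU).mem_nhds ⟨hy, hz⟩)).hasFDerivAt) (hasFDerivAt_prodMk_right y z)
    have hline : Filter.Tendsto (fun s : ℝ => y₀ + s • v) (𝓝[≠] 0) (𝓝 y₀) := by
      have : Continuous fun s : ℝ => y₀ + s • v := by fun_prop
      simpa using (this.tendsto 0).mono_left nhdsWithin_le_nhds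
    exact tendstoUniformlyOn_iteratedFDeriv_succ hU hKU
      (by
        filter_upwards [hline.eventually (hV.mem_nhds hy₀)] with s hs z hz
        exact ((hd _ hs z hz).sub (hd _ hy₀ z hz)).const_smul s⁻¹)
      (fun z hz => hasFDerivAt_partial_comm (w := (y₀, z))
        (hB.contDiffAt ((hV.prod hU).mem_nhds ⟨hy₀, hz⟩)) v)
      (tendstoUniformlyOn_slope hV hU n hC hy₀ v hK hKU)

end ParametricFamilies

/-! ### Jointly smooth functions as smooth families of functions. -/

section Currying

theorem smoothForms.chartRep_smul_sub {E : Type*} [NormedAddCommGroup E] [NormedSpace ℝ E]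
    {M : Type*} [TopologicalSpace M] [ChartedSpace E M] {k : ℕ} (r : ℝ) (θ η : smoothForms E M k)
    (x₀ : M) : ((r • (θ - η) : smoothForms E M k) : DForm E M k).chartRep x₀ =
      r • ((θ : DForm E M k).chartRep x₀ - (η : DForm E M k).chartRep x₀) := by
  rw [sub_eq_add_neg, sub_eq_add_neg, ← neg_one_smul ℝ η, ← neg_one_smul ℝ
    ((η : DForm E M k).chartRep x₀)]
  rfl

variable {Y : Type*} [NormedAddCommGroup Y] [NormedSpace ℝ Y] {V : Set Y}
  {F : Type*} [NormedAddCommGroup F] [NormedSpace ℝ F]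
  {G : Type*} [TopologicalSpace G] [ChartedSpace F G]

/-- The smooth form of degree zero underlying a function; zero if the function is not smooth. -/
def smoothFormOfFunction (f : G → ℝ) : smoothForms F G 0 :=
  open Classical in
  if h : (DForm.ofFunction F f).IsSmooth then ⟨DForm.ofFunction F f, h⟩ else 0

theorem coe_smoothFormOfFunction {f : G → ℝ} (h : (DForm.ofFunction F f).IsSmooth) :
    (smoothFormOfFunction f : smoothForms F G 0) = (⟨DForm.ofFunction F f, h⟩ : smoothForms F G 0) :=
  dif_pos h

/-- A jointly smooth family of functions is a smooth family of elements of the space of smooth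
functions. -/
theorem contDiffTVS_of_contDiffOn_uncurry (hV : IsOpen V) : ∀ (n : ℕ) {Φ : Y → smoothForms F G 0},
    (∀ x₀ : G, ContDiffOn ℝ ∞
      (fun w : Y × F => (Φ w.1 : DForm F G 0).toFunction ((extChartAt 𝓘(ℝ, F) x₀).symm w.2))
      (V ×ˢ (extChartAt 𝓘(ℝ, F) x₀).target)) → ContDiffTVS n Φ V := by
  have hLIE := fun (S : Set (Y × F)) (b : Y × F → ℝ) (hb : ContDiffOn ℝ ∞ b S) =>
    (ContinuousAlternatingMap.constOfIsEmptyLIE ℝ F ℝ (Fin 0)).contDiff.comp_contDiffOn hb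
  have hcont : ∀ {Φ : Y → smoothForms F G 0}, (∀ x₀ : G, ContDiffOn ℝ ∞
      (fun w : Y × F => (Φ w.1 : DForm F G 0).toFunction ((extChartAt 𝓘(ℝ, F) x₀).symm w.2))
      (V ×ˢ (extChartAt 𝓘(ℝ, F) x₀).target)) → ContinuousOn Φ V := by
    intro Φ hΦ y₀ hy₀
    refine Filter.Tendsto.mono_left (tendsto_smoothForms_iff.2 fun x₀ m K hK hKt => ?_)
      nhdsWithin_le_nhds
    have h := tendstoUniformlyOn_slice hV (isOpen_extChartAt_target (I := 𝓘(ℝ, F)) x₀) m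
      (hLIE _ _ (hΦ x₀)) hy₀ hK hKt
    convert h using 2
    · rename_i y
      congr 1
      funext z
      exact DForm.chartRep_zero_form _ _ _
    · funext z
      exact DForm.chartRep_zero_form _ _ _
  intro n
  induction n with
  | zero => exact fun hΦ => hcont hΦ
  | succ n ih =>
    intro Φ hΦ
    have hB : ∀ (x₀ : G) (y : Y) (v : Y) (z : F), y ∈ V → z ∈ (extChartAt 𝓘(ℝ, F) x₀).target →
        lineDeriv ℝ (fun y' => (Φ y' : DForm F G 0).toFunction ((extChartAt 𝓘(ℝ, F) x₀).symm z)) y v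
          = fderiv ℝ (fun w : Y × F => (Φ w.1 : DForm F G 0).toFunction
            ((extChartAt 𝓘(ℝ, F) x₀).symm w.2)) (y, z) (v, 0) := by
      intro x₀ y v z hy hz
      have hd := (((hΦ x₀).differentiableOn (by simp)).differentiableAt
        ((hV.prod (isOpen_extChartAt_target (I := 𝓘(ℝ, F)) x₀)).mem_nhds
          (show (y, z) ∈ _ from ⟨hy, hz⟩))).hasFDerivAt
      have h := HasFDerivAt.comp (g := fun w : Y × F => (Φ w.1 : DForm F G 0).toFunction
        ((extChartAt 𝓘(ℝ, F) x₀).symm w.2)) (f := fun y' => (y', z)) y hd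
        (hasFDerivAt_prodMk_left y z)
      exact (h.hasLineDerivAt v).lineDeriv
    have hder : ∀ (x₀ : G) (v : Y), ContDiffOn ℝ ∞ (fun w : Y × F => lineDeriv ℝ (fun y' =>
        (Φ y' : DForm F G 0).toFunction ((extChartAt 𝓘(ℝ, F) x₀).symm w.2)) w.1 v)
        (V ×ˢ (extChartAt 𝓘(ℝ, F) x₀).target) := fun x₀ v =>
      (((hΦ x₀).fderiv_of_isOpen (hV.prod (isOpen_extChartAt_target (I := 𝓘(ℝ, F)) x₀))
        (m := ∞) (by simp)).clm_apply contDiffOn_const).congr fun w hw => hB x₀ w.1 v w.2 hw.1 hw.2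
    -- The candidate derivative is computed pointwise on G. For y outside V the function may fail to
    -- be smooth, and the default value 0 is harmless because only V matters.
    let Φ' : Y → Y → smoothForms F G 0 := fun y v => smoothFormOfFunction fun x =>
      lineDeriv ℝ (fun y' => (Φ y' : DForm F G 0).toFunction x) y v
    have hΦ' : ∀ y ∈ V, ∀ v x, (Φ' y v : DForm F G 0).toFunction x =
        lineDeriv ℝ (fun y' => (Φ y' : DForm F G 0).toFunction x) y v := by
      intro y hy v x
      have hs : (DForm.ofFunction F fun x : G =>
          lineDeriv ℝ (fun y' => (Φ y' : DForm F G 0).toFunction x) y v).IsSmooth :=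
        DForm.isSmooth_of_toFunction fun x₀ =>
          (hder x₀ v).comp (contDiff_const.prodMk contDiff_id).contDiffOn fun z hz => ⟨hy, hz⟩
      simp only [Φ', coe_smoothFormOfFunction hs, DForm.toFunction_ofFunction]
    refine ⟨hcont hΦ, Φ', fun y hy v => ?_, fun v => ih fun x₀ =>
      (hder x₀ v).congr fun w hw => hΦ' w.1 hw.1 v _⟩
    refine tendsto_smoothForms_iff.2 fun x₀ m K hK hKt => ?_
    have ho := isOpen_extChartAt_target (I := 𝓘(ℝ, F)) x₀
    have h := tendstoUniformlyOn_slope hV ho m (hLIE _ _ (hΦ x₀)) hy v hK hKt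
    refine TendstoUniformlyOn.congr_right (f := iteratedFDeriv ℝ m fun z => fderiv ℝ
      (ContinuousAlternatingMap.constOfIsEmptyLIE ℝ F ℝ (Fin 0) ∘ fun w : Y × F =>
        (Φ w.1 : DForm F G 0).toFunction ((extChartAt 𝓘(ℝ, F) x₀).symm w.2)) (y, z) (v, 0)) ?_ ?_
    · convert h using 2
      congr 1
      rw [smoothForms.chartRep_smul_sub]
      funext z
      simp only [Pi.smul_apply, Pi.sub_apply, DForm.chartRep_zero_form]
      rfl
    · intro z hz
      refine Filter.EventuallyEq.eq_of_nhds (Filter.EventuallyEq.iteratedFDeriv ℝ ?_ m)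
      filter_upwards [ho.mem_nhds (hKt hz)] with t ht
      rw [DForm.chartRep_zero_form, hΦ' y hy, hB x₀ y v t hy ht]
      have hd := (((hΦ x₀).differentiableOn (by simp)).differentiableAt
        ((hV.prod ho).mem_nhds (show (y, t) ∈ _ from ⟨hy, ht⟩))).hasFDerivAt
      exact DFunLike.congr_fun ((ContinuousAlternatingMap.constOfIsEmptyLIE ℝ F ℝ (Fin
        0)).toContinuousLinearEquiv.toContinuousLinearMap.hasFDerivAt.comp (y, t) hd).fderiv (v, 0)

end Currying

/-! ### Smooth families of forms have jointly smooth coefficients. -/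

section Uncurrying

variable {Y : Type*} [NormedAddCommGroup Y] [NormedSpace ℝ Y] [FiniteDimensional ℝ Y] {V : Set Y}
  {E : Type*} [NormedAddCommGroup E] [NormedSpace ℝ E] [FiniteDimensional ℝ E]
  {M : Type*} [TopologicalSpace M] [ChartedSpace E M] {k : ℕ}

/-- All orders m of derivatives on M are handled together, because the induction on n trades one for
the other: a derivative in Y replaces Φ by its derivative, a derivative in E raises m by one. Both
have coefficients of class C^n, so the basis criterion applies. -/
theorem contDiffOn_uncurry_of_contDiffTVS (hV : IsOpen V) (x₀ : M) (u : Fin k → E) :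
    ∀ (n m : ℕ) (v : Fin m → E) {Φ : Y → smoothForms E M k}, ContDiffTVS n Φ V →
      ContDiffOn ℝ n (fun w : Y × E =>
          iteratedFDeriv ℝ m ((Φ w.1 : DForm E M k).chartRep x₀) w.2 v u)
        (V ×ˢ (extChartAt 𝓘(ℝ, E) x₀).target) := by
  have ho := isOpen_extChartAt_target (I := 𝓘(ℝ, E)) x₀
  have hsm : ∀ (θ : smoothForms E M k) {z : E}, z ∈ (extChartAt 𝓘(ℝ, E) x₀).target → ∀ m : ℕ,
      ContDiffAt ℝ m ((θ : DForm E M k).chartRep x₀) z := fun θ z hz m =>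
    (θ.2.contDiffAt hz).of_le (by exact_mod_cast le_top)
  have hev : ∀ (m : ℕ) (v : Fin m → E), Continuous
      fun A : E [×m]→L[ℝ] (E [⋀^Fin k]→L[ℝ] ℝ) => A v u := fun m v =>
    (ContinuousAlternatingMap.apply ℝ E ℝ u).continuous.comp
      (ContinuousMultilinearMap.apply ℝ (fun _ => E) _ v).continuous
  intro n
  induction n with
  | zero =>
    intro m v Φ hΦ
    refine contDiffOn_zero.2 ?_
    rintro ⟨y₀, z₀⟩ ⟨hy₀, hz₀⟩
    refine ((hev m v).tendsto _).comp ?_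
    obtain ⟨K, hK, hzK, hKt⟩ := exists_compact_subset ho hz₀
    have hΦt : Filter.Tendsto (fun w : Y × E => Φ w.1)
        (𝓝[V ×ˢ (extChartAt 𝓘(ℝ, E) x₀).target] (y₀, z₀)) (𝓝 (Φ y₀)) :=
      (hΦ y₀ hy₀).tendsto.comp (Filter.Tendsto.mono_right
        (continuousWithinAt_fst.tendsto_nhdsWithin fun w hw => hw.1) le_rfl)
    have hu := tendsto_smoothForms_iff.1 hΦt x₀ m K hK hKt
    -- Joint continuity combines convergence of Φ, uniform on a compact neighbourhood of z₀, with
    -- continuity of the limit form's coefficients.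
    refine tendsto_comp_of_locally_uniform_limit
      (f := iteratedFDeriv ℝ m ((Φ y₀ : DForm E M k).chartRep x₀)) ?_ continuousWithinAt_snd
      fun s hs => ⟨K, mem_interior_iff_mem_nhds.1 hzK, hu s hs⟩
    exact ((hsm (Φ y₀) hz₀ m).iteratedFDeriv_right (m := 0) (by simp)).continuousAt
  | succ n ih =>
    intro m v Φ hΦ
    obtain ⟨hc, Φ', hΦ', hΦ'n⟩ := id hΦ
    have bY := Module.finBasis ℝ Y
    have bE := Module.finBasis ℝ E
    refine contDiffOn_succ_of_lineDerivs (bY.prod bE) (hV.prod ho)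
      (D := Sum.elim
        (fun i w => iteratedFDeriv ℝ m ((Φ' w.1 (bY i) : DForm E M k).chartRep x₀) w.2 v u)
        (fun j w => iteratedFDeriv ℝ (m + 1) ((Φ w.1 : DForm E M k).chartRep x₀) w.2
          (Fin.cons (bE j) v) u)) ?_ ?_
    · rintro ⟨y, z⟩ ⟨hy, hz⟩ (i | j)
      · rw [hasLineDerivAt_iff_tendsto_slope_zero]
        have h1 := (tendsto_smoothForms_iff.1 (hΦ' y hy (bY i)) x₀ m {z} isCompact_singleton
          (singleton_subset_iff.2 hz)).tendsto_at (mem_singleton z)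
        have h2 := ((hev m v).tendsto _).comp h1
        refine h2.congr fun s => ?_
        have hb : (y, z) + s • (bY.prod bE) (Sum.inl i) = (y + s • bY i, z) := by
          simp [Module.Basis.prod_apply]
        have e : iteratedFDeriv ℝ m (((s⁻¹ • (Φ (y + s • bY i) - Φ y) :
            smoothForms E M k) : DForm E M k).chartRep x₀) z =
            s⁻¹ • (iteratedFDeriv ℝ m ((Φ (y + s • bY i) : DForm E M k).chartRep x₀) z -
              iteratedFDeriv ℝ m ((Φ y : DForm E M k).chartRep x₀) z) := by
          have hd : ContDiffAt ℝ m ((Φ (y + s • bY i) : DForm E M k).chartRep x₀ -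
              (Φ y : DForm E M k).chartRep x₀) z := (hsm _ hz m).sub (hsm _ hz m)
          rw [smoothForms.chartRep_smul_sub, iteratedFDeriv_const_smul_apply hd,
            iteratedFDeriv_sub_apply (hsm _ hz m) (hsm _ hz m)]
        rw [hb, Function.comp_apply, e]
        rfl
      · have h1 : HasFDerivAt (iteratedFDeriv ℝ m ((Φ y : DForm E M k).chartRep x₀))
            (fderiv ℝ (iteratedFDeriv ℝ m ((Φ y : DForm E M k).chartRep x₀)) z) z :=
          (((hsm (Φ y) hz (m + 1)).iteratedFDeriv_right (m := 1)
            (by push_cast; rw [add_comm])).differentiableAt (by simp)).hasFDerivAt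
        have h2 := h1.hasLineDerivAt (bE j)
        rw [hasLineDerivAt_iff_tendsto_slope_zero] at h2 ⊢
        have h3 := ((hev m v).tendsto _).comp h2
        simp only [Sum.elim_inr, iteratedFDeriv_succ_apply_left, Fin.cons_zero, Fin.tail_cons]
        refine h3.congr fun s => ?_
        have hb : (y, z) + s • (bY.prod bE) (Sum.inr j) = (y, z + s • bE j) := by
          simp [Module.Basis.prod_apply]
        rw [hb]
        rfl
    · rintro (i | j)
      · exact ih m v (hΦ'n (bY i))
      · exact ih (m + 1) _ hΦ.of_succ

end Uncurrying

/-! ### Stability of differentiable real cochains and the exponential law. -/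

section DifferentiableCochains

variable {F : Type*} [NormedAddCommGroup F] [NormedSpace ℝ F] [FiniteDimensional ℝ F]
  {G : Type*} [TopologicalSpace G] [ChartedSpace F G] {p : ℕ}

theorem IsDiffCochain.add {c c' : (Fin p → G) → ℝ} (hc : IsDiffCochain F c)
    (hc' : IsDiffCochain F c') : IsDiffCochain F fun g => c g + c' g :=
  isDiffCochain_real_iff.2 fun g₀ =>
    (isDiffCochain_real_iff.1 hc g₀).add (isDiffCochain_real_iff.1 hc' g₀)

theorem IsDiffCochain.zsmul (n : ℤ) {c : (Fin p → G) → ℝ} (hc : IsDiffCochain F c) :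
    IsDiffCochain F fun g => n • c g :=
  isDiffCochain_real_iff.2 fun g₀ => by
    simp only [← Int.cast_smul_eq_zsmul ℝ]
    exact (isDiffCochain_real_iff.1 hc g₀).const_smul (n : ℝ)

theorem IsDiffCochain.sum {ι : Type*} (s : Finset ι) {c : ι → (Fin p → G) → ℝ}
    (hc : ∀ i, IsDiffCochain F (c i)) : IsDiffCochain F fun g => ∑ i ∈ s, c i g :=
  isDiffCochain_real_iff.2 fun g₀ =>
    ContDiffOn.sum fun i _ => isDiffCochain_real_iff.1 (hc i) g₀

variable [IsManifold 𝓘(ℝ, F) ∞ G]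

/-- A differentiable cochain as a differentiable family of functions of its last variable. -/
theorem IsDiffCochain.curry {h : (Fin (p + 1) → G) → ℝ} (hh : IsDiffCochain F h) :
    ∃ f : (Fin p → G) → smoothForms F G 0, IsDiffCochain F f ∧
      ∀ g, (f g : DForm F G 0).toFunction = fun x => h (Fin.snoc g x) := by
  have hs : ∀ g : Fin p → G, (DForm.ofFunction F fun x => h (Fin.snoc g x)).IsSmooth := fun g =>
    DForm.isSmooth_of_toFunction fun x₀ => by
      simp only [DForm.toFunction_ofFunction]
      refine hh.contDiffOn_comp (u := fun z => Fin.snoc g ((extChartAt 𝓘(ℝ, F) x₀).symm z))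
        fun i => ?_
      refine Fin.lastCases ?_ (fun i => ?_) i
      · simpa using contMDiffOn_extChartAt_symm (I := 𝓘(ℝ, F)) (n := ∞) x₀
      · simpa using contMDiffOn_const
  have hf : ∀ g, (smoothFormOfFunction (F := F) fun x => h (Fin.snoc g x) : DForm F G 0).toFunction
      = fun x => h (Fin.snoc g x) := fun g => by
    rw [coe_smoothFormOfFunction (hs g), DForm.toFunction_ofFunction]
  refine ⟨fun g => smoothFormOfFunction fun x => h (Fin.snoc g x), fun g₀ n =>
    contDiffTVS_of_contDiffOn_uncurry (isOpen_pi_chartAt_target g₀) n fun x₀ => ?_, hf⟩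
  simp only [hf]
  refine hh.contDiffOn_comp (u := fun w : (Fin p → F) × F => Fin.snoc
    (fun i => (chartAt F (g₀ i)).symm (w.1 i)) ((extChartAt 𝓘(ℝ, F) x₀).symm w.2)) fun i => ?_
  refine Fin.lastCases ?_ (fun i => ?_) i
  · simp only [Fin.snoc_last]
    exact (contMDiffOn_extChartAt_symm (I := 𝓘(ℝ, F)) (n := ∞) x₀).comp
      (contDiff_snd (E := Fin p → F)).contMDiff.contMDiffOn fun w hw => hw.2
  · simp only [Fin.snoc_castSucc]
    exact (contMDiffOn_chart_coordinate g₀ i).comp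
      (contDiff_fst (F := F)).contMDiff.contMDiffOn fun w hw => hw.1

/-- The evaluation of a differentiable family of functions is differentiable. -/
theorem IsDiffCochain.uncurry {f : (Fin p → G) → smoothForms F G 0} (hf : IsDiffCochain F f) :
    IsDiffCochain F fun k : Fin (p + 1) → G =>
      (f fun i => k i.castSucc : DForm F G 0).toFunction (k (Fin.last p)) := by
  refine isDiffCochain_real_iff.2 fun g₀ => contDiffOn_infty.2 fun n => ?_
  have h := contDiffOn_uncurry_of_contDiffTVS (isOpen_pi_chartAt_target fun i => g₀ i.castSucc)
    (g₀ (Fin.last p)) Fin.elim0 n 0 Fin.elim0 (hf (fun i => g₀ i.castSucc) n)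
  have hu : ContDiff ℝ n fun y : Fin (p + 1) → F => ((fun i : Fin p => y i.castSucc), y (Fin.last p)) :=
    (contDiff_pi.2 fun i => contDiff_apply ℝ F _).prodMk (contDiff_apply ℝ F _)
  refine (h.comp hu.contDiffOn fun y (hy : y ∈ Set.univ.pi _) => ⟨fun i _ => hy _ trivial, ?_⟩).congr fun y _ => ?_
  · simpa using hy (Fin.last p) trivial
  · simp only [Function.comp_apply, iteratedFDeriv_zero_apply, DForm.chartRep_zero_form]
    simp

theorem IsDiffCochain.comp {p' : ℕ} {c : (Fin p → G) → ℝ} (hc : IsDiffCochain F c)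
    {u : (Fin p' → G) → Fin p → G}
    (hu : ∀ (g₀ : Fin p' → G) i, ContMDiffOn 𝓘(ℝ, Fin p' → F) 𝓘(ℝ, F) ∞
      (fun y : Fin p' → F => u (fun j => (chartAt F (g₀ j)).symm (y j)) i)
      (Set.univ.pi fun j => (chartAt F (g₀ j)).target)) :
    IsDiffCochain F fun g => c (u g) :=
  isDiffCochain_real_iff.2 fun g₀ => hc.contDiffOn_comp (hu g₀)

end DifferentiableCochains

/-! ### Differentiability of the group differential evaluated at the identity. -/

section GroupCochains

variable {F : Type*} [NormedAddCommGroup F] [NormedSpace ℝ F] [FiniteDimensional ℝ F]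
  {G : Type*} [TopologicalSpace G] [ChartedSpace F G] [Group G] [LieGroup 𝓘(ℝ, F) ∞ G] {p : ℕ}

/-- At the identity each term is a value of the uncurried cochain at coordinates of g, products of
neighbours, or 1; smoothness of multiplication then suffices. -/
theorem IsDiffCochain.toFunction_deltaOne
    {f : (Fin p → G) → smoothForms F G 0} (hf : IsDiffCochain F f) :
    IsDiffCochain F fun g : Fin (p + 1) → G =>
      (deltaOne (fun h => (f h : DForm F G 0)) g).toFunction 1 := by
  have key : ∀ {u : (Fin (p + 1) → G) → Fin p → G} {w : (Fin (p + 1) → G) → G},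
      (∀ (g₀ : Fin (p + 1) → G) i, ContMDiffOn 𝓘(ℝ, Fin (p + 1) → F) 𝓘(ℝ, F) ∞
        (fun y : Fin (p + 1) → F => u (fun j => (chartAt F (g₀ j)).symm (y j)) i)
        (Set.univ.pi fun j => (chartAt F (g₀ j)).target)) →
      (∀ g₀ : Fin (p + 1) → G, ContMDiffOn 𝓘(ℝ, Fin (p + 1) → F) 𝓘(ℝ, F) ∞
        (fun y : Fin (p + 1) → F => w fun j => (chartAt F (g₀ j)).symm (y j))
        (Set.univ.pi fun j => (chartAt F (g₀ j)).target)) →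
      IsDiffCochain F fun g => (f (u g) : DForm F G 0).toFunction (w g) := by
    intro u w hu hw
    have := hf.uncurry.comp (u := fun g => Fin.snoc (u g) (w g)) fun g₀ i => by
      refine Fin.lastCases ?_ (fun i => ?_) i
      · simpa using hw g₀
      · simpa using hu g₀ i
    simpa using this
  have h : (fun g : Fin (p + 1) → G =>
      (deltaOne (fun h => (f h : DForm F G 0)) g).toFunction 1) = fun g =>
      (f fun i => g i.succ : DForm F G 0).toFunction 1
      + ∑ i : Fin p, (-1 : ℤ) ^ ((i : ℕ) + 1) •
        (f (Fin.contractNth i.castSucc (· * ·) g) : DForm F G 0).toFunction 1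
      + (-1 : ℤ) ^ (p + 1) • (f fun i => g i.castSucc : DForm F G 0).toFunction (g (Fin.last p)) := by
    funext g
    rw [toFunction_deltaOne_eq]
    simp [groupDiff, Finset.sum_apply]
  rw [h]
  refine ((key (fun g₀ i => contMDiffOn_chart_coordinate g₀ i.succ)
    fun _ => contMDiffOn_const).add (IsDiffCochain.sum _ fun i => IsDiffCochain.zsmul _ ?_)).add
    (IsDiffCochain.zsmul _ (key (fun g₀ i => contMDiffOn_chart_coordinate g₀ i.castSucc)
      fun g₀ => contMDiffOn_chart_coordinate g₀ (Fin.last p)))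
  refine key (fun g₀ k => ?_) fun _ => contMDiffOn_const
  unfold Fin.contractNth
  split_ifs
  · exact contMDiffOn_chart_coordinate g₀ _
  · exact (contMDiffOn_chart_coordinate g₀ _).mul (contMDiffOn_chart_coordinate g₀ _)
  · exact contMDiffOn_chart_coordinate g₀ _

end GroupCochains

/-! ### Comparison of primitives of the cocycle with solutions of the equation for f. -/

section Transgression

variable {F : Type*} [NormedAddCommGroup F] [NormedSpace ℝ F] [FiniteDimensional ℝ F]
  {G : Type*} [TopologicalSpace G] [ChartedSpace F G] [Group G] [LieGroup 𝓘(ℝ, F) ∞ G]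
  {E : Type*} [NormedAddCommGroup E] [NormedSpace ℝ E] [FiniteDimensional ℝ E]
  {M : Type*} [TopologicalSpace M] [ChartedSpace E M] [IsManifold 𝓘(ℝ, E) ∞ M]
  [MulAction G M] [ContMDiffSMul 𝓘(ℝ, F) 𝓘(ℝ, E) ∞ G M] {p q : ℕ}
  {c₁ : (Fin p → G) → smoothForms E M (q + 1)} {c₀ : (Fin (p + 1) → G) → smoothForms E M q}
  {α : SmoothChain E M q}

theorem DForm.d_zsmul {k : ℕ} (n : ℤ) (η : DForm E M k) : (n • η).d = n • η.d := by
  rw [← Int.cast_smul_eq_zsmul ℝ, ← Int.cast_smul_eq_zsmul ℝ, DForm.d_smul]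

/-- Real cochains embed as cochains of constant functions, which translation fixes. -/
theorem groupDiff_const (b : (Fin p → G) → ℝ) (g : Fin (p + 1) → G) (x : G) :
    groupDiff (fun g (a : G → ℝ) x => a (g * x)) (fun h _ => b h) g x =
      groupDiff (fun _ a => a) b g := by
  simp [groupDiff, Finset.sum_apply]

/-- The fibre integrals of a cochain, corrected by the coboundary of a cochain of functions. -/
def correctedIntegral (F : Type*) [NormedAddCommGroup F] [NormedSpace ℝ F] [ChartedSpace F G]
    (α : SmoothChain E M q) (c₀ : (Fin (p + 1) → G) → smoothForms E M q)
    (f : (Fin p → G) → smoothForms F G 0) (g : Fin (p + 1) → G) : DForm F G 0 :=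
  fGamma F (k := 0) α (c₀ g : DForm E M q)
    + (-1 : ℤ) ^ (p + 1) • deltaOne (fun h => (f h : DForm F G 0)) g

theorem differentiableOn_fGamma (η : smoothForms E M q) (x₀ : G) : DifferentiableOn ℝ
    (fun y => (fGamma F (k := 0) α (η : DForm E M q) : DForm F G 0).toFunction
      ((extChartAt 𝓘(ℝ, F) x₀).symm y)) (extChartAt 𝓘(ℝ, F) x₀).target := fun _ hy =>
  (hasFDerivAt_fGamma η.2 α x₀ hy).differentiableAt.differentiableWithinAt

theorem toFunction_correctedIntegral (f : (Fin p → G) → smoothForms F G 0)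
    (g : Fin (p + 1) → G) (x : G) : (correctedIntegral F α c₀ f g).toFunction x =
      (fGamma F (k := 0) α (c₀ g : DForm E M q) : DForm F G 0).toFunction x +
        (-1 : ℤ) ^ (p + 1) • (deltaOne (fun h => (f h : DForm F G 0)) g).toFunction x := by
  have h1 := map_add (toFunctionHom F G) (fGamma F (k := 0) α (c₀ g : DForm E M q))
    ((-1 : ℤ) ^ (p + 1) • deltaOne (fun h => (f h : DForm F G 0)) g)
  rw [map_zsmul] at h1
  exact congrFun h1 x

theorem isSmooth_zsmul {k : ℕ} (n : ℤ) {η : DForm E M k} (hη : η.IsSmooth) : (n • η).IsSmooth :=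
  (smoothForms E M k).toAddSubgroup.zsmul_mem hη n

theorem differentiableOn_correctedIntegral (f : (Fin p → G) → smoothForms F G 0)
    (g : Fin (p + 1) → G) (x₀ : G) : DifferentiableOn ℝ
      (fun y => (correctedIntegral F α c₀ f g).toFunction ((extChartAt 𝓘(ℝ, F) x₀).symm y))
      (extChartAt 𝓘(ℝ, F) x₀).target := by
  have h2 := (isSmooth_zsmul ((-1 : ℤ) ^ (p + 1)) (isSmooth_deltaOne F f g)).toFunction x₀
  exact (differentiableOn_fGamma (α := α) (c₀ g) x₀).add (h2.differentiableOn (by simp))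

theorem d_correctedIntegral (f : (Fin p → G) → smoothForms F G 0) (g : Fin (p + 1) → G) :
    (correctedIntegral F α c₀ f g).d = (fGamma F (k := 0) α (c₀ g : DForm E M q) : DForm F G 0).d +
      (-1 : ℤ) ^ (p + 1) • deltaOne (fun h => (f h : DForm F G 0).d) g := by
  rw [correctedIntegral, DForm.d_add (fun x => DForm.differentiableAt_zero_form
    ((differentiableOn_fGamma (α := α) (c₀ g) x).differentiableAt
      ((isOpen_extChartAt_target x).mem_nhds (mem_extChartAt_target x))))
    (isSmooth_zsmul _ (isSmooth_deltaOne F f g)).differentiableAt, DForm.d_zsmul, d_deltaOne F]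

/-- The pivot of both directions: f solves the equation exactly when all corrected fibre integrals
are closed. -/
theorem IsDescentStep.deltaOne_sub_d (H : IsDescentStep c₁ c₀) (hα : α.IsCycle)
    (f : (Fin p → G) → smoothForms F G 0) (g : Fin (p + 1) → G) :
    deltaOne (fun g => fGamma F (k := 1) α (c₁ g : DForm E M (q + 1)) - (f g : DForm F G 0).d) g =
      -((-1 : ℤ) ^ (p + 1) • (correctedIntegral F α c₀ f g).d) := by
  have hact := isRightAction_act F (G := G) F G 1
  have e : (fun g => fGamma F (k := 1) α (c₁ g : DForm E M (q + 1)) - (f g : DForm F G 0).d) =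
      fun g => fGamma F (k := 1) α (c₁ g : DForm E M (q + 1)) +
        (-1 : ℤ) • (f g : DForm F G 0).d := by
    funext g
    rw [neg_one_zsmul, sub_eq_add_neg]
  rw [e, deltaOne, groupDiff_add hact, groupDiff_zsmul hact, Pi.add_apply, Pi.smul_apply,
    d_correctedIntegral, smul_add, neg_one_pow_smul_smul, neg_add, neg_one_zsmul]
  congr 1
  exact H.deltaOne_fGamma_eq hα g

/-- At the identity the fibre integral is the integral over α itself, whose dependence on a cochain
is controlled by `IsDiffCochain.integral`. -/
theorem toFunction_fGamma_one (α : SmoothChain E M q) (η : smoothForms E M q) :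
    (fGamma F (k := 0) α (η : DForm E M q) : DForm F G 0).toFunction 1 =
      α.integral fun x v => (η : DForm E M q) x v := by
  rw [fGamma_zero_apply η.2, (isRightAction_act F (G := G) E M q).one]

theorem IsDescentStep.groupDiff_fGamma (H : IsDescentStep c₁ c₀) (hα : α.HasInvariantClass F G)
    (g : Fin (p + 2) → G) (x : G) :
    groupDiff (fun g (a : G → ℝ) x => a (g * x))
      (fun h => (fGamma F (k := 0) α (c₀ h : DForm E M q) : DForm F G 0).toFunction) g x =
      cocycleOf α c₀ g := by
  rw [← H.toFunction_deltaOne hα g x, toFunction_deltaOne_eq]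

/-- The first half of the comparison: a differentiable primitive of the cocycle yields a
differentiable correction of the fibre integrals. -/
theorem IsDescentStep.exists_correction (H : IsDescentStep c₁ c₀) (hα : α.IsCycle)
    (hαinv : α.HasInvariantClass F G) (hc₀ : IsDiffCochain F c₀)
    (h : IsTrivialDiff F (cocycleOf α c₀)) :
    ∃ f : (Fin p → G) → smoothForms F G 0, IsDiffCochain F f ∧
      deltaOne (fun g => fGamma F (k := 1) α (c₁ g : DForm E M (q + 1)) - (f g : DForm F G 0).d)
        = 0 := by
  obtain ⟨b, hb, hbc⟩ := h
  have htr := isRightAction_translation G ℝ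
  -- Both f_α∘c₀ and the constant cochain b have coboundary c_a, so their difference is a cocycle.
  let c : (Fin (p + 1) → G) → G → ℝ := fun g =>
    (fGamma F (k := 0) α (c₀ g : DForm E M q) : DForm F G 0).toFunction + (-1 : ℤ) • fun _ => b g
  have hc : groupDiff (fun g (a : G → ℝ) x => a (g * x)) c = 0 := by
    rw [groupDiff_add htr, groupDiff_zsmul htr]
    funext g x
    rw [Pi.add_apply, Pi.add_apply, Pi.smul_apply, Pi.smul_apply, H.groupDiff_fGamma hαinv,
      groupDiff_const, hbc, neg_one_zsmul, add_neg_cancel]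
    rfl
  -- The contraction uses `c` only at the identity, where it is ∫_α c₀ - b. The sign -1 is chosen so
  -- that δ'f, multiplied by (-1)^(p+1), equals -c and the corrected integral is b.
  have hdiff : IsDiffCochain F fun k => (-1 : ℤ) • c k 1 := by
    refine IsDiffCochain.zsmul _ ?_
    simp only [c, Pi.add_apply, Pi.smul_apply, toFunction_fGamma_one]
    exact (hc₀.integral α).add (hb.zsmul _)
  obtain ⟨f, hf, hfe⟩ := hdiff.curry
  refine ⟨f, hf, funext fun g => ?_⟩
  have hδ : (deltaOne (fun h => (f h : DForm F G 0)) g).toFunction =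
      (-1 : ℤ) • (-1 : ℤ) ^ (p + 1) • c g := by
    rw [toFunction_deltaOne_eq]
    simp only [hfe]
    have h1 := groupDiff_zsmul htr (-1) fun (g : Fin p → G) x => c (Fin.snoc g x) 1
    rw [groupDiff_contraction c hc] at h1
    exact congrFun h1 g
  have hconst : correctedIntegral F α c₀ f g = DForm.ofFunction F fun _ => b g := by
    refine DForm.ext_toFunction fun x => ?_
    rw [toFunction_correctedIntegral, hδ, neg_one_zsmul, Pi.neg_apply, Pi.smul_apply, smul_neg,
      neg_one_pow_smul_smul, DForm.toFunction_ofFunction]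
    simp [c]
  rw [H.deltaOne_sub_d hα, hconst, DForm.d_ofFunction_const, smul_zero, neg_zero, Pi.zero_apply]

/-- The second half of the comparison. -/
theorem IsDescentStep.isTrivialDiff [ConnectedSpace G] (H : IsDescentStep c₁ c₀) (hα : α.IsCycle)
    (hαinv : α.HasInvariantClass F G) (hc₀ : IsDiffCochain F c₀)
    {f : (Fin p → G) → smoothForms F G 0} (hf : IsDiffCochain F f)
    (h : deltaOne (fun g => fGamma F (k := 1) α (c₁ g : DForm E M (q + 1)) - (f g : DForm F G 0).d)
        = 0) : IsTrivialDiff F (cocycleOf α c₀) := by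
  have htr := isRightAction_translation G ℝ
  have hd : ∀ g, (correctedIntegral F α c₀ f g).d = 0 := fun g => by
    have h1 := congrFun h g
    rw [H.deltaOne_sub_d hα, Pi.zero_apply, neg_eq_zero] at h1
    rw [← neg_one_pow_smul_smul (p + 1) (correctedIntegral F α c₀ f g).d, h1, smul_zero]
  have hconst : ∀ g, (correctedIntegral F α c₀ f g).toFunction =
      fun _ => (correctedIntegral F α c₀ f g).toFunction 1 := fun g => funext fun x =>
    DForm.toFunction_eq_of_d_eq_zero (hd g) (differentiableOn_correctedIntegral f g) x 1
  -- The primitive is the constant value of each corrected integral, read off at 1, where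
  -- differentiability is known. The correction is a coboundary, so it does not affect the
  -- differential.
  refine ⟨fun g => (correctedIntegral F α c₀ f g).toFunction 1, ?_, funext fun g => ?_⟩
  · simp only [toFunction_correctedIntegral, toFunction_fGamma_one]
    exact (hc₀.integral α).add (hf.toFunction_deltaOne.zsmul _)
  · rw [← groupDiff_const _ g 1, ← H.groupDiff_fGamma hαinv g 1]
    rw [← funext hconst]
    have e : (fun g => (correctedIntegral F α c₀ f g).toFunction) = fun g =>
        (fGamma F (k := 0) α (c₀ g : DForm E M q) : DForm F G 0).toFunction +
          (-1 : ℤ) ^ (p + 1) • groupDiff (fun g (a : G → ℝ) x => a (g * x))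
            (fun h => (f h : DForm F G 0).toFunction) g := by
      funext g x
      rw [toFunction_correctedIntegral, toFunction_deltaOne_eq]
      rfl
    rw [e, groupDiff_add htr, groupDiff_zsmul htr, groupDiff_groupDiff htr, smul_zero, add_zero]

end Transgression

end

theorem mainTheorem7
    -- the Lie group `G` and the `G`-manifold `M`
    {F : Type*} [NormedAddCommGroup F] [NormedSpace ℝ F] [FiniteDimensional ℝ F]
    {G : Type*} [TopologicalSpace G] [ChartedSpace F G] [Group G] [LieGroup 𝓘(ℝ, F) ∞ G]
    {E : Type*} [NormedAddCommGroup E] [NormedSpace ℝ E] [FiniteDimensional ℝ E]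
    {M : Type*} [TopologicalSpace M] [T2Space M] [ChartedSpace E M] [IsManifold 𝓘(ℝ, E) ∞ M]
    [MulAction G M] [ContMDiffSMul 𝓘(ℝ, F) 𝓘(ℝ, E) ∞ G M]
    -- the invariant exact form `θ` of degree `m = p + q + 1`, so that `q = m - p - 1`
    {p q : ℕ} (hp : 1 ≤ p)
    (θ : smoothForms E M (p + q + 1)) (hexact : (θ : DForm E M (p + q + 1)).IsExact)
    (hinv : ∀ g : G, DForm.act g (θ : DForm E M (p + q + 1)) = θ)
    -- `H^{m-p}(M) = … = H^{m-1}(M) = 0` and `H^{m-p-1}(M) ≠ 0`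
    (hH : ∀ k, q + 1 ≤ k → k ≤ p + q → DeRhamVanishes E M k)
    (hH' : ¬ DeRhamVanishes E M q)
    -- the cochains `φ_{i,m-i-1}`, differentiable for `i = 1, …, p`
    (φ : ∀ i j : ℕ, (Fin i → G) → smoothForms E M j)
    (hφ : IsDescent p q (θ : DForm E M (p + q + 1)) φ)
    (hdiff : ∀ i j : ℕ, 1 ≤ i → i ≤ p → i + j = p + q → IsDiffCochain F (φ i j))
    -- the smooth singular cycle `α` with `G`-invariant homology class `a`
    (α : SmoothChain E M q) (hα : α.IsCycle) (hαinv : α.HasInvariantClass F G) :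
    (IsTrivialDiff F (cocycleOf α (φ p q)) →
      ∃ f : (Fin (p - 1) → G) → smoothForms F G 0, IsDiffCochain F f ∧
        deltaOne (fun g => fGamma F α (φ (p - 1) (q + 1) g : DForm E M (q + 1))
          - (f g : DForm F G 0).d) = 0) ∧
    (ConnectedSpace G →
      (∃ f : (Fin (p - 1) → G) → smoothForms F G 0, IsDiffCochain F f ∧
        deltaOne (fun g => fGamma F α (φ (p - 1) (q + 1) g : DForm E M (q + 1))
          - (f g : DForm F G 0).d) = 0) →
      IsTrivialDiff F (cocycleOf α (φ p q))) := by
  -- Writing p as a successor makes the index p - 1 definitionally usable and exposes the last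
  -- relation of the descent.
  obtain ⟨p, rfl⟩ := Nat.exists_eq_add_of_le' hp
  have H : IsDescentStep (φ p (q + 1)) (φ (p + 1) q) :=
    ⟨hφ.step p q le_rfl rfl⟩
  have hc₀ := hdiff (p + 1) q (by omega) le_rfl rfl
  refine ⟨fun h => H.exists_correction hα hαinv hc₀ h, fun _ h => ?_⟩
  obtain ⟨f, hf, hf'⟩ := h
  exact H.isTrivialDiff hα hαinv hc₀ hf hf'
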